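/- Let $D\subset\mathbb R^2$ be a compact convex polygon with non-empty interior. A tessellation of $D$ is a finite subdivision of $D$ into convex polygons (cells) with disjoint interiors. Its vertices are the vertices of its cells; its edges are the line segments contained in sides of cells, ending at vertices and containing no other vertex between their ends; its segments are the maximal unions of aligned and contiguous edges, and a segment is internal if it does not lie on $\partial D$. A T-tessellation of $D$ is a tessellation such that every vertex other than those of $D$ lies on exactly three edges, two of which are aligned, and such that no two distinct segments are aligned. Let $\mathcal T$ be the set of T-tessellations of $D$, with the $\sigma$-algebra generated by the events that the union of the edges hits $K$, $K\subset D$ compact. Let $T_D\in\mathcal T$ be the empty tessellation, whose only cell is $D$. Updates of $T\in\mathcal T$, in each case required to produce an element of $\mathcal T$, are of three types. A split $S=(c,l)$ divides a cell $c$ by a line $l$ meeting its interior; $\mathcal S_T$ denotes the set of splits of $T$, and $dS$ the product of the counting measure on cells and of the motion-invariant measure on lines (scaled so that the lines hitting a unit square have mass $4/\pi$), restricted to $\mathcal S_T$. A merge $M\in\mathcal M_T$ deletes an internal segment consisting of a single edge. A flip $F\in\mathcal F_T$ deletes the edge at one end of an internal segment consisting of several edges and, at the other vertex of the deleted edge,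 extends the segment which was blocked there by a new edge up to the next segment. The reverse of a split is a merge and conversely, and the reverse of a flip is a flip: $\mathrm s^{-1}=\mathrm m$, $\mathrm m^{-1}=\mathrm s$, $\mathrm f^{-1}=\mathrm f$. Let $h\ge 0$ and $p_{\mathrm s},p_{\mathrm m},p_{\mathrm f}\ge 0$ be measurable functions on $\mathcal T$ with $p_{\mathrm s}+p_{\mathrm m}+p_{\mathrm f}=1$, and let $q_{\mathrm s},q_{\mathrm m},q_{\mathrm f}\ge0$ be measurable functions of pairs $(T,U)$ (an update $U$ of $T$ being identified with $UT$) such that $q_{\mathrm s}(T,\cdot)$ is a probability density with respect to $dS$ on $\mathcal S_T$, and $q_{\mathrm m}(T,\cdot)$, $q_{\mathrm f}(T,\cdot)$ are probability distributions on $\mathcal M_T$, $\mathcal F_T$ whenever these sets are non-empty. Let $(\mathbf T_n)$ be the Metropolis–Hastings–Green Markov chain on $\mathcal T$ which evolves as follows: given $\mathbf T_n=T$, draw a type $t\in\{\mathrm s,\mathrm m,\mathrm f\}$ with probabilities $p_t(T)$; if no update of type $t$ is applicable to $T$, put $\mathbf T_{n+1}=T$; otherwise draw $U$ from $q_t(T,\cdot)$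 and put $\mathbf T_{n+1}=UT$ with probability $\min\{1,r_t(T,U)\}$ and $\mathbf T_{n+1}=T$ otherwise, where $$r_t(T,U)=\frac{h(UT)}{h(T)}\,\frac{p_{t^{-1}}(UT)}{p_t(T)}\,\frac{q_{t^{-1}}(UT,U^{-1})}{q_t(T,U)}\in[0,\infty]$$ with $a/0=\infty$ for $a>0$, $0/0=0$ and $0\cdot\infty=0$. Assume that 1. for every $T\in\mathcal T$ with $\mathcal M_T\neq\emptyset$ there is $M\in\mathcal M_T$ such that $p_{\mathrm m}(T)q_{\mathrm m}(T,M)>0$ and $h(MT)p_{\mathrm s}(MT)q_{\mathrm s}(MT,M^{-1})>0$; 2. $h(T)p_{\mathrm f}(T)q_{\mathrm f}(T,F)>0$ for every $T\in\mathcal T$ and every $F\in\mathcal F_T$. Then $(\mathbf T_n)$ is $\psi$-irreducible, where $\psi$ is the point mass at $T_D$: for every $T\in\mathcal T$ and every measurable $B\subset\mathcal T$ with $T_D\in B$ there is an integer $m\ge1$ with $\mathbb P(\mathbf T_m\in B\mid \mathbf T_0=T)>0$. -/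

import Mathlib

open MeasureTheory ProbabilityTheory Set
open scoped NNReal ENNReal

noncomputable section

namespace TTess

/-- The Euclidean plane. -/
abbrev Plane := EuclideanSpace ℝ (Fin 2)

/-- Compact convex polygons with non-empty interior. -/
def IsConvexPolygon (K : Set Plane) : Prop :=
  (interior K).Nonempty ∧ ∃ F : Set Plane, F.Finite ∧ K = convexHull ℝ F

/-- The sides of a convex polygon. -/
def IsSide (K a : Set Plane) : Prop :=
  ∃ x ∈ K.extremePoints ℝ, ∃ y ∈ K.extremePoints ℝ,
    x ≠ y ∧ a = segment ℝ x y ∧ a ⊆ frontier K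

/-- A finite subdivision of `D` into convex polygons with disjoint interiors. (If every vertex
other than those of `D` is a T-vertex, no cell has a reflex angle, so that convexity of the
cells of a T-tessellation is no restriction.) -/
@[ext]
structure Tessellation (D : Set Plane) where
  cells : Set (Set Plane)
  finite_cells : cells.Finite
  isConvexPolygon : ∀ c ∈ cells, IsConvexPolygon c
  sUnion_cells : ⋃₀ cells = D
  disjoint_interior : ∀ c ∈ cells, ∀ c' ∈ cells, c ≠ c' → Disjoint (interior c) (interior c')

namespace Tessellation

variable {D : Set Plane} (T : Tessellation D)

/-- The vertices are the vertices of the cells. -/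
def vertices : Set Plane := ⋃ c ∈ T.cells, c.extremePoints ℝ

/-- Edges: line segments contained in a side of a cell, ending at vertices and containing no
other vertex between their ends. -/
def IsEdge (e : Set Plane) : Prop :=
  ∃ x ∈ T.vertices, ∃ y ∈ T.vertices, x ≠ y ∧ e = segment ℝ x y ∧
    (∃ c ∈ T.cells, ∃ a, IsSide c a ∧ e ⊆ a) ∧ Disjoint (openSegment ℝ x y) T.vertices

/-- The union of all edges. -/
def skeleton : Set Plane := ⋃₀ {e | T.IsEdge e}

/-- A non-degenerate line segment which is a union of (aligned and contiguous) edges. -/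
def IsEdgeRun (s : Set Plane) : Prop :=
  (∃ x y, x ≠ y ∧ s = segment ℝ x y) ∧ ∃ E ⊆ {e | T.IsEdge e}, s = ⋃₀ E

/-- The segments of a tessellation: maximal runs of aligned and contiguous edges. -/
def IsSegment (s : Set Plane) : Prop := Maximal T.IsEdgeRun s

/-- Internal segments: those which do not lie on the boundary of the domain. -/
def IsInternalSegment (s : Set Plane) : Prop := T.IsSegment s ∧ ¬ s ⊆ frontier D

/-- T-vertices: exactly three edges meet there, and two of them are aligned. -/
def IsTVertex (v : Plane) : Prop :=
  {e | T.IsEdge e ∧ v ∈ e}.ncard = 3 ∧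
    ∃ e₁ e₂, T.IsEdge e₁ ∧ T.IsEdge e₂ ∧ v ∈ e₁ ∧ v ∈ e₂ ∧ e₁ ≠ e₂ ∧ Collinear ℝ (e₁ ∪ e₂)

end Tessellation

/-- T-tessellations of `D`: all vertices, except those of `D`, are T-vertices, and there is no
pair of distinct and aligned segments. -/
@[ext]
structure TTessellation (D : Set Plane) extends Tessellation D where
  isTVertex : ∀ v ∈ toTessellation.vertices, v ∉ D.extremePoints ℝ → toTessellation.IsTVertex v
  eq_of_collinear : ∀ s s', toTessellation.IsSegment s → toTessellation.IsSegment s' →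
    Collinear ℝ (s ∪ s') → s = s'

/-- On a line there is at most one pair of extreme points of a given set. -/
theorem segment_eq_of_collinear_extremePoints {K : Set Plane} {x y z w : Plane}
    (hx : x ∈ K.extremePoints ℝ) (hy : y ∈ K.extremePoints ℝ)
    (hz : z ∈ K.extremePoints ℝ) (hw : w ∈ K.extremePoints ℝ)
    (hxy : x ≠ y) (hzw : z ≠ w) (h : Collinear ℝ ({x, y, z, w} : Set Plane)) :
    segment ℝ x y = segment ℝ z w := by
  have key : ∀ {a b c : Plane}, a ∈ K.extremePoints ℝ → b ∈ K.extremePoints ℝ →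
      c ∈ K.extremePoints ℝ → Wbtw ℝ a b c → b = a ∨ b = c := by
    intro a b c ha hb hc hw
    by_contra! hne
    have hb' : b ∈ openSegment ℝ a c :=
      mem_openSegment_of_ne_left_right hne.1.symm hne.2.symm (mem_segment_iff_wbtw.2 hw)
    exact hne.1 (hb.2 ha.1 hc.1 hb').symm
  have third : ∀ {a}, a ∈ K.extremePoints ℝ → Collinear ℝ ({x, y, a} : Set Plane) →
      a = x ∨ a = y := by
    intro a ha hc
    rcases hc.wbtw_or_wbtw_or_wbtw with h1 | h1 | h1
    · rcases key hx hy ha h1 with h2 | h2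
      · exact absurd h2.symm hxy
      · exact Or.inr h2.symm
    · rcases key hy ha hx h1 with h2 | h2
      · exact Or.inr h2
      · exact Or.inl h2
    · rcases key ha hx hy h1 with h2 | h2
      · exact Or.inl h2.symm
      · exact absurd h2 hxy
  have hz' := third hz (h.subset (by intro a; simp; tauto))
  have hw' := third hw (h.subset (by intro a; simp; tauto))
  rcases hz' with rfl | rfl <;> rcases hw' with rfl | rfl
  · exact absurd rfl hzw
  · rfl
  · exact segment_symm ℝ _ _
  · exact absurd rfl hzw

/-- The empty tessellation, whose only cell is the whole domain. -/
def emptyTessellation {D : Set Plane} (hD : IsConvexPolygon D) : TTessellation D where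
  cells := {D}
  finite_cells := finite_singleton D
  isConvexPolygon := by rintro c rfl; exact hD
  sUnion_cells := sUnion_singleton D
  disjoint_interior := by rintro c rfl c' rfl h; exact absurd rfl h
  isTVertex := by
    intro v hv hv'
    simp [Tessellation.vertices] at hv
    exact absurd hv hv'
  eq_of_collinear := by
    rintro s s' ⟨⟨⟨x, y, hxy, hs⟩, E, hE, hsE⟩, -⟩ ⟨⟨⟨x', y', hxy', hs'⟩, E', hE', hsE'⟩, -⟩ hcol
    have hne : E.Nonempty := by
      rw [nonempty_iff_ne_empty]
      rintro rfl
      have : x ∈ s := hs ▸ left_mem_segment ℝ x y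
      simp [hsE] at this
    have hne' : E'.Nonempty := by
      rw [nonempty_iff_ne_empty]
      rintro rfl
      have : x' ∈ s' := hs' ▸ left_mem_segment ℝ x' y'
      simp [hsE'] at this
    have all : ∀ e ∈ E ∪ E', ∀ f ∈ E ∪ E', e = f := by
      have sub : ∀ e ∈ E ∪ E', e ⊆ s ∪ s' := by
        rintro e (he | he)
        · exact (subset_sUnion_of_mem he).trans (hsE ▸ subset_union_left)
        · exact (subset_sUnion_of_mem he).trans (hsE' ▸ subset_union_right)
      intro e he f hf
      have he1 := sub e he
      have hf1 := sub f hf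
      have he2 := union_subset hE hE' he
      have hf2 := union_subset hE hE' hf
      obtain ⟨a, ha, b, hb, hab, rfl, -⟩ := he2
      obtain ⟨c, hc, d, hd, hcd, rfl, -⟩ := hf2
      simp only [Tessellation.vertices, mem_singleton_iff, iUnion_iUnion_eq_left] at ha hb hc hd
      refine segment_eq_of_collinear_extremePoints ha hb hc hd hab hcd (hcol.subset ?_)
      rintro p (rfl | rfl | rfl | rfl)
      · exact he1 (left_mem_segment ℝ _ _)
      · exact he1 (right_mem_segment ℝ _ _)
      · exact hf1 (left_mem_segment ℝ _ _)
      · exact hf1 (right_mem_segment ℝ _ _)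
    obtain ⟨e, he⟩ := hne
    obtain ⟨f, hf⟩ := hne'
    have h1 : s = e := by
      rw [hsE]
      refine subset_antisymm (sUnion_subset fun g hg => ?_) (subset_sUnion_of_mem he)
      exact (all g (Or.inl hg) e (Or.inl he)).subset
    have h2 : s' = f := by
      rw [hsE']
      refine subset_antisymm (sUnion_subset fun g hg => ?_) (subset_sUnion_of_mem hf)
      exact (all g (Or.inr hg) f (Or.inr hf)).subset
    rw [h1, h2]
    exact all e (Or.inl he) f (Or.inr hf)

/-- The hitting σ-algebra on the space of T-tessellations. -/
instance instMeasurableSpaceTTessellation (D : Set Plane) : MeasurableSpace (TTessellation D) :=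
  MeasurableSpace.generateFrom
    {A | ∃ K : Set Plane, IsCompact K ∧ K ⊆ D ∧
      A = {T : TTessellation D | (T.skeleton ∩ K).Nonempty}}

/-- The line with unit normal `(cos θ, sin θ)` at signed distance `r` from the origin, for
`ℓ = (θ, r)`. Every line has exactly one such representation with `0 ≤ θ < π`. -/
def line (ℓ : ℝ × ℝ) : Set Plane := {x | x 0 * Real.cos ℓ.1 + x 1 * Real.sin ℓ.1 = ℓ.2}

/-- The motion-invariant measure on lines, scaled such that the lines hitting a unit square have
mass `4 / π`. -/
def lineMeasure : Measure (ℝ × ℝ) :=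
  ENNReal.ofReal (1 / Real.pi) • (volume.restrict (Ico 0 Real.pi ×ˢ univ))

variable {D : Set Plane}

/-- `T'` is obtained from `T` by dividing the cell `c` by the line `l`. -/
def IsSplitBy (T : TTessellation D) (c l : Set Plane) (T' : TTessellation D) : Prop :=
  c ∈ T.cells ∧ (l ∩ interior c).Nonempty ∧ T'.skeleton = T.skeleton ∪ (l ∩ c)

/-- `T'` is obtained from `T` by a split. -/
def IsSplit (T T' : TTessellation D) : Prop :=
  ∃ ℓ : ℝ × ℝ, ℓ.1 ∈ Ico 0 Real.pi ∧ ∃ c, IsSplitBy T c (line ℓ) T'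

/-- `T'` is obtained from `T` by a merge: the deletion of an internal segment consisting of a
single edge (a non-blocking segment). The closure puts back its two ends, which belong to other
edges. -/
def IsMerge (T T' : TTessellation D) : Prop :=
  ∃ s, T.IsInternalSegment s ∧ T.IsEdge s ∧ T'.skeleton = closure (T.skeleton \ s)

/-- `T'` is obtained from `T` by a flip: the edge `[v, b]` at the end `b` of the blocking
internal segment `[a, b]` is deleted, and the segment `[c, v]`, which was blocked at `v` by
`[a, b]`, is extended by the new edge `[v, x]` until it meets the next segment, at `x`. -/
def IsFlip (T T' : TTessellation D) : Prop :=
  ∃ a b v c x : Plane,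
    T.IsInternalSegment (segment ℝ a b) ∧ ¬ T.IsEdge (segment ℝ a b) ∧
    v ∈ openSegment ℝ a b ∧ T.IsEdge (segment ℝ v b) ∧
    T.IsSegment (segment ℝ c v) ∧ v ∈ openSegment ℝ c x ∧
    x ∈ T.skeleton ∧ Disjoint (openSegment ℝ v x) T.skeleton ∧
    T'.skeleton = closure (T.skeleton \ segment ℝ v b) ∪ segment ℝ v x

/-- The three types of updates. -/
inductive UpdateType
  | split
  | merge
  | flip

/-- The type of the reverse update. -/
def UpdateType.inv : UpdateType → UpdateType
  | .split => .merge
  | .merge => .split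
  | .flip => .flip

/-- `T'` is obtained from `T` by an update of type `t`. As an update of `T` is determined by its
type and its result `T'`, an update of `T` is represented by its result. -/
def IsUpdate : UpdateType → TTessellation D → TTessellation D → Prop
  | .split => IsSplit
  | .merge => IsMerge
  | .flip => IsFlip

/-- There is an update of type `t` which is applicable to `T`. -/
def Applicable (t : UpdateType) (T : TTessellation D) : Prop := ∃ T', IsUpdate t T T'

/-- The integral of `U ↦ f (U T)` over the updates `U` of type `t` applicable to `T`. For splits
`U = (c, l)` this is with respect to the counting measure on cells times the measure on lines,
restricted to the pairs `(c, l)` such that `l` splits `c` (the innermost sum has one term if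
dividing `c` by `l` yields a T-tessellation, none otherwise); for merges and flips it is the sum
over the finite set of updates. -/
def updateIntegral (t : UpdateType) (T : TTessellation D) (f : TTessellation D → ℝ≥0∞) : ℝ≥0∞ :=
  match t with
  | .split => ∫⁻ ℓ, ∑' c : T.cells, ∑' T' : {T' // IsSplitBy T c (line ℓ) T'}, f T' ∂lineMeasure
  | .merge => ∑' T' : {T' // IsMerge T T'}, f T'
  | .flip => ∑' T' : {T' // IsFlip T T'}, f T'

/-- The inputs of the algorithm: the unnormalized density `h`, the probabilities `p t T` of
considering an update of type `t`, and the proposal densities `q t T (U T)`. The values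
`q t T T'` where `T'` is not the result of an update of type `t` of `T` play no role. -/
structure MHGInput (D : Set Plane) where
  h : TTessellation D → ℝ≥0
  p : UpdateType → TTessellation D → ℝ≥0
  q : UpdateType → TTessellation D → TTessellation D → ℝ≥0
  measurable_h : Measurable h
  measurable_p : ∀ t, Measurable (p t)
  measurable_q : ∀ t, Measurable (Function.uncurry (q t))
  sum_p : ∀ T, p .split T + p .merge T + p .flip T = 1
  integral_q : ∀ t T, Applicable t T → updateIntegral t T (fun T' => q t T T') = 1

namespace MHGInput

variable (I : MHGInput D)

/-- The Hastings ratio, in `[0, ∞]`. Here `a / 0 = ∞` for `a > 0`, and `0 / 0 = 0`. -/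
def hastingsRatio (t : UpdateType) (T T' : TTessellation D) : ℝ≥0∞ :=
  ((I.h T' : ℝ≥0∞) / I.h T) * ((I.p t.inv T' : ℝ≥0∞) / I.p t T) *
    ((I.q t.inv T' T : ℝ≥0∞) / I.q t T T')

/-- The probability of accepting the update from `T` to `T'`. -/
def acceptance (t : UpdateType) (T T' : TTessellation D) : ℝ≥0∞ := min 1 (I.hastingsRatio t T T')

open Classical in
/-- The conditional probability that the next state is in `B`, given that the current state
is `T` and that an update of type `t` is considered. -/
def typeTransition (t : UpdateType) (T : TTessellation D) (B : Set (TTessellation D)) : ℝ≥0∞ :=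
  if Applicable t T then
    updateIntegral t T (fun T' => I.q t T T' *
      (I.acceptance t T T' * B.indicator 1 T' + (1 - I.acceptance t T T') * B.indicator 1 T))
  else B.indicator 1 T

/-- The probability that the next state of the algorithm is in `B`, given that the current state
is `T`. -/
def transition (T : TTessellation D) (B : Set (TTessellation D)) : ℝ≥0∞ :=
  I.p .split T * I.typeTransition .split T B + I.p .merge T * I.typeTransition .merge T B +
    I.p .flip T * I.typeTransition .flip T B

/-- `κ` is the transition kernel of the Markov chain defined by the algorithm. -/
def IsTransitionKernel (κ : Kernel (TTessellation D) (TTessellation D)) : Prop :=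
  ∀ T B, MeasurableSet B → κ T B = I.transition T B

end MHGInput

/-- `ψ`-irreducibility of a Markov chain with transition kernel `κ`: every measurable set of
positive `ψ`-measure is reached with positive probability from every state, after a positive
number of steps. (`ProbabilityTheory.Kernel.IsIrreducible` is weaker: it allows zero steps.) -/
def IsPsiIrreducible {α : Type*} [MeasurableSpace α] (ψ : Measure α) (κ : Kernel α α) : Prop :=
  ∀ B, MeasurableSet B → 0 < ψ B → ∀ x, ∃ n : ℕ, 1 ≤ n ∧ 0 < (κ ^ n) x B

end TTess

end

/-! From every T-tessellation, moves of positive probability lead to the empty one. If a merge is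
applicable, the first hypothesis supplies one of positive probability. Since aligned segments are
equal, the line of the deleted segment then carries nothing any more, so one of the finitely many
lines carrying internal segments disappears. If no merge is applicable, every internal segment `[a,
b]` has vertices inside. Its last edge `[v, b]` is then a candidate for a flip: it is deleted, and
the segment arriving at `v` is prolonged to the next point `x` of the skeleton. A flip creates no
new carrying line. It keeps the line `L` of `[a, b]`, but removes a node from it. Flips of this kind
on `L` must therefore come to an end at a tessellation with an applicable merge.

The obstacle is that `x` may already be a vertex, in which case the result is no T-tessellation.
This happens only at a corner of `D` or where three carrying lines meet. The remedy is to split,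
before the flip, the cell crossed by the prolongation. The dividing line separates `v` from `x`,
does not meet `L` in this cell, and avoids all vertices and all crossings of carrying lines. The
prolongation then stops at the new chord. As this adds a line, progress is measured on the set `O`
of the initial lines: lexicographically by the number of lines of `O` which still carry an internal
segment, the number of nodes on one of them, and the number of all lines carrying internal segments.
The added lines are generic (`Generic`). Once `O` is exhausted, every candidate is a genuine flip
(`FlipData.x_notMem_vertices`) and no split is needed. This induction is `mem_of_closed`; its main
step is `FlipData.exists_split_flip`.

On the probabilistic side, flips and their reverses are proposed with positive probability by the
second hypothesis. A split of `T` into `T'` is used only when no merge applies to `T`. The only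
merge of `T'` is then the reverse of the split, so the first hypothesis at `T'` yields the
positivity of both proposals; `h` is positive at `T'` because a flip applies to `T'`. Splits have a
density, so an open set of dividing lines is used rather than a single line.

The geometry is expressed through skeletons. A tessellation is determined by its skeleton. It is a
T-tessellation when, off the corners of `D`, the skeleton is locally a line or a T (`IsFlatAt`,
`IsTeeAt`) and aligned pieces are joined (`AlignedConvex`). Each operation is carried out on cells,
and these two properties are then checked on the new skeleton (`TTessellation.ofSkeleton`). -/

open Filter Topology

namespace TTess

/-! ### Plane geometry -/

/-- The cross product of two vectors of the plane. -/
def cross (u v : Plane) : ℝ := u 0 * v 1 - u 1 * v 0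

theorem cross_add_right (u v w : Plane) : cross u (v + w) = cross u v + cross u w := by
  simp only [cross, PiLp.add_apply]; ring

theorem cross_sub_right (u v w : Plane) : cross u (v - w) = cross u v - cross u w := by
  simp only [cross, PiLp.sub_apply]; ring

theorem cross_smul_right (u v : Plane) (a : ℝ) : cross u (a • v) = a * cross u v := by
  simp only [cross, PiLp.smul_apply, smul_eq_mul]; ring

theorem cross_smul_left (u v : Plane) (a : ℝ) : cross (a • u) v = a * cross u v := by
  simp only [cross, PiLp.smul_apply, smul_eq_mul]; ring

theorem cross_neg_right (u v : Plane) : cross u (-v) = -cross u v := by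
  simp only [cross, PiLp.neg_apply]; ring

theorem cross_neg_left (u v : Plane) : cross (-u) v = -cross u v := by
  simp only [cross, PiLp.neg_apply]; ring

theorem cross_self (u : Plane) : cross u u = 0 := by simp only [cross]; ring

theorem cross_zero_right (u : Plane) : cross u 0 = 0 := by simp [cross]

theorem cross_zero_left (u : Plane) : cross 0 u = 0 := by simp [cross]

theorem cross_swap (u v : Plane) : cross u v = -cross v u := by simp only [cross]; ring

theorem plane_ext {u v : Plane} (h0 : u 0 = v 0) (h1 : u 1 = v 1) : u = v := by
  ext i; fin_cases i
  · exact h0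
  · exact h1

theorem continuous_cross (u : Plane) : Continuous (cross u) := by unfold cross; fun_prop

theorem exists_smul_of_cross_eq_zero {d u : Plane} (hd : d ≠ 0) (h : cross d u = 0) :
    ∃ τ : ℝ, u = τ • d := by
  by_cases h0 : d 0 = 0
  · have h1 : d 1 ≠ 0 := fun h1 => hd (plane_ext (by simpa using h0) (by simpa using h1))
    refine ⟨u 1 / d 1, plane_ext ?_ ?_⟩
    · simp only [cross, h0, zero_mul, zero_sub, neg_eq_zero, mul_eq_zero, h1, false_or] at h
      simp [h, h0]
    · simp [h1]
  · refine ⟨u 0 / d 0, plane_ext ?_ ?_⟩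
    · simp [h0]
    · simp only [cross] at h
      simp only [PiLp.smul_apply, smul_eq_mul]
      field_simp
      linarith

theorem exists_cross_pos {d : Plane} (hd : d ≠ 0) : ∃ n, 0 < cross d n := by
  refine ⟨!₂[-d 1, d 0], ?_⟩
  have : d 0 ≠ 0 ∨ d 1 ≠ 0 := by
    by_contra! h
    exact hd (plane_ext (by simpa using h.1) (by simpa using h.2))
  simp only [cross, Matrix.cons_val_one, Matrix.cons_val_zero,
    Matrix.cons_val_fin_one]
  rcases this with h | h
  · nlinarith [sq_nonneg (d 1), sq_pos_of_ne_zero h]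
  · nlinarith [sq_nonneg (d 0), sq_pos_of_ne_zero h]

theorem ne_zero_left_of_cross {d e : Plane} (h : cross d e ≠ 0) : d ≠ 0 := by
  rintro rfl; exact h (cross_zero_left e)

theorem ne_zero_right_of_cross {d e : Plane} (h : cross d e ≠ 0) : e ≠ 0 := by
  rintro rfl; exact h (cross_zero_right d)

/-- Every linear functional on the plane is a cross product. -/
theorem exists_cross_eq (f : Plane →L[ℝ] ℝ) : ∃ d : Plane, ∀ z, f z = cross d z := by
  refine ⟨!₂[f (EuclideanSpace.single 1 1), -f (EuclideanSpace.single 0 1)], fun z => ?_⟩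
  have hz : z = z 0 • EuclideanSpace.single (0 : Fin 2) (1 : ℝ) +
      z 1 • EuclideanSpace.single (1 : Fin 2) (1 : ℝ) := by
    apply plane_ext <;> simp
  conv_lhs => rw [hz]
  simp only [map_add, map_smul, smul_eq_mul, cross, Matrix.cons_val_one,
    Matrix.cons_val_zero, Matrix.cons_val_fin_one]
  ring

theorem mem_seg {x y z : Plane} :
    z ∈ segment ℝ x y ↔ ∃ τ : ℝ, 0 ≤ τ ∧ τ ≤ 1 ∧ z = x + τ • (y - x) := by
  rw [segment_eq_image']
  constructor
  · rintro ⟨τ, h, rfl⟩; exact ⟨τ, h.1, h.2, rfl⟩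
  · rintro ⟨τ, h, h', rfl⟩; exact ⟨τ, ⟨h, h'⟩, rfl⟩

theorem mem_oseg {x y z : Plane} :
    z ∈ openSegment ℝ x y ↔ ∃ τ : ℝ, 0 < τ ∧ τ < 1 ∧ z = x + τ • (y - x) := by
  rw [openSegment_eq_image']
  constructor
  · rintro ⟨τ, h, rfl⟩; exact ⟨τ, h.1, h.2, rfl⟩
  · rintro ⟨τ, h, h', rfl⟩; exact ⟨τ, ⟨h, h'⟩, rfl⟩

theorem cross_eq_zero_of_mem_seg {x y z : Plane} (h : z ∈ segment ℝ x y) :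
    cross (y - x) (z - x) = 0 := by
  obtain ⟨τ, -, -, rfl⟩ := mem_seg.1 h
  rw [add_sub_cancel_left, cross_smul_right, cross_self, mul_zero]

theorem add_smul_mem_seg {p d : Plane} {α β γ : ℝ} (h1 : α ≤ β) (h2 : β ≤ γ) :
    p + β • d ∈ segment ℝ (p + α • d) (p + γ • d) := by
  rcases eq_or_lt_of_le (h1.trans h2) with h | h
  · have h3 : α = β := by linarith
    rw [h3]; exact left_mem_segment ℝ _ _
  · refine mem_seg.2 ⟨(β - α) / (γ - α), by apply div_nonneg <;> linarith,
      by rw [div_le_one] <;> linarith, ?_⟩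
    have : γ - α ≠ 0 := by linarith
    rw [show p + γ • d - (p + α • d) = (γ - α) • d by module, smul_smul, div_mul_cancel₀ _ this]
    module

theorem mem_seg_add_smul {p d z : Plane} {α γ : ℝ} (h : α ≤ γ)
    (hz : z ∈ segment ℝ (p + α • d) (p + γ • d)) : ∃ β, α ≤ β ∧ β ≤ γ ∧ z = p + β • d := by
  obtain ⟨τ, h0, h1, rfl⟩ := mem_seg.1 hz
  refine ⟨α + τ * (γ - α), by nlinarith, by nlinarith, by module⟩

theorem add_smul_mem_oseg {p d : Plane} {α β γ : ℝ} (h1 : α < β) (h2 : β < γ) :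
    p + β • d ∈ openSegment ℝ (p + α • d) (p + γ • d) := by
  have h : α < γ := h1.trans h2
  refine mem_oseg.2 ⟨(β - α) / (γ - α), by apply div_pos <;> linarith,
      by rw [div_lt_one] <;> linarith, ?_⟩
  have : γ - α ≠ 0 := by linarith
  rw [show p + γ • d - (p + α • d) = (γ - α) • d by module, smul_smul, div_mul_cancel₀ _ this]
  module

theorem mem_oseg_add_smul {p d z : Plane} {α γ : ℝ} (h : α < γ)
    (hz : z ∈ openSegment ℝ (p + α • d) (p + γ • d)) : ∃ β, α < β ∧ β < γ ∧ z = p + β • d := by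
  obtain ⟨τ, h0, h1, rfl⟩ := mem_oseg.1 hz
  refine ⟨α + τ * (γ - α), by nlinarith, by nlinarith, by module⟩

theorem sub_ne_zero_of_oseg {x y z : Plane} (hxy : x ≠ y) (h : z ∈ openSegment ℝ x y) :
    z ≠ x ∧ z ≠ y := by
  obtain ⟨τ, h0, h1, rfl⟩ := mem_oseg.1 h
  have hd : y - x ≠ 0 := sub_ne_zero.2 hxy.symm
  constructor
  · intro h
    have : τ • (y - x) = 0 := by simpa using h
    rcases smul_eq_zero.1 this with h | h
    · linarith
    · exact hd h
  · intro h
    have : (1 - τ) • (y - x) = 0 := by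
      rw [show (1 - τ) • (y - x) = y - (x + τ • (y - x)) by module, h, sub_self]
    rcases smul_eq_zero.1 this with h | h
    · linarith
    · exact hd h

theorem mem_seg_iff_oseg {x y z : Plane} :
    z ∈ segment ℝ x y ↔ z = x ∨ z = y ∨ z ∈ openSegment ℝ x y := by
  rw [← insert_endpoints_openSegment]; simp

theorem oseg_ray_tendsto (p d : Plane) : Tendsto (fun τ : ℝ => p + τ • d) (𝓝 0) (𝓝 p) := by
  have : Continuous (fun τ : ℝ => p + τ • d) := by fun_prop
  simpa using this.tendsto 0

/-- A property that holds near `p` holds on a short segment around `p`. -/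
theorem exists_small {p d : Plane} {P : Plane → Prop} (h : ∀ᶠ z in 𝓝 p, P z) :
    ∃ δ > 0, ∀ τ : ℝ, |τ| ≤ δ → P (p + τ • d) := by
  have := (oseg_ray_tendsto p d).eventually h
  rw [Metric.eventually_nhds_iff] at this
  obtain ⟨ε, hε, H⟩ := this
  refine ⟨ε / 2, by linarith, fun τ hτ => H ?_⟩
  rw [Real.dist_eq, sub_zero]; linarith

theorem isClosed_seg (x y : Plane) : IsClosed (segment ℝ x y) := by
  rw [segment_eq_image']
  exact (isCompact_Icc.image (by fun_prop)).isClosed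

/-! ### Convex polygons -/

/-- The closed half-plane to the left of the line through `p` with direction `f`. -/
def leftOf (f p : Plane) : Set Plane := {z | 0 ≤ cross f (z - p)}

theorem isClosed_leftOf (f p : Plane) : IsClosed (leftOf f p) :=
  isClosed_le continuous_const ((continuous_cross f).comp (continuous_id.sub continuous_const))

theorem convex_leftOf (f p : Plane) : Convex ℝ (leftOf f p) := by
  intro x hx y hy a b ha hb hab
  simp only [leftOf, mem_ofPred_eq, cross_sub_right, cross_add_right, cross_smul_right] at *
  have : cross f p = a * cross f p + b * cross f p := by rw [← add_mul, hab, one_mul]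
  nlinarith

theorem isOpen_cross_pos (f p : Plane) : IsOpen {z | 0 < cross f (z - p)} :=
  isOpen_lt continuous_const ((continuous_cross f).comp (continuous_id.sub continuous_const))

theorem convex_cross_pos (f p : Plane) : Convex ℝ {z | 0 < cross f (z - p)} := by
  intro x hx y hy a b ha hb hab
  simp only [mem_ofPred_eq, cross_sub_right, cross_add_right, cross_smul_right] at *
  have : cross f p = a * cross f p + b * cross f p := by rw [← add_mul, hab, one_mul]
  rcases eq_or_lt_of_le ha with rfl | ha
  · have : b = 1 := by linarith
    subst this; linarith
  · nlinarith [mul_nonneg hb (sub_nonneg.2 hy.le), mul_pos ha (show 0 < cross f x - cross f p from hx)]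

theorem interior_leftOf {f : Plane} (hf : f ≠ 0) (p : Plane) :
    interior (leftOf f p) = {z | 0 < cross f (z - p)} := by
  refine subset_antisymm (fun z hz => ?_)
    (interior_maximal (fun z (hz : 0 < cross f (z - p)) => show 0 ≤ cross f (z - p) from hz.le)
      (isOpen_cross_pos f p))
  obtain ⟨n, hn⟩ := exists_cross_pos hf
  obtain ⟨δ, hδ, H⟩ := exists_small (d := n) (mem_interior_iff_mem_nhds.1 hz)
  have h1 : 0 ≤ cross f (z + (-δ) • n - p) := H (-δ) (by rw [abs_neg, abs_of_pos hδ])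
  rw [show z + (-δ) • n - p = (z - p) + (-δ) • n by module, cross_add_right,
    cross_smul_right] at h1
  have : 0 < δ * cross f n := mul_pos hδ hn
  simp only [mem_ofPred_eq]; linarith

/-- Of three distinct collinear points, one lies strictly between the two others, and that one is
not extreme. -/
theorem eq_or_eq_of_extreme {A : Set Plane} {x y z : Plane} (hx : x ∈ A.extremePoints ℝ)
    (hy : y ∈ A.extremePoints ℝ) (hz : z ∈ A.extremePoints ℝ) (hxy : x ≠ y)
    (h : cross (y - x) (z - x) = 0) : z = x ∨ z = y := by
  obtain ⟨τ, hτ⟩ := exists_smul_of_cross_eq_zero (sub_ne_zero.2 hxy.symm) h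
  have hz' : z = x + τ • (y - x) := by rw [← hτ]; abel
  have e0 : x = x + (0 : ℝ) • (y - x) := by simp
  have e1 : y = x + (1 : ℝ) • (y - x) := by simp
  rcases lt_trichotomy τ 0 with h0 | h0 | h0
  · exact absurd (hx.2 hy.1 hz.1 (by
      rw [openSegment_symm]
      have := add_smul_mem_oseg (p := x) (d := y - x) h0 one_pos
      rwa [← e0, ← e1, ← hz'] at this)) hxy.symm
  · left; rw [hz', h0]; simp
  · rcases lt_trichotomy τ 1 with h1 | h1 | h1
    · left
      exact (hz.2 hx.1 hy.1 (mem_oseg.2 ⟨τ, h0, h1, hz'⟩)).symm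
    · right; rw [hz', h1]; simp
    · refine absurd (hy.2 hx.1 hz.1 ?_) hxy
      have := add_smul_mem_oseg (p := x) (d := y - x) one_pos h1
      rwa [← e0, ← e1, ← hz'] at this

theorem finite_of_collinear_extreme {A S : Set Plane} (hS : S ⊆ A.extremePoints ℝ) {f p : Plane}
    (hf : f ≠ 0) (h : ∀ z ∈ S, cross f (z - p) = 0) : ∃ x y, S ⊆ {x, y} := by
  by_cases h1 : ∃ x ∈ S, ∃ y ∈ S, x ≠ y
  · obtain ⟨x, hx, y, hy, hxy⟩ := h1
    refine ⟨x, y, fun z hz => eq_or_eq_of_extreme (hS hx) (hS hy) (hS hz) hxy ?_⟩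
    have key : ∀ w ∈ S, ∃ τ : ℝ, w = p + τ • f := fun w hw => by
      obtain ⟨τ, hτ⟩ := exists_smul_of_cross_eq_zero hf (h w hw)
      exact ⟨τ, by rw [← hτ]; abel⟩
    obtain ⟨α, rfl⟩ := key x hx
    obtain ⟨β, rfl⟩ := key y hy
    obtain ⟨γ, rfl⟩ := key z hz
    rw [show p + β • f - (p + α • f) = (β - α) • f by module,
      show p + γ • f - (p + α • f) = (γ - α) • f by module, cross_smul_left, cross_smul_right,
      cross_self, mul_zero, mul_zero]
  · push Not at h1
    rcases S.eq_empty_or_nonempty with rfl | ⟨x, hx⟩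
    · exact ⟨0, 0, empty_subset _⟩
    · exact ⟨x, x, fun z hz => by simp [h1 x hx z hz]⟩

/-- Off the frontier, the plane consists of two disjoint open sets, the interior of `c` and the
complement of its closure; a connected set lies in one of them. -/
theorem subset_interior_of_disjoint_frontier {X c : Set Plane} (hX : IsPreconnected X)
    (h : Disjoint X (frontier c)) (hne : (X ∩ interior c).Nonempty) : X ⊆ interior c := by
  refine hX.subset_left_of_subset_union isOpen_interior isClosed_closure.isOpen_compl
    (disjoint_left.2 fun z hz hz' => hz' (subset_closure (interior_subset hz))) ?_ hne
  intro z hz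
  by_contra hz'
  rw [mem_union, not_or, notMem_compl_iff] at hz'
  exact disjoint_left.1 h hz ⟨hz'.2, hz'.1⟩

namespace IsConvexPolygon

variable {c : Set Plane}

theorem convex (hc : IsConvexPolygon c) : Convex ℝ c := by
  obtain ⟨-, F, -, rfl⟩ := hc; exact convex_convexHull ℝ F

theorem isCompact (hc : IsConvexPolygon c) : IsCompact c := by
  obtain ⟨-, F, hF, rfl⟩ := hc; exact hF.isCompact_convexHull ℝ

theorem isClosed (hc : IsConvexPolygon c) : IsClosed c := hc.isCompact.isClosed

theorem finite_extremePoints (hc : IsConvexPolygon c) : (c.extremePoints ℝ).Finite := by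
  obtain ⟨-, F, hF, rfl⟩ := hc; exact hF.subset extremePoints_convexHull_subset

theorem closure_interior (hc : IsConvexPolygon c) : closure (interior c) = c := by
  rw [hc.convex.closure_interior_eq_closure_of_nonempty_interior hc.1, hc.isClosed.closure_eq]

theorem frontier_subset (hc : IsConvexPolygon c) : frontier c ⊆ c := hc.isClosed.frontier_subset

theorem mem_frontier (hc : IsConvexPolygon c) {p : Plane} : p ∈ frontier c ↔ p ∈ c ∧ p ∉ interior c := by
  rw [hc.isClosed.frontier_eq]; rfl

theorem extremePoints_subset_frontier (hc : IsConvexPolygon c) :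
    c.extremePoints ℝ ⊆ frontier c := by
  intro p hp
  refine hc.mem_frontier.2 ⟨hp.1, fun hi => ?_⟩
  -- Any direction would do: an interior point is the midpoint of a short segment of `c`.
  have h1 : (!₂[1, 0] : Plane) ≠ 0 := fun h => by
    have := congrArg (fun z : Plane => z 0) h; simp at this
  obtain ⟨δ, hδ, H⟩ := exists_small (d := (!₂[1, 0] : Plane)) (mem_interior_iff_mem_nhds.1 hi)
  have := hp.2 (H (-δ) (by rw [abs_neg, abs_of_pos hδ])) (H δ (by rw [abs_of_pos hδ])) (by
    have := add_smul_mem_oseg (p := p) (d := (!₂[1, 0] : Plane)) (neg_lt_zero.2 hδ) hδ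
    rwa [zero_smul, add_zero] at this)
  have h2 : (-δ) • (!₂[1, 0] : Plane) = 0 := by simpa using this
  rcases smul_eq_zero.1 h2 with h | h
  · linarith
  · exact h1 h

/-- A polygon has a supporting line at each boundary point. -/
theorem exists_support (hc : IsConvexPolygon c) {p : Plane} (hp : p ∈ frontier c) :
    ∃ f : Plane, f ≠ 0 ∧ (∀ z ∈ interior c, 0 < cross f (z - p)) ∧ c ⊆ leftOf f p := by
  obtain ⟨g, hg⟩ := geometric_hahn_banach_open_point hc.convex.interior isOpen_interior
    (hc.mem_frontier.1 hp).2
  obtain ⟨d, hd⟩ := exists_cross_eq g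
  have h1 : ∀ z ∈ interior c, 0 < cross (-d) (z - p) := fun z hz => by
    have := hg z hz
    rw [hd, hd] at this
    rw [cross_neg_left, cross_sub_right]; linarith
  refine ⟨-d, ?_, h1, ?_⟩
  · rintro h0
    obtain ⟨z, hz⟩ := hc.1
    have := h1 z hz
    rw [h0, cross_zero_left] at this
    exact lt_irrefl _ this
  · nth_rewrite 1 [← hc.closure_interior]
    exact closure_minimal (fun z hz => (h1 z hz).le) (isClosed_leftOf _ _)

/-- The face `F` cut out by a supporting line at `p` is compact, convex and collinear, and its
extreme points are extreme in `c`. By Krein–Milman it is the hull of at most two extreme points of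
`c`. -/
theorem extreme_or_mem_side (hc : IsConvexPolygon c) {p : Plane} (hp : p ∈ frontier c) :
    p ∈ c.extremePoints ℝ ∨ ∃ x ∈ c.extremePoints ℝ, ∃ y ∈ c.extremePoints ℝ, x ≠ y ∧
      p ∈ openSegment ℝ x y ∧ segment ℝ x y ⊆ frontier c := by
  obtain ⟨f, hf, hint, hle⟩ := hc.exists_support hp
  have hpc := hc.frontier_subset hp
  have hz0 : ∀ z ∈ c, 0 ≤ cross f (z - p) := fun z hz => hle hz
  let F := c ∩ {z | cross f (z - p) = 0}
  have hFcl : IsCompact F := hc.isCompact.inter_right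
    (isClosed_eq ((continuous_cross f).comp (continuous_id.sub continuous_const)) continuous_const)
  have hFc : Convex ℝ F := by
    have : F = c ∩ (leftOf f p ∩ leftOf (-f) p) := by
      ext z
      simp only [F, leftOf, mem_inter_iff, mem_ofPred_eq, cross_neg_left]
      constructor
      · rintro ⟨h1, h2⟩; exact ⟨h1, by linarith, by linarith⟩
      · rintro ⟨h1, h2, h3⟩; exact ⟨h1, by linarith⟩
    rw [this]
    exact hc.convex.inter ((convex_leftOf _ _).inter (convex_leftOf _ _))
  have hext : F.extremePoints ℝ ⊆ c.extremePoints ℝ := by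
    intro q hq
    refine ⟨hq.1.1, fun x1 h1 x2 h2 h12 => ?_⟩
    have hq0 : cross f (q - p) = 0 := hq.1.2
    obtain ⟨a, b, ha, hb, hab, rfl⟩ := h12
    rw [show a • x1 + b • x2 - p = a • (x1 - p) + b • (x2 - p) by
      rw [smul_sub, smul_sub]
      nth_rewrite 1 [← one_smul ℝ p]
      rw [← hab]; module, cross_add_right, cross_smul_right, cross_smul_right] at hq0
    have g1 := hz0 x1 h1
    have g2 := hz0 x2 h2
    have k1 : cross f (x1 - p) = 0 := by
      have := mul_nonneg ha.le g1
      have := mul_nonneg hb.le g2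
      have : a * cross f (x1 - p) = 0 := by linarith
      exact (mul_eq_zero.1 this).resolve_left ha.ne'
    have k2 : cross f (x2 - p) = 0 := by
      rw [k1, mul_zero, zero_add] at hq0
      exact (mul_eq_zero.1 hq0).resolve_left hb.ne'
    exact hq.2 ⟨h1, k1⟩ ⟨h2, k2⟩ ⟨a, b, ha, hb, hab, rfl⟩
  have hpF : p ∈ F := ⟨hpc, by simp [cross_zero_right]⟩
  obtain ⟨x, y, hxy⟩ := finite_of_collinear_extreme hext hf (p := p) fun z hz => hz.1.2
  have hfin : (F.extremePoints ℝ).Finite := (by simp : ({x, y} : Set Plane).Finite).subset hxy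
  have hp2 : p ∈ convexHull ℝ (F.extremePoints ℝ) := by
    rw [← (hfin.isClosed_convexHull ℝ).closure_eq, closure_convexHull_extremePoints hFcl hFc]
    exact hpF
  by_cases hpe : p ∈ F.extremePoints ℝ
  · exact Or.inl (hext hpe)
  have hFfr : F ⊆ frontier c := fun z hz => by
    refine hc.mem_frontier.2 ⟨hz.1, fun hi => ?_⟩
    have h1 := hint z hi
    have h2 : cross f (z - p) = 0 := hz.2
    linarith
  have hp3 : p ∈ segment ℝ x y := by
    rw [← convexHull_pair]; exact convexHull_mono hxy hp2
  have single : ∀ w, ¬ F.extremePoints ℝ ⊆ {w} := fun w hw => by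
    have := convexHull_mono hw hp2
    rw [convexHull_singleton, mem_singleton_iff] at this
    obtain ⟨q, hq⟩ := hFcl.extremePoints_nonempty (E := Plane) ⟨p, hpF⟩
    have := hw hq
    simp_all
  have hx : x ∈ F.extremePoints ℝ := by
    by_contra h
    refine single y fun z hz => ?_
    rcases hxy hz with rfl | h'
    · exact absurd hz h
    · exact h'
  have hy : y ∈ F.extremePoints ℝ := by
    by_contra h
    refine single x fun z hz => ?_
    rcases hxy hz with h' | h'
    · exact h'
    · exact absurd (h' ▸ hz) h
  have hne : x ≠ y := by
    rintro rfl
    exact single x (by simpa using hxy)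
  right
  refine ⟨x, hext hx, y, hext hy, hne, ?_, (hFc.segment_subset hx.1 hy.1).trans hFfr⟩
  rcases mem_seg_iff_oseg.1 hp3 with rfl | rfl | h
  · exact absurd hx hpe
  · exact absurd hy hpe
  · exact h

/-- The boundary of a polygon has no isolated points. -/
theorem mem_closure_frontier_diff (hc : IsConvexPolygon c) {p : Plane} (hp : p ∈ frontier c) :
    p ∈ closure (frontier c \ {p}) := by
  by_contra hcl
  have h1 : ∀ᶠ z in 𝓝 p, z ∉ frontier c \ {p} := by
    have := isClosed_closure.isOpen_compl.mem_nhds hcl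
    filter_upwards [this] with z hz h
    exact hz (subset_closure h)
  rw [Metric.eventually_nhds_iff_ball] at h1
  obtain ⟨ε, hε, H⟩ := h1
  have hpc : p ∈ closure (interior c) := by
    rw [hc.closure_interior]; exact hc.frontier_subset hp
  have hpn : p ∈ closure cᶜ := by
    rw [closure_compl]; exact (hc.mem_frontier.1 hp).2
  obtain ⟨o, ho, hoc⟩ := mem_closure_iff_nhds.1 hpc _ (Metric.ball_mem_nhds p hε)
  obtain ⟨q, hq, hqc⟩ := mem_closure_iff_nhds.1 hpn _ (Metric.ball_mem_nhds p hε)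
  have hqp : p - q ≠ 0 := fun h => hqc (by
    rw [← sub_eq_zero.1 h]; exact hc.frontier_subset hp)
  obtain ⟨n, hn⟩ := exists_cross_pos hqp
  -- If `p` were isolated in the frontier, every segment from a nearby interior point to the
  -- exterior point `q` would leave `c` through `p`. All interior points near `p` would then lie on
  -- the line through `p` and `q`.
  have key : ∀ z ∈ Metric.ball p ε ∩ interior c, cross (p - q) (z - q) = 0 := by
    intro z hz
    have hpre : IsPreconnected (segment ℝ z q) := (convex_segment z q).isPreconnected
    obtain ⟨w, hw, hwf⟩ : (segment ℝ z q ∩ frontier c).Nonempty := by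
      by_contra hne
      exact hqc (interior_subset (subset_interior_of_disjoint_frontier hpre
        (disjoint_iff_inter_eq_empty.2 (not_nonempty_iff_eq_empty.1 hne))
        ⟨z, left_mem_segment ℝ z q, hz.2⟩ (right_mem_segment ℝ z q)))
    have hwb := (convex_ball p ε).segment_subset hz.1 hq hw
    have : w = p := by
      by_contra hne
      exact H w hwb ⟨hwf, hne⟩
    subst this
    rw [segment_symm] at hw
    have := cross_eq_zero_of_mem_seg hw
    rw [cross_swap, this, neg_zero]
  obtain ⟨δ, hδ, H2⟩ := exists_small (d := n)
    ((Metric.isOpen_ball.inter isOpen_interior).mem_nhds ⟨ho, hoc⟩ :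
      Metric.ball p ε ∩ interior c ∈ 𝓝 o)
  have k1 := key o ⟨ho, hoc⟩
  have k2 := key _ (H2 δ (by rw [abs_of_pos hδ]))
  rw [show o + δ • n - q = (o - q) + δ • n by module, cross_add_right, k1, cross_smul_right,
    zero_add] at k2
  exact (mul_pos hδ hn).ne' k2

theorem finite_sides (hc : IsConvexPolygon c) : {a | IsSide c a}.Finite := by
  refine ((hc.finite_extremePoints.prod hc.finite_extremePoints).image
    fun q => segment ℝ q.1 q.2).subset ?_
  rintro a ⟨x, hx, y, hy, -, rfl, -⟩
  exact ⟨(x, y), ⟨hx, hy⟩, rfl⟩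

/-- Extreme points are the difficulty. The sides and the other extreme points form a closed set
which contains the frontier minus `p`, hence also `p`, which is not isolated in the frontier. -/
theorem exists_side (hc : IsConvexPolygon c) {p : Plane} (hp : p ∈ frontier c) :
    ∃ a, IsSide c a ∧ p ∈ a := by
  have hcl : IsClosed (⋃₀ {a | IsSide c a}) := by
    rw [sUnion_eq_biUnion]
    refine hc.finite_sides.isClosed_biUnion ?_
    rintro a ⟨x, -, y, -, -, rfl, -⟩
    exact isClosed_seg x y
  have hfin := hc.finite_extremePoints
  have h1 : frontier c \ {p} ⊆ ⋃₀ {a | IsSide c a} ∪ (c.extremePoints ℝ \ {p}) := by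
    rintro z ⟨hz, hzp⟩
    rcases hc.extreme_or_mem_side hz with h | ⟨x, hx, y, hy, hxy, hzs, hs⟩
    · exact Or.inr ⟨h, hzp⟩
    · exact Or.inl ⟨_, ⟨x, hx, y, hy, hxy, rfl, hs⟩, openSegment_subset_segment ℝ _ _ hzs⟩
  have h2 : IsClosed (⋃₀ {a | IsSide c a} ∪ (c.extremePoints ℝ \ {p})) :=
    hcl.union (hfin.subset sdiff_subset).isClosed
  rcases closure_minimal h1 h2 (hc.mem_closure_frontier_diff hp) with ⟨a, ha, hpa⟩ | h
  · exact ⟨a, ha, hpa⟩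
  · exact absurd rfl h.2

/-- A polygon whose interior misses a segment around one of its points lies on one side of it. -/
theorem one_side (hc : IsConvexPolygon c) {p f : Plane} (hp : p ∈ c) {δ : ℝ} (hδ : 0 < δ)
    (hf : f ≠ 0) (h : ∀ τ : ℝ, |τ| ≤ δ → p + τ • f ∉ interior c) :
    c ⊆ leftOf f p ∨ c ⊆ leftOf (-f) p := by
  by_contra! hcon
  -- `c` is the closure of its interior, so a point on the wrong side can be taken in the interior.
  have key : ∀ g, ¬ c ⊆ leftOf g p → ∃ z ∈ interior c, cross g (z - p) < 0 := by
    intro g hg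
    by_contra! hall
    refine hg ?_
    rw [← hc.closure_interior]
    exact closure_minimal hall (isClosed_leftOf g p)
  obtain ⟨z, hz, hz0⟩ := key _ hcon.1
  obtain ⟨w, hw, hw0⟩ := key _ hcon.2
  rw [cross_neg_left, neg_lt_zero] at hw0
  -- the point of the segment from `z` to `w` on the line
  set a := cross f (w - p) with ha
  set b := -cross f (z - p) with hb
  have hb0 : 0 < b := by linarith
  let q := (a / (a + b)) • z + (b / (a + b)) • w
  have hsum : a / (a + b) + b / (a + b) = 1 := by field_simp
  have hq : q ∈ interior c := hc.convex.interior hz hw (by positivity) (by positivity) hsum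
  have hqp : q - p = (a / (a + b)) • (z - p) + (b / (a + b)) • (w - p) := by
    simp only [q]
    nth_rewrite 1 [← one_smul ℝ p]
    rw [← hsum]; module
  have hq0 : cross f (q - p) = 0 := by
    rw [hqp, cross_add_right, cross_smul_right, cross_smul_right, ← ha,
      show cross f (z - p) = -b by rw [hb]; ring]
    field_simp; ring
  obtain ⟨τ, hτ⟩ := exists_smul_of_cross_eq_zero hf hq0
  have hτ' : q = p + τ • f := by rw [← hτ]; abel
  -- shrink towards `p`
  obtain ⟨s, hs0, hs1, hs⟩ : ∃ s : ℝ, 0 < s ∧ s ≤ 1 ∧ |s * τ| ≤ δ := by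
    refine ⟨min 1 (δ / (|τ| + 1)), lt_min one_pos (by positivity), min_le_left _ _, ?_⟩
    rw [abs_mul, abs_of_pos (lt_min one_pos (by positivity))]
    calc min 1 (δ / (|τ| + 1)) * |τ| ≤ δ / (|τ| + 1) * |τ| := by gcongr; exact min_le_right _ _
      _ ≤ δ / (|τ| + 1) * (|τ| + 1) := by gcongr; linarith
      _ = δ := by field_simp
  refine h (s * τ) hs ?_
  have := hc.convex.combo_interior_self_mem_interior hq hp hs0 (sub_nonneg.2 hs1) (by ring)
  convert this using 1
  rw [hτ']; module

end IsConvexPolygon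

/-- By Krein–Milman a compact convex set is the closed hull of its extreme points, and the hull of a
finite set is already closed. -/
theorem isConvexPolygon_of_finite_extremePoints {c : Set Plane} (hc : IsCompact c)
    (hconv : Convex ℝ c) (hint : (interior c).Nonempty) (hfin : (c.extremePoints ℝ).Finite) :
    IsConvexPolygon c := by
  refine ⟨hint, _, hfin, ?_⟩
  rw [← (hfin.isClosed_convexHull ℝ).closure_eq, closure_convexHull_extremePoints hc hconv]

theorem IsConvexPolygon.interior_inter_leftOf {c : Set Plane} {f p : Plane} (hf : f ≠ 0) :
    interior (c ∩ leftOf f p) = interior c ∩ {z | 0 < cross f (z - p)} := by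
  rw [interior_inter, interior_leftOf hf]

/-- Off the cutting line, an extreme point of the intersection is extreme in `c`, since small
displacements stay in the half-plane. On the cutting line there are at most two extreme points. -/
theorem IsConvexPolygon.inter_leftOf {c : Set Plane} (hc : IsConvexPolygon c) {f p : Plane}
    (hf : f ≠ 0) (h : ∃ z ∈ interior c, 0 < cross f (z - p)) :
    IsConvexPolygon (c ∩ leftOf f p) := by
  refine isConvexPolygon_of_finite_extremePoints (hc.isCompact.inter_right (isClosed_leftOf f p))
    (hc.convex.inter (convex_leftOf f p)) ?_ ?_
  · rw [interior_inter_leftOf hf]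
    obtain ⟨z, hz, hz0⟩ := h
    exact ⟨z, hz, hz0⟩
  · let S := (c ∩ leftOf f p).extremePoints ℝ
    have h1 : S ⊆ c.extremePoints ℝ ∪ {z ∈ S | cross f (z - p) = 0} := by
      intro q hq
      by_cases h0 : cross f (q - p) = 0
      · exact Or.inr ⟨hq, h0⟩
      have hpos : 0 < cross f (q - p) := lt_of_le_of_ne hq.1.2 (Ne.symm h0)
      refine Or.inl ⟨hq.1.1, fun x1 hx1 x2 hx2 h12 => ?_⟩
      obtain ⟨τ, ht0, ht1, ht⟩ := mem_oseg.1 h12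
      obtain ⟨δ, hδ, H⟩ := exists_small (d := x2 - x1) ((isOpen_cross_pos f p).mem_nhds hpos)
      -- Small enough for both displaced points to stay in the half-plane and between `x1` and `x2`.
      let s := min δ (min τ (1 - τ))
      have hs0 : 0 < s := lt_min hδ (lt_min ht0 (by linarith))
      have hsδ : s ≤ δ := min_le_left _ _
      have hsτ : s ≤ τ := (min_le_right _ _).trans (min_le_left _ _)
      have hsτ' : s ≤ 1 - τ := (min_le_right _ _).trans (min_le_right _ _)
      have mem : ∀ r, |r| ≤ s → q + r • (x2 - x1) ∈ c ∩ leftOf f p := fun r hr => by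
        have hr' := abs_le.1 hr
        refine ⟨hc.convex.segment_subset hx1 hx2 (mem_seg.2 ⟨τ + r, by linarith, by linarith, ?_⟩),
          (H r (hr.trans hsδ)).le⟩
        rw [ht]; module
      have := hq.2 (mem (-s) (by rw [abs_neg, abs_of_pos hs0])) (mem s (by rw [abs_of_pos hs0])) (by
        have := add_smul_mem_oseg (p := q) (d := x2 - x1) (neg_lt_zero.2 hs0) hs0
        rwa [zero_smul, add_zero] at this)
      have h2 : (-s) • (x2 - x1) = 0 := by simpa using this
      rcases smul_eq_zero.1 h2 with h | h
      · linarith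
      · rw [ht, h]; simp
    obtain ⟨x, y, hxy⟩ := finite_of_collinear_extreme (A := c ∩ leftOf f p)
      (S := {z ∈ S | cross f (z - p) = 0}) (fun z hz => hz.1) hf (fun z hz => hz.2)
    exact (hc.finite_extremePoints.union
      ((by simp : ({x, y} : Set Plane).Finite).subset hxy)).subset h1

theorem IsConvexPolygon.union {A B : Set Plane} (hA : IsConvexPolygon A) (hB : IsConvexPolygon B)
    (h : Convex ℝ (A ∪ B)) : IsConvexPolygon (A ∪ B) := by
  obtain ⟨hi, F, hF, rfl⟩ := hA
  obtain ⟨-, G, hG, rfl⟩ := hB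
  refine ⟨hi.mono (interior_mono subset_union_left), F ∪ G, hF.union hG, ?_⟩
  refine subset_antisymm (union_subset (convexHull_mono subset_union_left)
    (convexHull_mono subset_union_right)) (convexHull_min ?_ h)
  exact union_subset_union (subset_convexHull ℝ F) (subset_convexHull ℝ G)

/-! ### Segments and germs -/

/-- Both segments are parametrised along `[a, b]`. In `0 = (1 - σ) s + σ t` the terms are
non-negative, so each vanishes; the same holds for the other end, and only the two matchings of the
ends remain. -/
theorem segment_eq_segment {x y a b : Plane} (h : segment ℝ x y = segment ℝ a b) :
    (x = a ∧ y = b) ∨ (x = b ∧ y = a) := by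
  by_cases hab : a = b
  · subst hab
    rw [segment_same] at h
    left
    exact ⟨by simpa using h.subset (left_mem_segment ℝ x y),
      by simpa using h.subset (right_mem_segment ℝ x y)⟩
  have hd : b - a ≠ 0 := sub_ne_zero.2 (Ne.symm hab)
  obtain ⟨s, hs0, hs1, hx⟩ := mem_seg.1 (h.subset (left_mem_segment ℝ x y))
  obtain ⟨t, ht0, ht1, hy⟩ := mem_seg.1 (h.subset (right_mem_segment ℝ x y))
  obtain ⟨σ, h0, h1, ha⟩ := mem_seg.1 (h.superset (left_mem_segment ℝ a b))
  obtain ⟨ρ, k0, k1, hb⟩ := mem_seg.1 (h.superset (right_mem_segment ℝ a b))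
  have e1 : (s + σ * (t - s)) • (b - a) = 0 := by
    have : a = a + (s + σ * (t - s)) • (b - a) := by
      refine ha.trans ?_
      rw [hx, hy]; module
    simpa using this.symm
  have e2 : (s + ρ * (t - s) - 1) • (b - a) = 0 := by
    have : b = a + (s + ρ * (t - s)) • (b - a) := by
      refine hb.trans ?_
      rw [hx, hy]; module
    rw [show (s + ρ * (t - s) - 1) • (b - a) = a + (s + ρ * (t - s)) • (b - a) - b by module,
      ← this, sub_self]
  have e1' := (smul_eq_zero.1 e1).resolve_right hd
  have e2' := (smul_eq_zero.1 e2).resolve_right hd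
  have f1 : (1 - σ) * s = 0 := by
    nlinarith [mul_nonneg (sub_nonneg.2 h1) hs0, mul_nonneg h0 ht0]
  have f2 : σ * t = 0 := by
    nlinarith [mul_nonneg (sub_nonneg.2 h1) hs0, mul_nonneg h0 ht0]
  have f3 : (1 - ρ) * (1 - s) = 0 := by
    nlinarith [mul_nonneg (sub_nonneg.2 k1) (sub_nonneg.2 hs1), mul_nonneg k0 (sub_nonneg.2 ht1)]
  have f4 : ρ * (1 - t) = 0 := by
    nlinarith [mul_nonneg (sub_nonneg.2 k1) (sub_nonneg.2 hs1), mul_nonneg k0 (sub_nonneg.2 ht1)]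
  rcases mul_eq_zero.1 f1 with g | g
  · have hσ : σ = 1 := by linarith
    have htz : t = 0 := by rw [hσ] at f2; linarith
    have hρ : ρ = 0 := by rw [htz] at f4; linarith
    have hs' : s = 1 := by rw [hρ] at f3; linarith
    right
    rw [hx, hy, hs', htz]; exact ⟨by module, by module⟩
  · have hρ : ρ = 1 := by rw [g] at f3; linarith
    have ht' : t = 1 := by rw [hρ] at f4; linarith
    left
    rw [hx, hy, g, ht']; exact ⟨by module, by module⟩

theorem eventually_line (p : Plane) {d : Plane} (hd : d ≠ 0) {δ : ℝ} (hδ : 0 < δ) :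
    ∀ᶠ z in 𝓝 p, cross d (z - p) = 0 → ∃ τ : ℝ, |τ| < δ ∧ z = p + τ • d := by
  have hn : 0 < ‖d‖ := norm_pos_iff.2 hd
  filter_upwards [Metric.ball_mem_nhds p (mul_pos hδ hn)] with z hz h
  obtain ⟨τ, hτ⟩ := exists_smul_of_cross_eq_zero hd h
  refine ⟨τ, ?_, by rw [← hτ]; abel⟩
  rw [Metric.mem_ball, dist_eq_norm, hτ, norm_smul, Real.norm_eq_abs] at hz
  exact lt_of_mul_lt_mul_right hz hn.le

theorem eventually_ray (p : Plane) {d e : Plane} (h : 0 < cross d e) {δ : ℝ} (hδ : 0 < δ) :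
    ∀ᶠ z in 𝓝 p, cross e (z - p) = 0 → 0 ≤ cross d (z - p) →
      ∃ τ : ℝ, 0 ≤ τ ∧ τ < δ ∧ z = p + τ • e := by
  filter_upwards [eventually_line p (ne_zero_right_of_cross h.ne') hδ] with z hz h1 h2
  obtain ⟨τ, hτ, rfl⟩ := hz h1
  rw [add_sub_cancel_left, cross_smul_right] at h2
  exact ⟨τ, nonneg_of_mul_nonneg_left h2 h, (abs_lt.1 hτ).2, rfl⟩

/-- Near `p`, the set `K` is a line with direction `d`. -/
def IsFlatAt (K : Set Plane) (p d : Plane) : Prop :=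
  d ≠ 0 ∧ ∀ᶠ z in 𝓝 p, (z ∈ K ↔ cross d (z - p) = 0)

/-- Near `p`, the set `K` is the union of a line with direction `d` and of a half-line with
direction `e`. -/
def IsTeeAt (K : Set Plane) (p d e : Plane) : Prop :=
  0 < cross d e ∧
    ∀ᶠ z in 𝓝 p, (z ∈ K ↔ cross d (z - p) = 0 ∨ (cross e (z - p) = 0 ∧ 0 ≤ cross d (z - p)))

theorem IsFlatAt.exists_small {K : Set Plane} {p d : Plane} (h : IsFlatAt K p d) :
    ∃ δ > 0, ∀ τ : ℝ, |τ| ≤ δ → p + τ • d ∈ K := by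
  obtain ⟨δ, hδ, H⟩ := TTess.exists_small (d := d) h.2
  refine ⟨δ, hδ, fun τ hτ => (H τ hτ).2 ?_⟩
  rw [add_sub_cancel_left, cross_smul_right, cross_self, mul_zero]

theorem IsTeeAt.exists_small {K : Set Plane} {p d e : Plane} (h : IsTeeAt K p d e) :
    ∃ δ > 0, ∀ τ : ℝ, |τ| ≤ δ → p + τ • d ∈ K ∧ (0 ≤ τ → p + τ • e ∈ K) := by
  obtain ⟨δ, hδ, H⟩ := TTess.exists_small (d := d) h.2
  obtain ⟨δ', hδ', H'⟩ := TTess.exists_small (d := e) h.2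
  refine ⟨min δ δ', lt_min hδ hδ', fun τ hτ => ⟨(H τ (hτ.trans (min_le_left _ _))).2 (Or.inl ?_),
    fun h0 => (H' τ (hτ.trans (min_le_right _ _))).2 (Or.inr ⟨?_, ?_⟩)⟩⟩
  · rw [add_sub_cancel_left, cross_smul_right, cross_self, mul_zero]
  · rw [add_sub_cancel_left, cross_smul_right, cross_self, mul_zero]
  · rw [add_sub_cancel_left, cross_smul_right]; exact mul_nonneg h0 h.1.le

/-- A short segment starting at a flat point and contained in `K` follows the line. -/
theorem IsFlatAt.cross_eq_zero {K : Set Plane} {p d u : Plane} (h : IsFlatAt K p d)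
    (hu : ∃ δ > 0, ∀ τ : ℝ, 0 ≤ τ → τ ≤ δ → p + τ • u ∈ K) : cross d u = 0 := by
  obtain ⟨δ, hδ, H⟩ := hu
  obtain ⟨δ', hδ', H'⟩ := TTess.exists_small (d := u) h.2
  have hm : 0 < min δ δ' := lt_min hδ hδ'
  have := (H' (min δ δ') (by rw [abs_of_pos hm]; exact min_le_right _ _)).1
    (H _ hm.le (min_le_left _ _))
  rw [add_sub_cancel_left, cross_smul_right] at this
  exact (mul_eq_zero.1 this).resolve_left hm.ne'

theorem IsTeeAt.cross_eq_zero {K : Set Plane} {p d e u : Plane} (h : IsTeeAt K p d e)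
    (hu : ∃ δ > 0, ∀ τ : ℝ, 0 ≤ τ → τ ≤ δ → p + τ • u ∈ K) :
    cross d u = 0 ∨ (cross e u = 0 ∧ 0 ≤ cross d u) := by
  obtain ⟨δ, hδ, H⟩ := hu
  obtain ⟨δ', hδ', H'⟩ := TTess.exists_small (d := u) h.2
  have hm : 0 < min δ δ' := lt_min hδ hδ'
  have := (H' (min δ δ') (by rw [abs_of_pos hm]; exact min_le_right _ _)).1
    (H _ hm.le (min_le_left _ _))
  rw [add_sub_cancel_left, cross_smul_right, cross_smul_right] at this
  rcases this with h | ⟨h1, h2⟩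
  · exact Or.inl ((mul_eq_zero.1 h).resolve_left hm.ne')
  · exact Or.inr ⟨(mul_eq_zero.1 h1).resolve_left hm.ne', nonneg_of_mul_nonneg_right h2 hm⟩

theorem IsFlatAt.congr {K K' : Set Plane} {p d : Plane} (h : IsFlatAt K p d)
    (hK : ∀ᶠ z in 𝓝 p, (z ∈ K' ↔ z ∈ K)) : IsFlatAt K' p d := by
  refine ⟨h.1, ?_⟩
  filter_upwards [h.2, hK] with z h1 h2
  rw [h2, h1]

theorem IsTeeAt.congr {K K' : Set Plane} {p d e : Plane} (h : IsTeeAt K p d e)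
    (hK : ∀ᶠ z in 𝓝 p, (z ∈ K' ↔ z ∈ K)) : IsTeeAt K' p d e := by
  refine ⟨h.1, ?_⟩
  filter_upwards [h.2, hK] with z h1 h2
  rw [h2, h1]

theorem IsFlatAt.neg {K : Set Plane} {p d : Plane} (h : IsFlatAt K p d) : IsFlatAt K p (-d) := by
  refine ⟨neg_ne_zero.2 h.1, ?_⟩
  filter_upwards [h.2] with z hz
  rw [hz, cross_neg_left, neg_eq_zero]

/-- A tee contains segments in two independent directions, a flat germ in one only. -/
theorem IsFlatAt.not_tee {K : Set Plane} {p d d' e : Plane} (h : IsFlatAt K p d)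
    (h' : IsTeeAt K p d' e) : False := by
  obtain ⟨δ, hδ, H⟩ := h'.exists_small
  have h1 := h.cross_eq_zero ⟨δ, hδ, fun τ h0 h1 => (H τ (by rwa [abs_of_nonneg h0])).1⟩
  have h2 := h.cross_eq_zero ⟨δ, hδ, fun τ h0 h1 => (H τ (by rwa [abs_of_nonneg h0])).2 h0⟩
  obtain ⟨a, rfl⟩ := exists_smul_of_cross_eq_zero h.1 h1
  obtain ⟨b, rfl⟩ := exists_smul_of_cross_eq_zero h.1 h2
  have := h'.1
  rw [cross_smul_left, cross_smul_right, cross_self] at this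
  simp at this

namespace Tessellation

variable {D : Set Plane} (T : Tessellation D)

/-! ### Vertices and skeleton of a tessellation -/

theorem cell_subset {c : Set Plane} (hc : c ∈ T.cells) : c ⊆ D := by
  rw [← T.sUnion_cells]; exact subset_sUnion_of_mem hc

theorem exists_cell {p : Plane} (hp : p ∈ D) : ∃ c ∈ T.cells, p ∈ c := by
  rw [← T.sUnion_cells] at hp; exact hp

theorem finite_vertices : T.vertices.Finite :=
  T.finite_cells.biUnion fun c hc => (T.isConvexPolygon c hc).finite_extremePoints

theorem mem_vertices {v : Plane} : v ∈ T.vertices ↔ ∃ c ∈ T.cells, v ∈ c.extremePoints ℝ := by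
  simp [vertices]

theorem finite_edges : {e | T.IsEdge e}.Finite := by
  refine ((T.finite_vertices.prod T.finite_vertices).image
    fun q => segment ℝ q.1 q.2).subset ?_
  rintro a ⟨x, hx, y, hy, -, rfl, -⟩
  exact ⟨(x, y), ⟨hx, hy⟩, rfl⟩

/-- A segment between vertices is cut into pieces by the vertices on it. -/
theorem exists_piece {x y p : Plane} (hx : x ∈ T.vertices) (hy : y ∈ T.vertices) (hxy : x ≠ y)
    (hp : p ∈ segment ℝ x y) : ∃ x' ∈ T.vertices, ∃ y' ∈ T.vertices, x' ≠ y' ∧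
      x' ∈ segment ℝ x y ∧ y' ∈ segment ℝ x y ∧ p ∈ segment ℝ x' y' ∧
      Disjoint (openSegment ℝ x' y') T.vertices := by
  let S : Set (Plane × Plane) := {q | q.1 ∈ T.vertices ∧ q.2 ∈ T.vertices ∧ q.1 ≠ q.2 ∧
    q.1 ∈ segment ℝ x y ∧ q.2 ∈ segment ℝ x y ∧ p ∈ segment ℝ q.1 q.2}
  have hS : S.Finite := (T.finite_vertices.prod T.finite_vertices).subset fun q hq => ⟨hq.1, hq.2.1⟩
  -- A shortest segment between two vertices which contains `p` has no vertex inside, as such a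
  -- vertex would cut off a shorter one.
  obtain ⟨q, hq, hmin⟩ := exists_min_image S (fun q => dist q.1 q.2) hS
    ⟨(x, y), hx, hy, hxy, left_mem_segment ℝ _ _, right_mem_segment ℝ _ _, hp⟩
  rcases q with ⟨a, b⟩
  obtain ⟨ha, hb, hab, has, hbs, hpab⟩ := hq
  refine ⟨a, ha, b, hb, hab, has, hbs, hpab, disjoint_left.2 fun w hw hwV => ?_⟩
  have hwab := openSegment_subset_segment ℝ _ _ hw
  have hwne := sub_ne_zero_of_oseg hab hw
  have hws := (convex_segment x y).segment_subset has hbs hwab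
  have hdist : dist a w + dist w b = dist a b := (mem_segment_iff_wbtw.1 hwab).dist_add_dist
  have h1 : 0 < dist a w := dist_pos.2 hwne.1.symm
  have h2 : 0 < dist w b := dist_pos.2 hwne.2
  obtain ⟨τ, h0, h1', rfl⟩ := mem_seg.1 hpab
  obtain ⟨σ, k0, k1, rfl⟩ := mem_oseg.1 hw
  have ea : a = a + (0 : ℝ) • (b - a) := by simp
  have eb : b = a + (1 : ℝ) • (b - a) := by simp
  rcases le_total τ σ with h | h
  · have := hmin (a, a + σ • (b - a)) ⟨ha, hwV, hwne.1.symm, has, hws, by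
      have := add_smul_mem_seg (p := a) (d := b - a) h0 h
      rwa [← ea] at this⟩
    simp only at this; linarith
  · have := hmin (a + σ • (b - a), b) ⟨hwV, hb, hwne.2, hws, hbs, by
      have := add_smul_mem_seg (p := a) (d := b - a) h h1'
      rwa [← eb] at this⟩
    simp only at this; linarith

theorem exists_edge_subset_side {c a : Set Plane} (hc : c ∈ T.cells) (ha : IsSide c a) {p : Plane}
    (hp : p ∈ a) : ∃ e, T.IsEdge e ∧ p ∈ e ∧ e ⊆ a := by
  obtain ⟨x, hx, y, hy, hxy, rfl, hs⟩ := id ha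
  obtain ⟨x', hx', y', hy', hne, hxs, hys, hp', hd⟩ := T.exists_piece
    (T.mem_vertices.2 ⟨c, hc, hx⟩) (T.mem_vertices.2 ⟨c, hc, hy⟩) hxy hp
  have hsub := (convex_segment x y).segment_subset hxs hys
  exact ⟨_, ⟨x', hx', y', hy', hne, rfl, ⟨c, hc, _, ha, hsub⟩, hd⟩, hp', hsub⟩

theorem mem_skeleton_iff_frontier {p : Plane} :
    p ∈ T.skeleton ↔ ∃ c ∈ T.cells, p ∈ frontier c := by
  constructor
  · rintro ⟨e, ⟨x, -, y, -, -, -, ⟨c, hc, a, ⟨-, -, -, -, -, -, h⟩, hea⟩, -⟩, hp⟩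
    exact ⟨c, hc, h (hea hp)⟩
  · rintro ⟨c, hc, hp⟩
    obtain ⟨a, ha, hpa⟩ := (T.isConvexPolygon c hc).exists_side hp
    obtain ⟨e, he, hpe, -⟩ := T.exists_edge_subset_side hc ha hpa
    exact ⟨e, he, hpe⟩

theorem frontier_cell_subset {c : Set Plane} (hc : c ∈ T.cells) : frontier c ⊆ T.skeleton :=
  fun _ hp => T.mem_skeleton_iff_frontier.2 ⟨c, hc, hp⟩

/-- A cell is the closure of its interior, so a frontier point of one cell cannot be interior to
another. In this form the skeleton is easy to compute when cells are cut or glued. -/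
theorem mem_skeleton_iff {p : Plane} :
    p ∈ T.skeleton ↔ p ∈ D ∧ ∀ c ∈ T.cells, p ∉ interior c := by
  rw [mem_skeleton_iff_frontier]
  constructor
  · rintro ⟨c, hc, hp⟩
    have hP := T.isConvexPolygon c hc
    refine ⟨T.cell_subset hc (hP.frontier_subset hp), fun c' hc' hp' => ?_⟩
    by_cases h : c = c'
    · subst h; exact (hP.mem_frontier.1 hp).2 hp'
    · have : p ∈ closure (interior c) := by rw [hP.closure_interior]; exact hP.frontier_subset hp
      obtain ⟨z, hz, hz'⟩ := mem_closure_iff.1 this _ isOpen_interior hp'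
      exact disjoint_left.1 (T.disjoint_interior c hc c' hc' h) hz' hz
  · rintro ⟨hp, h⟩
    obtain ⟨c, hc, hpc⟩ := T.exists_cell hp
    exact ⟨c, hc, (T.isConvexPolygon c hc).mem_frontier.2 ⟨hpc, h c hc⟩⟩

theorem disjoint_interior_skeleton {c : Set Plane} (hc : c ∈ T.cells) :
    Disjoint (interior c) T.skeleton :=
  disjoint_left.2 fun _ hz hz' => (T.mem_skeleton_iff.1 hz').2 c hc hz

theorem skeleton_subset : T.skeleton ⊆ D := fun _ hp => (T.mem_skeleton_iff.1 hp).1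

theorem isClosed_skeleton : IsClosed T.skeleton := by
  have : T.skeleton = ⋃ c ∈ T.cells, frontier c := by
    ext p; simp [mem_skeleton_iff_frontier]
  rw [this]
  exact T.finite_cells.isClosed_biUnion fun _ _ => isClosed_frontier

theorem isClosed_domain (T : Tessellation D) : IsClosed D := by
  rw [← T.sUnion_cells, sUnion_eq_biUnion]
  exact T.finite_cells.isClosed_biUnion fun c hc => (T.isConvexPolygon c hc).isClosed

theorem frontier_subset_skeleton : frontier D ⊆ T.skeleton := by
  intro p hp
  rw [T.isClosed_domain.frontier_eq] at hp
  exact T.mem_skeleton_iff.2 ⟨hp.1, fun c hc h => hp.2 (interior_mono (T.cell_subset hc) h)⟩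

theorem vertices_subset_skeleton : T.vertices ⊆ T.skeleton := by
  intro v hv
  obtain ⟨c, hc, hvc⟩ := T.mem_vertices.1 hv
  exact T.frontier_cell_subset hc ((T.isConvexPolygon c hc).extremePoints_subset_frontier hvc)

theorem extremePoints_subset_vertices : D.extremePoints ℝ ⊆ T.vertices := by
  intro v hv
  obtain ⟨c, hc, hvc⟩ := T.exists_cell hv.1
  exact T.mem_vertices.2 ⟨c, hc, hvc,
    fun x hx y hy h => hv.2 (T.cell_subset hc hx) (T.cell_subset hc hy) h⟩

theorem exists_cell_of_isPreconnected {X : Set Plane} (hX : IsPreconnected X) (hne : X.Nonempty)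
    (hXD : X ⊆ D) (hd : Disjoint X T.skeleton) : ∃ c ∈ T.cells, X ⊆ interior c := by
  obtain ⟨p, hp⟩ := hne
  have hp' := disjoint_left.1 hd hp
  rw [mem_skeleton_iff] at hp'
  push Not at hp'
  obtain ⟨c, hc, hpc⟩ := hp' (hXD hp)
  exact ⟨c, hc, subset_interior_of_disjoint_frontier hX (hd.mono_right (T.frontier_cell_subset hc))
    ⟨p, hp, hpc⟩⟩

theorem subset_interior_of_meets {X c : Set Plane} (hX : IsPreconnected X)
    (hd : Disjoint X T.skeleton) (hc : c ∈ T.cells) (hne : (X ∩ interior c).Nonempty) :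
    X ⊆ interior c :=
  subset_interior_of_disjoint_frontier hX (hd.mono_right (T.frontier_cell_subset hc)) hne

theorem cell_eq_of_meets {c c' : Set Plane} (hc : c ∈ T.cells) (hc' : c' ∈ T.cells)
    (h : (interior c ∩ interior c').Nonempty) : c = c' := by
  by_contra hne
  exact not_disjoint_iff_nonempty_inter.2 h (T.disjoint_interior c hc c' hc' hne)

/-- The interior of a cell is connected and avoids the common skeleton, so it lies inside a cell of
the other tessellation, and conversely; the two cells then coincide. -/
theorem cells_subset_of_skeleton_eq {T' : Tessellation D} (h : T.skeleton = T'.skeleton) :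
    T.cells ⊆ T'.cells := by
  intro c hc
  have key : ∀ (S S' : Tessellation D), S.skeleton = S'.skeleton → ∀ c ∈ S.cells,
      ∃ c' ∈ S'.cells, interior c ⊆ interior c' := fun S S' h c hc =>
    S'.exists_cell_of_isPreconnected (S.isConvexPolygon c hc).convex.interior.isPreconnected
      (S.isConvexPolygon c hc).1 (interior_subset.trans (S.cell_subset hc))
      (h ▸ S.disjoint_interior_skeleton hc)
  obtain ⟨c', hc', h1⟩ := key T T' h c hc
  obtain ⟨c'', hc'', h2⟩ := key T' T h.symm c' hc'
  obtain ⟨z, hz⟩ := (T.isConvexPolygon c hc).1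
  obtain rfl := T.cell_eq_of_meets hc hc'' ⟨z, hz, h2 (h1 hz)⟩
  have : c = c' := by
    rw [← (T.isConvexPolygon c hc).closure_interior,
      ← (T'.isConvexPolygon c' hc').closure_interior, h1.antisymm h2]
  rwa [this]

/-- A tessellation is determined by its skeleton. -/
theorem eq_of_skeleton_eq {T T' : Tessellation D} (h : T.skeleton = T'.skeleton) : T = T' :=
  Tessellation.ext ((T.cells_subset_of_skeleton_eq h).antisymm
    (T'.cells_subset_of_skeleton_eq h.symm))

theorem one_side {c : Set Plane} (hc : c ∈ T.cells) {p f : Plane} (hp : p ∈ c) (hf : f ≠ 0)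
    (h : ∃ δ > 0, ∀ τ : ℝ, |τ| ≤ δ → p + τ • f ∈ T.skeleton) :
    c ⊆ leftOf f p ∨ c ⊆ leftOf (-f) p := by
  obtain ⟨δ, hδ, H⟩ := h
  exact (T.isConvexPolygon c hc).one_side hp hδ hf fun τ hτ hi =>
    disjoint_left.1 (T.disjoint_interior_skeleton hc) hi (H τ hτ)

/-! ### Edges -/

variable {T}

theorem IsEdge.subset_skeleton {e : Set Plane} (he : T.IsEdge e) : e ⊆ T.skeleton :=
  subset_sUnion_of_mem he

theorem IsEdge.disjoint {x y : Plane} (he : T.IsEdge (segment ℝ x y)) :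
    x ≠ y ∧ x ∈ T.vertices ∧ y ∈ T.vertices ∧ Disjoint (openSegment ℝ x y) T.vertices := by
  obtain ⟨a, ha, b, hb, hab, h, -, hd⟩ := he
  rcases segment_eq_segment h with ⟨rfl, rfl⟩ | ⟨rfl, rfl⟩
  · exact ⟨hab, ha, hb, hd⟩
  · exact ⟨hab.symm, hb, ha, by rwa [openSegment_symm]⟩

theorem IsEdge.exists_oseg {e : Set Plane} (he : T.IsEdge e) {p : Plane} (hp : p ∈ e)
    (hpV : p ∉ T.vertices) : ∃ x ∈ T.vertices, ∃ y ∈ T.vertices, x ≠ y ∧ e = segment ℝ x y ∧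
      p ∈ openSegment ℝ x y ∧ Disjoint (openSegment ℝ x y) T.vertices := by
  obtain ⟨x, hx, y, hy, hxy, rfl, -, hd⟩ := he
  refine ⟨x, hx, y, hy, hxy, rfl, ?_, hd⟩
  rcases mem_seg_iff_oseg.1 hp with rfl | rfl | h
  · exact absurd hx hpV
  · exact absurd hy hpV
  · exact h

theorem IsEdge.eq_segment {e : Set Plane} (he : T.IsEdge e) {v : Plane} (hv : v ∈ e)
    (hvV : v ∈ T.vertices) : ∃ w ∈ T.vertices, w ≠ v ∧ e = segment ℝ v w := by
  obtain ⟨x, hx, y, hy, hxy, rfl, -, hd⟩ := he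
  rcases mem_seg_iff_oseg.1 hv with rfl | rfl | h
  · exact ⟨y, hy, hxy.symm, rfl⟩
  · exact ⟨x, hx, hxy, segment_symm ℝ _ _⟩
  · exact absurd hvV (disjoint_left.1 hd h)

theorem IsEdge.isClosed {e : Set Plane} (he : T.IsEdge e) : IsClosed e := by
  obtain ⟨x, -, y, -, -, rfl, -⟩ := he; exact isClosed_seg x y

variable (T) in
theorem eventually_mem_edge (p : Plane) :
    ∀ᶠ z in 𝓝 p, z ∈ T.skeleton → ∃ e, T.IsEdge e ∧ p ∈ e ∧ z ∈ e := by
  have h1 : ∀ᶠ z in 𝓝 p, ∀ e ∈ {e | T.IsEdge e}, p ∉ e → z ∉ e := by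
    rw [eventually_all_finite T.finite_edges]
    intro e he
    by_cases hp : p ∈ e
    · exact Eventually.of_forall fun z h => absurd hp h
    · filter_upwards [(IsEdge.isClosed he).isOpen_compl.mem_nhds hp] with z hz _ using hz
  filter_upwards [h1] with z hz ⟨e, he, hze⟩
  refine ⟨e, he, ?_, hze⟩
  by_contra hp
  exact hz e he hp hze

theorem smul_mem_of_oseg {x y p : Plane} (h : p ∈ openSegment ℝ x y) :
    ∃ δ > 0, ∀ τ : ℝ, |τ| ≤ δ → p + τ • (y - x) ∈ segment ℝ x y := by
  obtain ⟨σ, h0, h1, rfl⟩ := mem_oseg.1 h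
  refine ⟨min σ (1 - σ), lt_min h0 (by linarith), fun τ hτ => mem_seg.2 ⟨σ + τ, ?_, ?_, by module⟩⟩
  · have := (abs_le.1 (hτ.trans (min_le_left _ _))).1; linarith
  · have := (abs_le.1 (hτ.trans (min_le_right _ _))).2; linarith

/-- The edge `e` lies in a cell, and this cell lies on one side of the line through `x` and `y`. As
`p` is inside `e`, the two ends of `e` can be on the same side only if both are on the line. -/
theorem collinear_of_edges {x y : Plane} {p : Plane} {e : Set Plane}
    (hxy : x ≠ y) (hK : segment ℝ x y ⊆ T.skeleton) (hp : p ∈ openSegment ℝ x y)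
    (he : T.IsEdge e) (hpe : p ∈ e) (hpV : p ∉ T.vertices) :
    ∀ z ∈ e, cross (y - x) (z - p) = 0 := by
  have hd : y - x ≠ 0 := sub_ne_zero.2 hxy.symm
  obtain ⟨a, ha, b, hb, hab, rfl, hpo, hdis⟩ := he.exists_oseg hpe hpV
  obtain ⟨-, -, -, -, -, -, ⟨c, hc, s, ⟨-, -, -, -, -, -, hs⟩, hes⟩, -⟩ := he
  have hec : segment ℝ a b ⊆ c := (hes.trans hs).trans (T.isConvexPolygon c hc).frontier_subset
  obtain ⟨δ, hδ, H⟩ := smul_mem_of_oseg hp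
  have key : cross (y - x) (b - a) = 0 := by
    obtain ⟨σ, h0, h1, hσ⟩ := mem_oseg.1 hpo
    have e1 : a - p = (-σ) • (b - a) := by rw [hσ]; module
    have e2 : b - p = (1 - σ) • (b - a) := by rw [hσ]; module
    rcases T.one_side hc (hec hpe) hd ⟨δ, hδ, fun τ hτ => hK (H τ hτ)⟩ with h | h
    · have k1 := h (hec (left_mem_segment ℝ a b))
      have k2 := h (hec (right_mem_segment ℝ a b))
      simp only [leftOf, mem_ofPred_eq, e1, e2, cross_smul_right] at k1 k2
      have := nonneg_of_mul_nonneg_right k2 (by linarith)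
      nlinarith
    · have k1 := h (hec (left_mem_segment ℝ a b))
      have k2 := h (hec (right_mem_segment ℝ a b))
      simp only [leftOf, mem_ofPred_eq, e1, e2, cross_smul_right, cross_neg_left] at k1 k2
      have := nonneg_of_mul_nonneg_right (show 0 ≤ (1 - σ) * -cross (y - x) (b - a) by linarith)
        (by linarith)
      nlinarith
  intro z hz
  obtain ⟨σ, h0, h1, hσ⟩ := mem_oseg.1 hpo
  obtain ⟨σ', -, -, hσ'⟩ := mem_seg.1 hz
  rw [show z - p = (σ' - σ) • (b - a) by rw [hσ, hσ']; module, cross_smul_right, key, mul_zero]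

theorem exists_flat_of_edge {x y : Plane} {p : Plane} (hxy : x ≠ y)
    (hK : segment ℝ x y ⊆ T.skeleton) (hp : p ∈ openSegment ℝ x y) (hpV : p ∉ T.vertices) :
    IsFlatAt T.skeleton p (y - x) := by
  have hd : y - x ≠ 0 := sub_ne_zero.2 hxy.symm
  refine ⟨hd, ?_⟩
  obtain ⟨δ, hδ, H⟩ := smul_mem_of_oseg hp
  filter_upwards [T.eventually_mem_edge p, eventually_line p hd hδ] with z h1 h2
  constructor
  · intro hz
    obtain ⟨e, he, hpe, hze⟩ := h1 hz
    exact collinear_of_edges hxy hK hp he hpe hpV z hze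
  · intro hz
    obtain ⟨τ, hτ, rfl⟩ := h2 hz
    exact hK (H τ hτ.le)

theorem exists_isFlatAt {p : Plane} (hp : p ∈ T.skeleton) (hpV : p ∉ T.vertices) :
    ∃ d, IsFlatAt T.skeleton p d := by
  obtain ⟨e, he, hpe⟩ := hp
  obtain ⟨x, hx, y, hy, hxy, rfl, hpo, hd⟩ := he.exists_oseg hpe hpV
  exact ⟨_, exists_flat_of_edge hxy he.subset_skeleton hpo hpV⟩

/-- At a flat point, a cell containing `p` contains a half-disc at `p` (cut by `D` if `p` is on the
boundary). It therefore contains a short segment of the line around `p`, and `p` is not extreme in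
it. -/
theorem not_mem_vertices_of_isFlatAt (hD : IsConvexPolygon D) {p d : Plane}
    (h : IsFlatAt T.skeleton p d) : p ∉ T.vertices := by
  intro hp
  obtain ⟨c, hc, hpc⟩ := T.mem_vertices.1 hp
  have hP := T.isConvexPolygon c hc
  obtain ⟨f, hf, hfc⟩ : ∃ f, IsFlatAt T.skeleton p f ∧ c ⊆ leftOf f p := by
    rcases T.one_side hc hpc.1 h.1 h.exists_small with h1 | h1
    · exact ⟨d, h, h1⟩
    · exact ⟨-d, h.neg, h1⟩
  obtain ⟨ε, hε, H⟩ := Metric.eventually_nhds_iff_ball.1 hf.2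
  -- Convex and disjoint from the skeleton, hence inside one cell. The intersection with the
  -- interior of `D` is there because `p` may lie on the boundary of `D`.
  let X := Metric.ball p ε ∩ {z | 0 < cross f (z - p)} ∩ interior D
  have hXc : Convex ℝ X := ((convex_ball p ε).inter (convex_cross_pos f p)).inter hD.convex.interior
  have hXd : Disjoint X T.skeleton := disjoint_left.2 fun z hz hzK => by
    have h1 := (H z hz.1.1).1 hzK
    have h2 : 0 < cross f (z - p) := hz.1.2
    linarith
  obtain ⟨o, ho, hoX⟩ : (X ∩ interior c).Nonempty := by
    have : p ∈ closure (interior c) := by rw [hP.closure_interior]; exact hpc.1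
    obtain ⟨z, hz, hzc⟩ := mem_closure_iff_nhds.1 this _ (Metric.ball_mem_nhds p hε)
    refine ⟨z, ⟨⟨hz, show 0 < cross f (z - p) from
      lt_of_le_of_ne (hfc (interior_subset hzc)) fun h0 => ?_⟩,
      interior_mono (T.cell_subset hc) hzc⟩, hzc⟩
    exact disjoint_left.1 (T.disjoint_interior_skeleton hc) hzc ((H z hz).2 h0.symm)
  have hXint := T.subset_interior_of_meets hXc.isPreconnected hXd hc ⟨o, ho, hoX⟩
  have hXcl : closure X ⊆ c := by
    rw [← hP.closure_interior]; exact closure_mono hXint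
  obtain ⟨δ, hδ, Hδ⟩ := TTess.exists_small (d := f) (Metric.ball_mem_nhds p hε)
  have key : ∀ τ : ℝ, |τ| ≤ δ → p + τ • f ∈ c := by
    intro τ hτ
    refine hXcl ?_
    set w := p + τ • f with hw
    have hwb := Hδ τ hτ
    have hw0 : cross f (w - p) = 0 := by
      rw [hw, add_sub_cancel_left, cross_smul_right, cross_self, mul_zero]
    have hwD : w ∈ D := T.skeleton_subset ((H w hwb).2 hw0)
    -- Points of the line are reached from inside `X`, along the segment to its point `o`.
    have hlim : Tendsto (fun s : ℝ => w + s • (o - w)) (𝓝[>] 0) (𝓝 w) :=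
      (oseg_ray_tendsto w (o - w)).mono_left nhdsWithin_le_nhds
    refine mem_closure_of_tendsto hlim ?_
    filter_upwards [Ioo_mem_nhdsGT (zero_lt_one' ℝ)] with s hs
    have hs0 : 0 < s := hs.1
    have hs1 : s < 1 := hs.2
    have e : w + s • (o - w) = (1 - s) • w + s • o := by module
    refine ⟨⟨?_, ?_⟩, ?_⟩
    · rw [e]
      exact convex_ball p ε hwb ho.1.1 (by linarith) hs0.le (by ring)
    · have h1 : 0 < cross f (o - p) := ho.1.2
      change 0 < cross f (w + s • (o - w) - p)
      rw [show w + s • (o - w) - p = (1 - s) • (w - p) + s • (o - p) by module,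
        cross_add_right, cross_smul_right, cross_smul_right, hw0]
      nlinarith
    · rw [e]
      exact hD.convex.combo_self_interior_mem_interior hwD ho.2 (by linarith) hs0 (by ring)
  have := hpc.2 (key (-δ) (by rw [abs_neg, abs_of_pos hδ])) (key δ (by rw [abs_of_pos hδ])) (by
    have := add_smul_mem_oseg (p := p) (d := f) (neg_lt_zero.2 hδ) hδ
    rwa [zero_smul, add_zero] at this)
  have h2 : (-δ) • f = 0 := by simpa using this
  rcases smul_eq_zero.1 h2 with h | h
  · linarith
  · exact hf.1 h

end Tessellation

/-! ### Convexity of a skeleton along lines -/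

theorem seg_subset_union {p d : Plane} {α β γ : ℝ} (h1 : α ≤ β) (h2 : β ≤ γ) :
    segment ℝ (p + α • d) (p + γ • d) ⊆
      segment ℝ (p + α • d) (p + β • d) ∪ segment ℝ (p + β • d) (p + γ • d) := by
  intro z hz
  obtain ⟨τ, k1, k2, rfl⟩ := mem_seg_add_smul (h1.trans h2) hz
  rcases le_total τ β with h | h
  · exact Or.inl (add_smul_mem_seg k1 h)
  · exact Or.inr (add_smul_mem_seg h k2)

theorem oseg_nonempty (x y : Plane) : (openSegment ℝ x y).Nonempty :=
  ⟨_, mem_oseg.2 ⟨1 / 2, by norm_num, by norm_num, rfl⟩⟩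

/-- The points of `K` belonging to a non-degenerate segment with direction `d` contained in `K`. -/
def core (K : Set Plane) (d : Plane) : Set Plane :=
  {p | ∃ τ : ℝ, τ ≠ 0 ∧ segment ℝ p (p + τ • d) ⊆ K}

/-- Any two aligned segments contained in `K` belong to a common one. -/
def AlignedConvex (K : Set Plane) : Prop :=
  ∀ d, d ≠ 0 → ∀ p ∈ core K d, ∀ p' ∈ core K d, cross d (p' - p) = 0 → segment ℝ p p' ⊆ K

theorem core_mono {K K' : Set Plane} (h : K ⊆ K') (d : Plane) : core K d ⊆ core K' d :=
  fun _ ⟨τ, h0, hs⟩ => ⟨τ, h0, hs.trans h⟩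

theorem core_subset (K : Set Plane) (d : Plane) : core K d ⊆ K :=
  fun _ ⟨_, _, hs⟩ => hs (left_mem_segment ℝ _ _)

theorem core_smul {K : Set Plane} {d : Plane} {a : ℝ} (ha : a ≠ 0) : core K (a • d) = core K d := by
  ext p
  constructor
  · rintro ⟨τ, h0, hs⟩
    exact ⟨τ * a, mul_ne_zero h0 ha, by rwa [mul_smul]⟩
  · rintro ⟨τ, h0, hs⟩
    exact ⟨τ / a, div_ne_zero h0 ha, by rwa [smul_smul, div_mul_cancel₀ _ ha]⟩

theorem mem_core_of_segment {K : Set Plane} {x y z : Plane}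
    (hK : segment ℝ x y ⊆ K) (hz : z ∈ segment ℝ x y) : z ∈ core K (y - x) := by
  obtain ⟨τ, h0, h1, rfl⟩ := mem_seg.1 hz
  by_cases h : τ = 1
  · refine ⟨-1, by norm_num, ?_⟩
    rw [h, show x + (1 : ℝ) • (y - x) = y by module, show y + (-1 : ℝ) • (y - x) = x by module,
      segment_symm]
    exact hK
  · refine ⟨1 - τ, sub_ne_zero.2 (Ne.symm h), ?_⟩
    rw [show x + τ • (y - x) + (1 - τ) • (y - x) = y by module]
    exact ((convex_segment x y).segment_subset hz (right_mem_segment ℝ x y)).trans hK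

namespace Tessellation

variable {D : Set Plane} {T : Tessellation D}

/-! ### Edges at a vertex -/

theorem IsEdge.exists_param {e : Set Plane} (he : T.IsEdge e) {p d : Plane} (hp : p ∈ e)
    (hpV : p ∉ T.vertices) (hd : d ≠ 0) (hcol : ∀ z ∈ e, cross d (z - p) = 0) :
    ∃ α β : ℝ, α < 0 ∧ 0 < β ∧ p + α • d ∈ T.vertices ∧ p + β • d ∈ T.vertices ∧
      e = segment ℝ (p + α • d) (p + β • d) ∧
      Disjoint (openSegment ℝ (p + α • d) (p + β • d)) T.vertices := by
  obtain ⟨x, hx, y, hy, hxy, rfl, ho, hdis⟩ := he.exists_oseg hp hpV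
  obtain ⟨α, hα⟩ := exists_smul_of_cross_eq_zero hd (hcol x (left_mem_segment ℝ _ _))
  obtain ⟨β, hβ⟩ := exists_smul_of_cross_eq_zero hd (hcol y (right_mem_segment ℝ _ _))
  have ex : x = p + α • d := by rw [← hα]; abel
  have ey : y = p + β • d := by rw [← hβ]; abel
  obtain ⟨σ, h0, h1, hσ⟩ := mem_oseg.1 ho
  have h2 : (α + σ * (β - α)) • d = 0 := by
    have : p + (α + σ * (β - α)) • d = p := by
      nth_rewrite 2 [hσ]; rw [ex, ey]; module
    simpa using this
  have h3 := (smul_eq_zero.1 h2).resolve_right hd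
  have hne : α ≠ β := by rintro rfl; exact hxy (ex.trans ey.symm)
  rcases lt_or_gt_of_ne hne with h | h
  · refine ⟨α, β, by nlinarith, by nlinarith, ?_⟩
    rw [← ex, ← ey]; exact ⟨hx, hy, rfl, hdis⟩
  · refine ⟨β, α, by nlinarith, by nlinarith, ?_⟩
    rw [← ex, ← ey]; exact ⟨hy, hx, segment_symm ℝ _ _, by rwa [openSegment_symm]⟩

theorem IsEdge.eq_of_mem {e e' : Set Plane} (he : T.IsEdge e) (he' : T.IsEdge e') {p : Plane}
    (hp : p ∈ e) (hp' : p ∈ e') (hpV : p ∉ T.vertices) : e = e' := by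
  obtain ⟨x, hx, y, hy, hxy, rfl, ho, -⟩ := he.exists_oseg hp hpV
  have hd : y - x ≠ 0 := sub_ne_zero.2 hxy.symm
  have hcol := collinear_of_edges hxy he.subset_skeleton ho he' hp' hpV
  have hcol' := collinear_of_edges hxy he.subset_skeleton ho he hp hpV
  obtain ⟨α, β, h1, h2, h3, h4, h5, h6⟩ := he.exists_param hp hpV hd hcol'
  obtain ⟨α', β', k1, k2, k3, k4, k5, k6⟩ := he'.exists_param hp' hpV hd hcol
  have e1 : α = α' := by
    rcases lt_trichotomy α α' with h | h | h
    · exact absurd k3 (disjoint_left.1 h6 (add_smul_mem_oseg h (by linarith)))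
    · exact h
    · exact absurd h3 (disjoint_left.1 k6 (add_smul_mem_oseg h (by linarith)))
  have e2 : β = β' := by
    rcases lt_trichotomy β β' with h | h | h
    · exact absurd h4 (disjoint_left.1 k6 (add_smul_mem_oseg (by linarith) h))
    · exact h
    · exact absurd k4 (disjoint_left.1 h6 (add_smul_mem_oseg (by linarith) h))
  rw [h5, k5, e1, e2]

/-- Two edges leaving `v` in the same direction share a point inside both, which is no vertex. -/
theorem IsEdge.eq_of_dir {v u : Plane} {r r' : ℝ} (hr : 0 < r) (hr' : 0 < r')
    (h : T.IsEdge (segment ℝ v (v + r • u))) (h' : T.IsEdge (segment ℝ v (v + r' • u))) :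
    segment ℝ v (v + r • u) = segment ℝ v (v + r' • u) := by
  have hm : 0 < min r r' / 2 := by have := lt_min hr hr'; linarith
  have e0 : v = v + (0 : ℝ) • u := by simp
  have h1 : min r r' / 2 < r := by have := min_le_left r r'; linarith
  have h2 : min r r' / 2 < r' := by have := min_le_right r r'; linarith
  have o1 := add_smul_mem_oseg (p := v) (d := u) hm h1
  have o2 := add_smul_mem_oseg (p := v) (d := u) hm h2
  rw [← e0] at o1 o2
  exact h.eq_of_mem h' (openSegment_subset_segment ℝ _ _ o1) (openSegment_subset_segment ℝ _ _ o2)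
    (disjoint_left.1 h.disjoint.2.2.2 o1)

/-- Near `v` the skeleton consists of edges through `v`, and an edge containing a vertex has it as
an end. -/
theorem exists_edge_dir {v u : Plane} (hv : v ∈ T.vertices) (hu : u ≠ 0)
    (h : ∃ δ > 0, ∀ τ : ℝ, 0 ≤ τ → τ ≤ δ → v + τ • u ∈ T.skeleton) :
    ∃ r : ℝ, 0 < r ∧ T.IsEdge (segment ℝ v (v + r • u)) := by
  obtain ⟨δ, hδ, H⟩ := h
  obtain ⟨δ', hδ', H'⟩ := TTess.exists_small (d := u) (T.eventually_mem_edge v)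
  have hm : 0 < min δ δ' := lt_min hδ hδ'
  obtain ⟨e, he, hve, hze⟩ := H' (min δ δ') (by rw [abs_of_pos hm]; exact min_le_right _ _)
    (H _ hm.le (min_le_left _ _))
  obtain ⟨w, hw, hwv, rfl⟩ := he.eq_segment hve hv
  obtain ⟨s, hs0, hs1, hs⟩ := mem_seg.1 hze
  have hs2 : min δ δ' • u = s • (w - v) := by simpa using hs
  have hspos : 0 < s := lt_of_le_of_ne hs0 (by
    rintro rfl
    rw [zero_smul] at hs2
    rcases smul_eq_zero.1 hs2 with h | h
    · exact hm.ne' h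
    · exact hu h)
  refine ⟨min δ δ' / s, div_pos hm hspos, ?_⟩
  have : v + (min δ δ' / s) • u = w := by
    rw [div_eq_inv_mul, mul_smul, hs2, smul_smul, inv_mul_cancel₀ hspos.ne', one_smul]; abel
  rwa [this]

/-- Distinct edges at `v` have distinct directions. So the two aligned edges are opposite and form
the line of the germ, while the third is transversal and forms its stem. -/
theorem isTeeAt_of_isTVertex {v : Plane} (hv : v ∈ T.vertices) (h : T.IsTVertex v) :
    ∃ d e, IsTeeAt T.skeleton v d e := by
  obtain ⟨hcard, e₁, e₂, he₁, he₂, hv₁, hv₂, hne, hcol⟩ := h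
  obtain ⟨e₃, he₃, hv₃, h31, h32, hall⟩ : ∃ e₃, T.IsEdge e₃ ∧ v ∈ e₃ ∧ e₃ ≠ e₁ ∧ e₃ ≠ e₂ ∧
      ∀ e, T.IsEdge e → v ∈ e → e = e₁ ∨ e = e₂ ∨ e = e₃ := by
    obtain ⟨a, b, c, hab, hac, hbc, habc⟩ := ncard_eq_three.1 hcard
    have m : ∀ e, T.IsEdge e → v ∈ e → e = a ∨ e = b ∨ e = c := fun e h1 h2 => by
      have : e ∈ {e | T.IsEdge e ∧ v ∈ e} := ⟨h1, h2⟩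
      rw [habc] at this; simpa using this
    have ma : a ∈ {e | T.IsEdge e ∧ v ∈ e} := by rw [habc]; simp
    have mb : b ∈ {e | T.IsEdge e ∧ v ∈ e} := by rw [habc]; simp
    have mc : c ∈ {e | T.IsEdge e ∧ v ∈ e} := by rw [habc]; simp
    rcases m e₁ he₁ hv₁ with rfl | rfl | rfl <;> rcases m e₂ he₂ hv₂ with rfl | rfl | rfl
    · exact absurd rfl hne
    · exact ⟨c, mc.1, mc.2, hac.symm, hbc.symm, m⟩
    · exact ⟨b, mb.1, mb.2, hab.symm, hbc, fun e h h' => by rcases m e h h' with h | h | h <;> tauto⟩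
    · exact ⟨c, mc.1, mc.2, hbc.symm, hac.symm,
        fun e h h' => by rcases m e h h' with h | h | h <;> tauto⟩
    · exact absurd rfl hne
    · exact ⟨a, ma.1, ma.2, hab, hac, fun e h h' => by rcases m e h h' with h | h | h <;> tauto⟩
    · exact ⟨b, mb.1, mb.2, hbc, hab.symm, fun e h h' => by rcases m e h h' with h | h | h <;> tauto⟩
    · exact ⟨a, ma.1, ma.2, hac, hab, fun e h h' => by rcases m e h h' with h | h | h <;> tauto⟩
    · exact absurd rfl hne
  obtain ⟨w₁, -, hw₁, rfl⟩ := he₁.eq_segment hv₁ hv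
  obtain ⟨w₂, -, hw₂, rfl⟩ := he₂.eq_segment hv₂ hv
  obtain ⟨w₃, -, hw₃, rfl⟩ := he₃.eq_segment hv₃ hv
  have hd : w₁ - v ≠ 0 := sub_ne_zero.2 hw₁
  have z1 : ∀ w : Plane, w = v + (1 : ℝ) • (w - v) := fun w => by module
  have same : ∀ {w w' : Plane}, T.IsEdge (segment ℝ v w) → T.IsEdge (segment ℝ v w') → ∀ τ : ℝ,
      0 < τ → w' - v = τ • (w - v) → segment ℝ v w = segment ℝ v w' := by
    intro w w' h h' τ hτ he
    have e : w' = v + τ • (w - v) := by rw [← he]; abel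
    rw [z1 w] at h
    rw [e] at h' ⊢
    have := IsEdge.eq_of_dir one_pos hτ h h'
    rwa [← z1 w] at this
  -- the two aligned edges are opposite
  obtain ⟨τ, hτ⟩ : ∃ τ : ℝ, w₂ - v = τ • (w₁ - v) := by
    rw [collinear_iff_of_mem (p₀ := v) (Or.inl (left_mem_segment ℝ _ _))] at hcol
    obtain ⟨d, hd'⟩ := hcol
    obtain ⟨a, ha⟩ := hd' w₁ (Or.inl (right_mem_segment ℝ _ _))
    obtain ⟨b, hb⟩ := hd' w₂ (Or.inr (right_mem_segment ℝ _ _))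
    simp only [vadd_eq_add] at ha hb
    have ha0 : a ≠ 0 := by rintro rfl; simp at ha; exact hw₁ ha
    refine ⟨b / a, ?_⟩
    rw [ha, hb, add_sub_cancel_right, add_sub_cancel_right, smul_smul, div_mul_cancel₀ _ ha0]
  have hτ0 : τ < 0 := by
    rcases lt_trichotomy τ 0 with h | h | h
    · exact h
    · rw [h, zero_smul, sub_eq_zero] at hτ; exact absurd hτ hw₂
    · exact absurd (same he₁ he₂ τ h hτ) hne
  have hc : cross (w₁ - v) (w₃ - v) ≠ 0 := by
    intro h0
    obtain ⟨σ, hσ⟩ := exists_smul_of_cross_eq_zero hd h0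
    rcases lt_trichotomy σ 0 with h | h | h
    · refine h32 (same he₂ he₃ (σ / τ) (div_pos_of_neg_of_neg h hτ0) ?_).symm
      rw [hτ, hσ, smul_smul, div_mul_cancel₀ _ hτ0.ne]
    · rw [h, zero_smul, sub_eq_zero] at hσ; exact hw₃ hσ
    · exact h31 (same he₁ he₃ σ h hσ).symm
  -- the germ
  have germ : ∀ d : Plane, 0 < cross d (w₃ - v) → (∃ κ : ℝ, κ ≠ 0 ∧ w₁ - v = κ • d) →
      IsTeeAt T.skeleton v d (w₃ - v) := by
    rintro d hpos ⟨κ, hκ, hκd⟩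
    refine ⟨hpos, ?_⟩
    have hm : 0 < min 1 (-τ) := lt_min one_pos (by linarith)
    filter_upwards [T.eventually_mem_edge v, eventually_line v hd hm,
      eventually_ray v hpos one_pos] with z h1 h2 h3
    constructor
    · intro hz
      obtain ⟨e, he, hve, hze⟩ := h1 hz
      rcases hall e he hve with rfl | rfl | rfl
      · left
        obtain ⟨s, -, -, rfl⟩ := mem_seg.1 hze
        rw [add_sub_cancel_left, hκd, cross_smul_right, cross_smul_right, cross_self]; simp
      · left
        obtain ⟨s, -, -, rfl⟩ := mem_seg.1 hze
        rw [add_sub_cancel_left, hτ, hκd, cross_smul_right, cross_smul_right, cross_smul_right,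
          cross_self]; simp
      · right
        obtain ⟨s, hs, -, rfl⟩ := mem_seg.1 hze
        rw [add_sub_cancel_left, cross_smul_right, cross_smul_right, cross_self]
        exact ⟨mul_zero _, mul_nonneg hs hpos.le⟩
    · rintro (hz | ⟨hz, hz'⟩)
      · obtain ⟨s, hs, rfl⟩ := h2 (by rw [hκd, cross_smul_left, hz, mul_zero])
        have hs1 := abs_lt.1 (lt_of_lt_of_le hs (min_le_left _ _))
        have hs2 := abs_lt.1 (lt_of_lt_of_le hs (min_le_right _ _))
        rcases le_total 0 s with h | h
        · exact he₁.subset_skeleton (mem_seg.2 ⟨s, h, hs1.2.le, rfl⟩)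
        · refine he₂.subset_skeleton (mem_seg.2 ⟨s / τ, div_nonneg_of_nonpos h hτ0.le, ?_, ?_⟩)
          · rw [div_le_one_of_neg hτ0]; linarith
          · rw [hτ, smul_smul, div_mul_cancel₀ _ hτ0.ne]
      · obtain ⟨s, hs, hs1, rfl⟩ := h3 hz hz'
        exact he₃.subset_skeleton (mem_seg.2 ⟨s, hs, hs1.le, rfl⟩)
  -- The sign of `d` is chosen such that the stem points to its left, as `IsTeeAt` requires.
  rcases lt_or_gt_of_ne hc with h | h
  · exact ⟨_, _, germ (-(w₁ - v)) (by rw [cross_neg_left]; linarith)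
      ⟨-1, by norm_num, by module⟩⟩
  · exact ⟨_, _, germ (w₁ - v) h ⟨1, by norm_num, by module⟩⟩

/-- Each of the three half-lines of the germ carries one edge, and `IsTeeAt.cross_eq_zero` leaves no
other direction for an edge at `v`. -/
theorem isTVertex_of_isTeeAt {v d e : Plane} (hv : v ∈ T.vertices)
    (h : IsTeeAt T.skeleton v d e) : T.IsTVertex v := by
  have hd : d ≠ 0 := ne_zero_left_of_cross h.1.ne'
  have he : e ≠ 0 := ne_zero_right_of_cross h.1.ne'
  obtain ⟨δ, hδ, H⟩ := h.exists_small
  obtain ⟨r₁, hr₁, h₁⟩ := exists_edge_dir hv hd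
    ⟨δ, hδ, fun τ h0 h1 => (H τ (by rwa [abs_of_nonneg h0])).1⟩
  obtain ⟨r₂, hr₂, h₂⟩ := exists_edge_dir hv (neg_ne_zero.2 hd)
    ⟨δ, hδ, fun τ h0 h1 => by
      have := (H (-τ) (by rwa [abs_neg, abs_of_nonneg h0])).1
      rwa [neg_smul, ← smul_neg] at this⟩
  obtain ⟨r₃, hr₃, h₃⟩ := exists_edge_dir hv he
    ⟨δ, hδ, fun τ h0 h1 => (H τ (by rwa [abs_of_nonneg h0])).2 h0⟩
  have n12 : segment ℝ v (v + r₁ • d) ≠ segment ℝ v (v + r₂ • -d) := by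
    intro h
    have : v + r₁ • d ∈ segment ℝ v (v + r₂ • -d) := h ▸ right_mem_segment ℝ _ _
    obtain ⟨τ, h0, -, h2⟩ := mem_seg.1 this
    have h3 : (r₁ + τ * r₂) • d = 0 := by
      rw [show (r₁ + τ * r₂) • d = v + r₁ • d - (v + τ • (v + r₂ • -d - v)) by module, ← h2, sub_self]
    have := (smul_eq_zero.1 h3).resolve_right hd
    nlinarith [mul_nonneg h0 hr₂.le]
  have nn : ∀ (κ : ℝ) (r : ℝ), 0 < r → segment ℝ v (v + r₃ • e) ≠ segment ℝ v (v + r • κ • d) := by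
    intro κ r hr heq
    obtain ⟨τ, -, -, h5⟩ := mem_seg.1 (heq.subset (right_mem_segment ℝ v (v + r₃ • e)))
    have h6 : r₃ • e = (τ * r * κ) • d := by
      have : v + r₃ • e = v + (τ * r * κ) • d := by rw [h5]; module
      simpa using this
    have h7 : cross d (r₃ • e) = 0 := by rw [h6, cross_smul_right, cross_self, mul_zero]
    rw [cross_smul_right] at h7
    exact (mul_pos hr₃ h.1).ne' h7
  have n13 : segment ℝ v (v + r₁ • d) ≠ segment ℝ v (v + r₃ • e) := by
    have := nn 1 r₁ hr₁; rw [one_smul] at this; exact this.symm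
  have n23 : segment ℝ v (v + r₂ • -d) ≠ segment ℝ v (v + r₃ • e) := by
    have := nn (-1) r₂ hr₂; rw [neg_one_smul] at this; exact this.symm
  refine ⟨ncard_eq_three.2 ⟨_, _, _, n12, n13, n23, ?_⟩, _, _, h₁, h₂, left_mem_segment ℝ _ _,
    left_mem_segment ℝ _ _, n12, ?_⟩
  · ext E
    simp only [mem_ofPred_eq, mem_insert_iff, mem_singleton_iff]
    constructor
    · rintro ⟨hE, hvE⟩
      obtain ⟨w, hw, hwv, rfl⟩ := hE.eq_segment hvE hv
      have hw0 : w - v ≠ 0 := sub_ne_zero.2 hwv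
      have hdir : ∀ (u : Plane) (r κ : ℝ), 0 < r → 0 < κ → T.IsEdge (segment ℝ v (v + r • u)) →
          w - v = κ • u → segment ℝ v w = segment ℝ v (v + r • u) := by
        intro u r κ hr hκ hr' hwu
        have : w = v + κ • u := by rw [← hwu]; abel
        rw [this] at hE ⊢
        exact IsEdge.eq_of_dir hκ hr hE hr'
      rcases h.cross_eq_zero (u := w - v) ⟨1, one_pos, fun τ h0 h1 =>
        hE.subset_skeleton (mem_seg.2 ⟨τ, h0, h1, rfl⟩)⟩ with h0 | ⟨h0, h0'⟩
      · obtain ⟨κ, hκ⟩ := exists_smul_of_cross_eq_zero hd h0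
        rcases lt_trichotomy κ 0 with hlt | rfl | hgt
        · exact Or.inr (Or.inl (hdir _ _ (-κ) hr₂ (by linarith) h₂ (by rw [hκ]; module)))
        · rw [zero_smul] at hκ; exact absurd hκ hw0
        · exact Or.inl (hdir _ _ κ hr₁ hgt h₁ hκ)
      · obtain ⟨κ, hκ⟩ := exists_smul_of_cross_eq_zero he h0
        rw [hκ, cross_smul_right] at h0'
        have hκ0 := nonneg_of_mul_nonneg_left h0' h.1
        rcases hκ0.lt_or_eq with hgt | rfl
        · exact Or.inr (Or.inr (hdir _ _ κ hr₃ hgt h₃ hκ))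
        · rw [zero_smul] at hκ; exact absurd hκ hw0
    · rintro (rfl | rfl | rfl)
      · exact ⟨h₁, left_mem_segment ℝ _ _⟩
      · exact ⟨h₂, left_mem_segment ℝ _ _⟩
      · exact ⟨h₃, left_mem_segment ℝ _ _⟩
  · rw [collinear_iff_of_mem (p₀ := v) (Or.inl (left_mem_segment ℝ _ _))]
    refine ⟨d, ?_⟩
    rintro p (hp | hp)
    · obtain ⟨τ, -, -, rfl⟩ := mem_seg.1 hp
      exact ⟨τ * r₁, by rw [vadd_eq_add]; module⟩
    · obtain ⟨τ, -, -, rfl⟩ := mem_seg.1 hp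
      exact ⟨-(τ * r₂), by rw [vadd_eq_add]; module⟩

/-! ### Segments of a tessellation -/

/-- The condition on sides of cells comes for free: a point inside the segment belongs to some edge,
which is aligned with the segment and must have the same ends. -/
theorem isEdge_of_disjoint {x y : Plane} (hx : x ∈ T.vertices) (hy : y ∈ T.vertices) (hxy : x ≠ y)
    (hK : segment ℝ x y ⊆ T.skeleton) (hd : Disjoint (openSegment ℝ x y) T.vertices) :
    T.IsEdge (segment ℝ x y) := by
  obtain ⟨p, hp⟩ := oseg_nonempty x y
  have hpV := disjoint_left.1 hd hp
  obtain ⟨e, he, hpe⟩ := hK (openSegment_subset_segment ℝ _ _ hp)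
  have hcol := collinear_of_edges hxy hK hp he hpe hpV
  obtain ⟨α', β', k1, k2, k3, k4, k5, k6⟩ :=
    he.exists_param hpe hpV (sub_ne_zero.2 hxy.symm) hcol
  obtain ⟨σ, h0, h1, hσ⟩ := mem_oseg.1 hp
  set d := y - x with hdef
  have ex : x = p + (-σ) • d := by rw [hσ]; module
  have ey : y = p + (1 - σ) • d := by rw [hσ, hdef]; module
  rw [ex, ey] at hd
  have e1 : α' = -σ := by
    rcases lt_trichotomy α' (-σ) with h | h | h
    · exact absurd (ex ▸ hx) (disjoint_left.1 k6 (add_smul_mem_oseg h (by linarith)))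
    · exact h
    · exact absurd k3 (disjoint_left.1 hd (add_smul_mem_oseg h (by linarith)))
  have e2 : β' = 1 - σ := by
    rcases lt_trichotomy β' (1 - σ) with h | h | h
    · exact absurd k4 (disjoint_left.1 hd (add_smul_mem_oseg (by linarith) h))
    · exact h
    · exact absurd (ey ▸ hy) (disjoint_left.1 k6 (add_smul_mem_oseg (by linarith) h))
  rw [e1, e2, ← ex, ← ey] at k5
  rwa [← k5]

/-- An end of a run which is not a vertex would be inside one of the edges of the run, and this edge
would stick out. Conversely, the vertices on the segment cut it into edges. -/
theorem isEdgeRun_iff {s : Set Plane} : T.IsEdgeRun s ↔ ∃ x y, x ≠ y ∧ x ∈ T.vertices ∧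
    y ∈ T.vertices ∧ s = segment ℝ x y ∧ s ⊆ T.skeleton := by
  constructor
  · rintro ⟨⟨x, y, hxy, rfl⟩, E, hE, hs⟩
    have key : ∀ {a b : Plane}, a ≠ b → segment ℝ a b = ⋃₀ E → a ∈ T.vertices := by
      intro a b hab hs
      obtain ⟨e, he, hae⟩ : a ∈ ⋃₀ E := hs ▸ left_mem_segment ℝ a b
      by_contra haV
      obtain ⟨x', -, y', -, hxy', rfl, hao, -⟩ := IsEdge.exists_oseg (hE he) hae haV
      have hsub : segment ℝ x' y' ⊆ segment ℝ a b := hs ▸ subset_sUnion_of_mem he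
      have hd : b - a ≠ 0 := sub_ne_zero.2 hab.symm
      obtain ⟨s, s0, -, hs'⟩ := mem_seg.1 (hsub (left_mem_segment ℝ _ _))
      obtain ⟨t, t0, -, ht'⟩ := mem_seg.1 (hsub (right_mem_segment ℝ _ _))
      obtain ⟨σ, h0, h1, hσ⟩ := mem_oseg.1 hao
      have h2 : (s + σ * (t - s)) • (b - a) = 0 := by
        have : a = a + (s + σ * (t - s)) • (b - a) := by
          refine hσ.trans ?_
          rw [hs', ht']; module
        simpa using this.symm
      have h3 := (smul_eq_zero.1 h2).resolve_right hd
      have h4 : s = 0 := by nlinarith [mul_nonneg h0.le t0, mul_nonneg (sub_nonneg.2 h1.le) s0]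
      have h5 : t = 0 := by
        rw [h4] at h3; simp only [zero_add, sub_zero] at h3
        exact (mul_eq_zero.1 h3).resolve_left h0.ne'
      exact hxy' (by rw [hs', ht', h4, h5])
    refine ⟨x, y, hxy, key hxy hs, key hxy.symm (by rw [segment_symm, hs]), rfl, ?_⟩
    rw [hs]; exact sUnion_subset fun e he => IsEdge.subset_skeleton (hE he)
  · rintro ⟨x, y, hxy, hx, hy, rfl, hK⟩
    refine ⟨⟨x, y, hxy, rfl⟩, {e | T.IsEdge e ∧ e ⊆ segment ℝ x y}, fun e he => he.1, ?_⟩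
    refine subset_antisymm (fun p hp => ?_) (sUnion_subset fun e he => he.2)
    obtain ⟨x', hx', y', hy', hne, hxs, hys, hp', hd⟩ := T.exists_piece hx hy hxy hp
    have hsub := (convex_segment x y).segment_subset hxs hys
    exact ⟨_, ⟨isEdge_of_disjoint hx' hy' hne (hsub.trans hK) hd, hsub⟩, hp'⟩

/-- If `x` is no vertex, it is inside an edge, necessarily aligned with `y - x`; the segment is
prolonged to the end of this edge behind `x`. -/
theorem exists_extension {x y : Plane} (hxy : x ≠ y) (hK : segment ℝ x y ⊆ T.skeleton) :
    ∃ α : ℝ, α ≤ 0 ∧ x + α • (y - x) ∈ T.vertices ∧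
      segment ℝ (x + α • (y - x)) y ⊆ T.skeleton := by
  by_cases hx : x ∈ T.vertices
  · exact ⟨0, le_rfl, by simpa using hx, by simpa using hK⟩
  obtain ⟨e, he, hxe⟩ := hK (left_mem_segment ℝ x y)
  have hd : y - x ≠ 0 := sub_ne_zero.2 hxy.symm
  obtain ⟨a, -, b, -, hab, rfl, ho, -⟩ := he.exists_oseg hxe hx
  have hcol := collinear_of_edges hab he.subset_skeleton ho he hxe hx
  have hflat := exists_flat_of_edge hab he.subset_skeleton ho hx
  have h0 := hflat.cross_eq_zero (u := y - x) ⟨1, one_pos, fun τ h0 h1 =>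
    hK (mem_seg.2 ⟨τ, h0, h1, rfl⟩)⟩
  obtain ⟨κ, hκ⟩ := exists_smul_of_cross_eq_zero (sub_ne_zero.2 hab.symm) h0
  have hcol' : ∀ z ∈ segment ℝ a b, cross (y - x) (z - x) = 0 := fun z hz => by
    rw [hκ, cross_smul_left, hcol z hz, mul_zero]
  obtain ⟨α, β, h1, h2, h3, h4, h5, h6⟩ := he.exists_param hxe hx hd hcol'
  refine ⟨α, h1.le, h3, ?_⟩
  have ey : y = x + (1 : ℝ) • (y - x) := by module
  have ex : x = x + (0 : ℝ) • (y - x) := by module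
  have hu := seg_subset_union (p := x) (d := y - x) h1.le zero_le_one
  rw [← ey, ← ex] at hu
  refine hu.trans (union_subset ?_ hK)
  refine Subset.trans ?_ he.subset_skeleton
  rw [h5]
  refine (convex_segment _ _).segment_subset (left_mem_segment ℝ _ _) ?_
  have := add_smul_mem_seg (p := x) (d := y - x) h1.le h2.le
  rwa [← ex] at this

theorem exists_isEdgeRun {x y : Plane} (hxy : x ≠ y) (hK : segment ℝ x y ⊆ T.skeleton) :
    ∃ s, T.IsEdgeRun s ∧ segment ℝ x y ⊆ s := by
  obtain ⟨α, hα, hxV, h1⟩ := exists_extension hxy hK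
  set x' := x + α • (y - x) with hx'
  have hd : y - x ≠ 0 := sub_ne_zero.2 hxy.symm
  have hne : y ≠ x' := by
    intro h
    have : (1 - α) • (y - x) = 0 := by
      rw [show (1 - α) • (y - x) = y - x' by rw [hx']; module, ← h, sub_self]
    rcases smul_eq_zero.1 this with h | h
    · linarith
    · exact hd h
  obtain ⟨β, hβ, hyV, h2⟩ := exists_extension hne (by rwa [segment_symm])
  have e1 : y + β • (x' - y) = x + (1 - β * (1 - α)) • (y - x) := by rw [hx']; module
  have hle : 1 ≤ 1 - β * (1 - α) := by nlinarith
  have ey : y = x + (1 : ℝ) • (y - x) := by module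
  have ex : x = x + (0 : ℝ) • (y - x) := by module
  refine ⟨_, isEdgeRun_iff.2 ⟨_, _, ?_, hyV, hxV, rfl, h2⟩, ?_⟩
  · intro h
    rw [e1, hx'] at h
    have : (1 - β * (1 - α) - α) • (y - x) = 0 := by
      rw [sub_smul, sub_eq_zero]; simpa using h
    rcases smul_eq_zero.1 this with h | h
    · linarith
    · exact hd h
  · rw [segment_symm ℝ (y + _), e1, hx']
    refine (convex_segment _ _).segment_subset ?_ ?_
    · have := add_smul_mem_seg (p := x) (d := y - x) hα (by linarith : (0 : ℝ) ≤ 1 - β * (1 - α))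
      rwa [← ex] at this
    · have := add_smul_mem_seg (p := x) (d := y - x) (by linarith : α ≤ 1) hle
      rwa [← ey] at this

/-- Expresses segments by the skeleton alone, so that segments of two tessellations with related
skeletons can be compared. -/
theorem isSegment_iff {s : Set Plane} : T.IsSegment s ↔ (∃ x y, x ≠ y ∧ s = segment ℝ x y) ∧
    s ⊆ T.skeleton ∧ ∀ x y, s ⊆ segment ℝ x y → segment ℝ x y ⊆ T.skeleton →
      segment ℝ x y ⊆ s := by
  constructor
  · rintro ⟨hr, hmax⟩
    obtain ⟨x, y, hxy, hx, hy, hs, hK⟩ := isEdgeRun_iff.1 hr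
    refine ⟨⟨x, y, hxy, hs⟩, hK, fun a b hab habK => ?_⟩
    have hne : a ≠ b := by
      rintro rfl
      rw [segment_same, hs] at hab
      exact hxy ((hab (left_mem_segment ℝ _ _)).trans (hab (right_mem_segment ℝ _ _)).symm)
    obtain ⟨r, hr', hsub⟩ := exists_isEdgeRun hne habK
    exact hsub.trans (hmax hr' (hab.trans hsub))
  · rintro ⟨⟨x, y, hxy, rfl⟩, hK, hmax⟩
    obtain ⟨r, hr, hsub⟩ := exists_isEdgeRun hxy hK
    obtain ⟨a, b, hab, -, -, rfl, habK⟩ := isEdgeRun_iff.1 hr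
    have : segment ℝ x y = segment ℝ a b := hsub.antisymm (hmax a b hsub habK)
    rw [this]
    refine ⟨hr, fun r' hr' hle => ?_⟩
    obtain ⟨a', b', -, -, -, rfl, habK'⟩ := isEdgeRun_iff.1 hr'
    exact this ▸ hmax a' b' (hsub.trans hle) habK'

theorem exists_isSegment {x y : Plane} (hxy : x ≠ y) (hK : segment ℝ x y ⊆ T.skeleton) :
    ∃ s, T.IsSegment s ∧ segment ℝ x y ⊆ s := by
  obtain ⟨r, hr, hsub⟩ := exists_isEdgeRun hxy hK
  have hfin : {s | T.IsEdgeRun s}.Finite := by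
    refine ((T.finite_vertices.prod T.finite_vertices).image
      fun q => segment ℝ q.1 q.2).subset ?_
    intro s hs
    obtain ⟨x, y, -, hx, hy, rfl, -⟩ := isEdgeRun_iff.1 hs
    exact ⟨(x, y), ⟨hx, hy⟩, rfl⟩
  obtain ⟨m, hm, hmax⟩ := hfin.exists_le_maximal hr
  exact ⟨m, hmax, hsub.trans hm⟩

theorem IsSegment.exists_endpoints {s : Set Plane} (hs : T.IsSegment s) : ∃ x y, x ≠ y ∧
    x ∈ T.vertices ∧ y ∈ T.vertices ∧ s = segment ℝ x y ∧ s ⊆ T.skeleton :=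
  isEdgeRun_iff.1 hs.1

theorem IsSegment.endpoints {x y : Plane} (hs : T.IsSegment (segment ℝ x y)) :
    x ≠ y ∧ x ∈ T.vertices ∧ y ∈ T.vertices ∧ segment ℝ x y ⊆ T.skeleton := by
  obtain ⟨a, b, hab, ha, hb, h, hK⟩ := hs.exists_endpoints
  rcases segment_eq_segment h with ⟨rfl, rfl⟩ | ⟨rfl, rfl⟩
  · exact ⟨hab, ha, hb, hK⟩
  · exact ⟨hab.symm, hb, ha, hK⟩

/-- Aligned segments are equal if and only if the skeleton is convex along each line. -/
theorem eq_of_collinear_of_alignedConvex (h : AlignedConvex T.skeleton) (s s' : Set Plane)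
    (hs : T.IsSegment s) (hs' : T.IsSegment s') (hcol : Collinear ℝ (s ∪ s')) : s = s' := by
  obtain ⟨x, y, hxy, -, -, rfl, hK⟩ := hs.exists_endpoints
  obtain ⟨x', y', hxy', -, -, rfl, hK'⟩ := hs'.exists_endpoints
  have hd : y - x ≠ 0 := sub_ne_zero.2 hxy.symm
  have hpar : ∀ z ∈ segment ℝ x y ∪ segment ℝ x' y', ∃ τ : ℝ, z = x + τ • (y - x) := by
    rw [collinear_iff_of_mem (p₀ := x) (Or.inl (left_mem_segment ℝ _ _))] at hcol
    obtain ⟨w, hw⟩ := hcol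
    obtain ⟨b, hb⟩ := hw y (Or.inl (right_mem_segment ℝ _ _))
    rw [vadd_eq_add] at hb
    have hb0 : b ≠ 0 := by rintro rfl; simp at hb; exact hxy hb.symm
    intro z hz
    obtain ⟨a, ha⟩ := hw z hz
    rw [vadd_eq_add] at ha
    refine ⟨a / b, ?_⟩
    rw [ha, hb, add_sub_cancel_right, smul_smul, div_mul_cancel₀ _ hb0]; abel
  have hcore : ∀ z ∈ segment ℝ x y ∪ segment ℝ x' y', z ∈ core T.skeleton (y - x) := by
    rintro z (hz | hz)
    · exact mem_core_of_segment hK hz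
    · have := mem_core_of_segment hK' hz
      obtain ⟨a, ha⟩ := hpar x' (Or.inr (left_mem_segment ℝ _ _))
      obtain ⟨b, hb⟩ := hpar y' (Or.inr (right_mem_segment ℝ _ _))
      have e : y' - x' = (b - a) • (y - x) := by rw [ha, hb]; module
      rw [e, core_smul] at this
      · exact this
      · rintro h0
        rw [h0, zero_smul, sub_eq_zero] at e
        exact hxy' e.symm
  have hseg : ∀ z ∈ segment ℝ x y ∪ segment ℝ x' y', ∀ w ∈ segment ℝ x y ∪ segment ℝ x' y',
      segment ℝ z w ⊆ T.skeleton := fun z hz w hw => by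
    refine h _ hd z (hcore z hz) w (hcore w hw) ?_
    obtain ⟨a, rfl⟩ := hpar z hz
    obtain ⟨b, rfl⟩ := hpar w hw
    rw [show x + b • (y - x) - (x + a • (y - x)) = (b - a) • (y - x) by module, cross_smul_right,
      cross_self, mul_zero]
  -- the hull of both segments
  obtain ⟨a, ha⟩ := hpar x' (Or.inr (left_mem_segment ℝ _ _))
  obtain ⟨b, hb⟩ := hpar y' (Or.inr (right_mem_segment ℝ _ _))
  have e0 : x = x + (0 : ℝ) • (y - x) := by module
  have e1 : y = x + (1 : ℝ) • (y - x) := by module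
  have hpt : ∀ τ : ℝ, (τ = 0 ∨ τ = 1 ∨ τ = a ∨ τ = b) →
      x + τ • (y - x) ∈ segment ℝ x y ∪ segment ℝ x' y' := by
    rintro τ (rfl | rfl | rfl | rfl)
    · rw [← e0]; exact Or.inl (left_mem_segment ℝ _ _)
    · rw [← e1]; exact Or.inl (right_mem_segment ℝ _ _)
    · rw [← ha]; exact Or.inr (left_mem_segment ℝ _ _)
    · rw [← hb]; exact Or.inr (right_mem_segment ℝ _ _)
  obtain ⟨m, hm, hm'⟩ : ∃ m : ℝ, (m = 0 ∨ m = 1 ∨ m = a ∨ m = b) ∧ m ≤ 0 ∧ m ≤ 1 ∧ m ≤ a ∧ m ≤ b := by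
    obtain ⟨m, hm, h⟩ := Finset.exists_min_image ({0, 1, a, b} : Finset ℝ) id ⟨0, by simp⟩
    exact ⟨m, by simpa using hm, by simpa using h⟩
  obtain ⟨M, hM, hM'⟩ : ∃ m : ℝ, (m = 0 ∨ m = 1 ∨ m = a ∨ m = b) ∧ 0 ≤ m ∧ 1 ≤ m ∧ a ≤ m ∧ b ≤ m := by
    obtain ⟨m, hm, h⟩ := Finset.exists_max_image ({0, 1, a, b} : Finset ℝ) id ⟨0, by simp⟩
    exact ⟨m, by simpa using hm, by simpa using h⟩
  have hmM := hseg _ (hpt m hm) _ (hpt M hM)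
  have hin : ∀ τ : ℝ, m ≤ τ → τ ≤ M →
      x + τ • (y - x) ∈ segment ℝ (x + m • (y - x)) (x + M • (y - x)) :=
    fun τ h1 h2 => add_smul_mem_seg h1 h2
  have s1 : segment ℝ x y ⊆ segment ℝ (x + m • (y - x)) (x + M • (y - x)) := by
    refine (convex_segment _ _).segment_subset ?_ ?_
    · have := hin 0 hm'.1 hM'.1; rwa [← e0] at this
    · have := hin 1 hm'.2.1 hM'.2.1; rwa [← e1] at this
  have s2 : segment ℝ x' y' ⊆ segment ℝ (x + m • (y - x)) (x + M • (y - x)) := by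
    refine (convex_segment _ _).segment_subset ?_ ?_
    · have := hin a hm'.2.2.1 hM'.2.2.1; rwa [← ha] at this
    · have := hin b hm'.2.2.2 hM'.2.2.2; rwa [← hb] at this
  rw [s1.antisymm ((isSegment_iff.1 hs).2.2 _ _ s1 hmM),
    ← s2.antisymm ((isSegment_iff.1 hs').2.2 _ _ s2 hmM)]

end Tessellation

/-! ### T-tessellations characterised by their skeletons -/

variable {D : Set Plane}

/-- Converse of `eq_of_collinear_of_alignedConvex`. Both pieces extend to segments of `T` on the
same line, hence to the same segment, which is convex. -/
theorem TTessellation.alignedConvex (T : TTessellation D) : AlignedConvex T.skeleton := by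
  rintro d hd p ⟨τ, hτ, hs⟩ p' ⟨τ', hτ', hs'⟩ hc
  have hne : ∀ (q : Plane) (σ : ℝ), σ ≠ 0 → q ≠ q + σ • d := fun q σ hσ h => by
    have : σ • d = 0 := by simpa using h.symm
    rcases smul_eq_zero.1 this with h | h
    · exact hσ h
    · exact hd h
  obtain ⟨s, hS, hsub⟩ := Tessellation.exists_isSegment (hne p τ hτ) hs
  obtain ⟨s', hS', hsub'⟩ := Tessellation.exists_isSegment (hne p' τ' hτ') hs'
  have hline : ∀ (q : Plane) (σ : ℝ) (S : Set Plane), σ ≠ 0 → T.IsSegment S →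
      segment ℝ q (q + σ • d) ⊆ S → ∀ z ∈ S, ∃ a : ℝ, z = q + a • d := by
    intro q σ S hσ hS hsub z hz
    obtain ⟨x, y, hxy, -, -, rfl, -⟩ := hS.exists_endpoints
    obtain ⟨a, -, -, ha⟩ := mem_seg.1 (hsub (left_mem_segment ℝ _ _))
    obtain ⟨b, -, -, hb⟩ := mem_seg.1 (hsub (right_mem_segment ℝ _ _))
    obtain ⟨c, -, -, hz'⟩ := mem_seg.1 hz
    have e : σ • d = (b - a) • (y - x) := by
      calc σ • d = (q + σ • d) - q := by abel
        _ = (x + b • (y - x)) - (x + a • (y - x)) := by rw [← ha, hb]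
        _ = (b - a) • (y - x) := by module
    have hba : b - a ≠ 0 := by
      intro h0
      rw [h0, zero_smul] at e
      rcases smul_eq_zero.1 e with h | h
      · exact hσ h
      · exact hd h
    have e' : y - x = (σ / (b - a)) • d := by
      rw [div_eq_inv_mul, mul_smul, e, smul_smul, inv_mul_cancel₀ hba, one_smul]
    refine ⟨(c - a) * (σ / (b - a)), ?_⟩
    rw [mul_smul, ← e', hz']
    calc x + c • (y - x) = (x + a • (y - x)) + (c - a) • (y - x) := by module
      _ = q + (c - a) • (y - x) := by rw [← ha]
  obtain ⟨k, hk⟩ := exists_smul_of_cross_eq_zero hd hc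
  have hp' : p' = p + k • d := by rw [← hk]; abel
  have := T.eq_of_collinear s s' hS hS' (by
    rw [collinear_iff_of_mem (p₀ := p) (Or.inl (hsub (left_mem_segment ℝ _ _)))]
    refine ⟨d, ?_⟩
    rintro z (hz | hz)
    · obtain ⟨a, rfl⟩ := hline p τ s hτ hS hsub z hz
      exact ⟨a, by rw [vadd_eq_add]; abel⟩
    · obtain ⟨a, rfl⟩ := hline p' τ' s' hτ' hS' hsub' z hz
      exact ⟨k + a, by rw [vadd_eq_add, hp']; module⟩)
  subst this
  obtain ⟨x, y, hxy, -, -, rfl, hK⟩ := hS.exists_endpoints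
  exact ((convex_segment x y).segment_subset (hsub (left_mem_segment ℝ _ _))
    (hsub' (left_mem_segment ℝ _ _))).trans hK

/-- The points of the skeleton of a T-tessellation. -/
theorem TTessellation.isFlatAt_or_isTeeAt (T : TTessellation D) {p : Plane} (hp : p ∈ T.skeleton)
    (hD : p ∉ D.extremePoints ℝ) :
    (∃ d, IsFlatAt T.skeleton p d) ∨ ∃ d e, IsTeeAt T.skeleton p d e := by
  by_cases hV : p ∈ T.vertices
  · exact Or.inr (Tessellation.isTeeAt_of_isTVertex hV (T.isTVertex p hV hD))
  · exact Or.inl (Tessellation.exists_isFlatAt hp hV)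

/-- A tessellation whose skeleton looks locally like that of a T-tessellation. -/
def TTessellation.ofSkeleton (hD : IsConvexPolygon D) (T : Tessellation D)
    (hloc : ∀ p ∈ T.skeleton, p ∉ D.extremePoints ℝ →
      (∃ d, IsFlatAt T.skeleton p d) ∨ ∃ d e, IsTeeAt T.skeleton p d e)
    (hal : AlignedConvex T.skeleton) : TTessellation D where
  toTessellation := T
  isTVertex := by
    intro v hv hvD
    rcases hloc v (T.vertices_subset_skeleton hv) hvD with ⟨d, h⟩ | ⟨d, e, h⟩
    · exact absurd hv (Tessellation.not_mem_vertices_of_isFlatAt hD h)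
    · exact Tessellation.isTVertex_of_isTeeAt hv h
  eq_of_collinear := Tessellation.eq_of_collinear_of_alignedConvex hal

theorem TTessellation.eq_of_skeleton_eq {T T' : TTessellation D} (h : T.skeleton = T'.skeleton) :
    T = T' := by
  have := Tessellation.eq_of_skeleton_eq h
  cases T; cases T'; simp_all

end TTess

namespace TTess

/-! ### Gluing convex sets along a common segment -/

theorem cross_sub_base {f v b : Plane} (h : cross f (b - v) = 0) (z : Plane) :
    cross f (z - b) = cross f (z - v) := by
  rw [show z - b = (z - v) - (b - v) by abel, cross_sub_right, h, sub_zero]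

theorem exists_line_param {d v b z : Plane} (hd : d ≠ 0) (hvb : v ≠ b) (hdb : cross d (b - v) = 0)
    (hz : cross d (z - v) = 0) : ∃ τ : ℝ, z = v + τ • (b - v) := by
  obtain ⟨κ, hκ⟩ := exists_smul_of_cross_eq_zero hd hdb
  obtain ⟨τ, hτ⟩ := exists_smul_of_cross_eq_zero hd hz
  have hκ0 : κ ≠ 0 := by
    rintro rfl
    rw [zero_smul, sub_eq_zero] at hκ
    exact hvb hκ.symm
  refine ⟨τ / κ, ?_⟩
  rw [hκ, smul_smul, div_mul_cancel₀ _ hκ0, ← hτ]; abel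

/-- A position on a line between two transversal half-planes. -/
theorem mem_seg_of_halfplanes {d v b gv gb z : Plane} (hd : d ≠ 0) (hdb : cross d (b - v) = 0)
    (hgv : 0 < cross gv (b - v)) (hgb : 0 < cross gb (v - b)) (hz : cross d (z - v) = 0)
    (h1 : 0 ≤ cross gv (z - v)) (h2 : 0 ≤ cross gb (z - b)) : z ∈ segment ℝ v b := by
  have hvb : v ≠ b := by rintro rfl; simp [cross_zero_right] at hgv
  obtain ⟨τ, rfl⟩ := exists_line_param hd hvb hdb hz
  rw [add_sub_cancel_left, cross_smul_right] at h1
  rw [show v + τ • (b - v) - b = (1 - τ) • (v - b) by module, cross_smul_right] at h2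
  have := nonneg_of_mul_nonneg_left h1 hgv
  have := nonneg_of_mul_nonneg_left h2 hgb
  exact mem_seg.2 ⟨τ, by linarith, by linarith, rfl⟩

theorem mem_oseg_of_halfplanes {d v b gv gb z : Plane} (hd : d ≠ 0) (hdb : cross d (b - v) = 0)
    (hgv : 0 < cross gv (b - v)) (hgb : 0 < cross gb (v - b)) (hz : cross d (z - v) = 0)
    (h1 : 0 < cross gv (z - v)) (h2 : 0 < cross gb (z - b)) : z ∈ openSegment ℝ v b := by
  rcases mem_seg_iff_oseg.1 (mem_seg_of_halfplanes hd hdb hgv hgb hz h1.le h2.le) with rfl | rfl | h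
  · simp [cross_zero_right] at h1
  · simp [cross_zero_right] at h2
  · exact h

theorem segment_subset_union_of_mem {x y z : Plane} (hz : z ∈ segment ℝ x y) :
    segment ℝ x y ⊆ segment ℝ x z ∪ segment ℝ z y := by
  obtain ⟨τ, h0, h1, rfl⟩ := mem_seg.1 hz
  have := seg_subset_union (p := x) (d := y - x) h0 h1
  rwa [show x + (0 : ℝ) • (y - x) = x by module, show x + (1 : ℝ) • (y - x) = y by module] at this

/-- Two convex sets on both sides of a line, which are adjacent along a segment and do not extend
beyond transversal lines through its ends, have a convex union. -/
theorem convex_union_of_adjacent {A B : Set Plane} {d v b gv gb : Plane} (hA : Convex ℝ A)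
    (hB : Convex ℝ B) (hd : d ≠ 0) (hdb : cross d (b - v) = 0)
    (hgv : 0 < cross gv (b - v)) (hgb : 0 < cross gb (v - b))
    (hsA : segment ℝ v b ⊆ A) (hsB : segment ℝ v b ⊆ B)
    (hAd : A ⊆ leftOf d v) (hBd : B ⊆ leftOf (-d) v) (hv : A ∪ B ⊆ leftOf gv v)
    (hb : A ∪ B ⊆ leftOf gb b) : Convex ℝ (A ∪ B) := by
  have key : ∀ x ∈ A, ∀ y ∈ B, segment ℝ x y ⊆ A ∪ B := by
    intro x hx y hy
    have h1 : 0 ≤ cross d (x - v) := hAd hx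
    have h2 : 0 ≤ cross (-d) (y - v) := hBd hy
    -- If `x` is on the line, the transversal half-planes put it on `[v, b]`, hence in `B`.
    -- Otherwise `[x, y]` crosses the line at the point `z` below, which is on `[v, b]` for the same
    -- reason.
    rcases h1.eq_or_lt with h0 | h0
    · have := mem_seg_of_halfplanes hd hdb hgv hgb h0.symm (hv (Or.inl hx)) (hb (Or.inl hx))
      exact (hB.segment_subset (hsB this) hy).trans subset_union_right
    set α := cross d (x - v) with hα
    set β := cross (-d) (y - v) with hβ
    have hs : 0 < α + β := by linarith
    have hsum : β / (α + β) + α / (α + β) = 1 := by field_simp; ring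
    set z := x + (α / (α + β)) • (y - x) with hz
    have hzs : z ∈ segment ℝ x y := mem_seg.2 ⟨_, by positivity, by
      rw [div_le_one hs]; linarith, hz⟩
    have hzd : cross d (z - v) = 0 := by
      have e : cross d (y - v) = -β := by rw [hβ, cross_neg_left]; ring
      rw [show z - v = (1 - α / (α + β)) • (x - v) + (α / (α + β)) • (y - v) by rw [hz]; module,
        cross_add_right, cross_smul_right, cross_smul_right, e, ← hα]
      field_simp; ring
    have hzm := mem_seg_of_halfplanes hd hdb hgv hgb hzd
      ((convex_leftOf gv v).segment_subset (hv (Or.inl hx)) (hv (Or.inr hy)) hzs)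
      ((convex_leftOf gb b).segment_subset (hb (Or.inl hx)) (hb (Or.inr hy)) hzs)
    exact (segment_subset_union_of_mem hzs).trans
      (union_subset_union (hA.segment_subset hx (hsA hzm)) (hB.segment_subset (hsB hzm) hy))
  rw [convex_iff_segment_subset]
  rintro x (hx | hx) y (hy | hy)
  · exact (hA.segment_subset hx hy).trans subset_union_left
  · exact key x hx y hy
  · rw [segment_symm]; exact key y hy x hx
  · exact (hB.segment_subset hx hy).trans subset_union_right

namespace Tessellation

variable {D : Set Plane} (T : Tessellation D)

/-! ### Operations on cells -/

theorem exists_splitCell {c : Set Plane} (hc : c ∈ T.cells) {f p : Plane} (hf : f ≠ 0)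
    (hpos : ∃ z ∈ interior c, 0 < cross f (z - p))
    (hneg : ∃ z ∈ interior c, 0 < cross (-f) (z - p)) :
    ∃ T' : Tessellation D, T'.cells = T.cells \ {c} ∪ {c ∩ leftOf f p, c ∩ leftOf (-f) p} ∧
      T'.skeleton = T.skeleton ∪ (c ∩ {z | cross f (z - p) = 0}) := by
  have hP := T.isConvexPolygon c hc
  have hf' : -f ≠ 0 := neg_ne_zero.2 hf
  have i1 := IsConvexPolygon.interior_inter_leftOf (c := c) (p := p) hf
  have i2 := IsConvexPolygon.interior_inter_leftOf (c := c) (p := p) hf'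
  have hcov : c ∩ leftOf f p ∪ c ∩ leftOf (-f) p = c := by
    rw [← inter_union_distrib_left, inter_eq_left]
    intro z _
    rcases le_total 0 (cross f (z - p)) with h | h
    · exact Or.inl h
    · exact Or.inr (by change 0 ≤ cross (-f) (z - p); rw [cross_neg_left]; linarith)
  have hd12 : Disjoint (interior (c ∩ leftOf f p)) (interior (c ∩ leftOf (-f) p)) := by
    rw [i1, i2]
    refine disjoint_left.2 fun z hz hz' => ?_
    have h1 : 0 < cross f (z - p) := hz.2
    have h2 : 0 < cross (-f) (z - p) := hz'.2
    rw [cross_neg_left] at h2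
    linarith
  have hdo : ∀ c' ∈ T.cells \ {c}, ∀ H : Set Plane, Disjoint (interior c') (interior (c ∩ H)) :=
    fun c' hc' H => (T.disjoint_interior c' hc'.1 c hc hc'.2).mono_right
      (interior_mono inter_subset_left)
  let T' : Tessellation D :=
    { cells := T.cells \ {c} ∪ {c ∩ leftOf f p, c ∩ leftOf (-f) p}
      finite_cells := (T.finite_cells.subset sdiff_subset).union (by simp)
      isConvexPolygon := by
        rintro c' (h | rfl | rfl)
        · exact T.isConvexPolygon c' h.1
        · exact hP.inter_leftOf hf hpos
        · exact hP.inter_leftOf hf' hneg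
      sUnion_cells := by
        rw [sUnion_union, sUnion_pair, hcov]
        nth_rewrite 2 [← T.sUnion_cells]
        nth_rewrite 2 [← sUnion_singleton c]
        rw [← sUnion_union, sdiff_union_of_subset (singleton_subset_iff.2 hc)]
      disjoint_interior := by
        rintro c₁ (h₁ | rfl | rfl) c₂ (h₂ | rfl | rfl) hne
        · exact T.disjoint_interior c₁ h₁.1 c₂ h₂.1 hne
        · exact hdo c₁ h₁ _
        · exact hdo c₁ h₁ _
        · exact (hdo c₂ h₂ _).symm
        · exact absurd rfl hne
        · exact hd12
        · exact (hdo c₂ h₂ _).symm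
        · exact hd12.symm
        · exact absurd rfl hne }
  refine ⟨T', rfl, ?_⟩
  ext z
  rw [mem_union, mem_skeleton_iff, mem_skeleton_iff]
  constructor
  · rintro ⟨hzD, hz⟩
    by_cases hzc : z ∈ interior c
    · right
      refine ⟨interior_subset hzc, ?_⟩
      have h1 := hz _ (Or.inr (Or.inl rfl))
      have h2 := hz _ (Or.inr (Or.inr rfl))
      rw [i1] at h1
      rw [i2] at h2
      have h1' : ¬ 0 < cross f (z - p) := fun h => h1 ⟨hzc, h⟩
      have h2' : ¬ 0 < cross (-f) (z - p) := fun h => h2 ⟨hzc, h⟩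
      rw [cross_neg_left] at h2'
      change cross f (z - p) = 0
      linarith
    · left
      refine ⟨hzD, fun c' hc' => ?_⟩
      by_cases h : c' = c
      · rwa [h]
      · exact hz c' (Or.inl ⟨hc', h⟩)
  · rintro (⟨hzD, hz⟩ | ⟨hzc, hz⟩)
    · refine ⟨hzD, ?_⟩
      rintro c' (h | rfl | rfl)
      · exact hz c' h.1
      · exact fun h => hz c hc (interior_mono inter_subset_left h)
      · exact fun h => hz c hc (interior_mono inter_subset_left h)
    · refine ⟨T.cell_subset hc hzc, ?_⟩
      have hz0 : cross f (z - p) = 0 := hz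
      rintro c' (h | rfl | rfl)
      · intro hi
        have : z ∈ closure (interior c) := by rwa [hP.closure_interior]
        obtain ⟨w, hw, hw'⟩ := mem_closure_iff.1 this _ isOpen_interior hi
        exact disjoint_left.1 (T.disjoint_interior c' h.1 c hc h.2) hw hw'
      · rw [i1]
        rintro ⟨-, h⟩
        have h : 0 < cross f (z - p) := h
        linarith
      · rw [i2]
        rintro ⟨-, h⟩
        have h : 0 < cross (-f) (z - p) := h
        rw [cross_neg_left] at h
        linarith

/-- The half-planes make the union of the two cells convex. They also confine the skeleton inside
the union to the open segment, so that exactly this open segment is lost. -/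
theorem exists_mergeCells {A B : Set Plane} (hA : A ∈ T.cells) (hB : B ∈ T.cells) (hAB : A ≠ B)
    {d v b gv gb : Plane} (hd : d ≠ 0) (hdb : cross d (b - v) = 0)
    (hgv : 0 < cross gv (b - v)) (hgb : 0 < cross gb (v - b))
    (hsA : segment ℝ v b ⊆ A) (hsB : segment ℝ v b ⊆ B)
    (hAd : A ⊆ leftOf d v) (hBd : B ⊆ leftOf (-d) v) (hv : A ∪ B ⊆ leftOf gv v)
    (hb : A ∪ B ⊆ leftOf gb b) :
    ∃ T' : Tessellation D, T'.skeleton = T.skeleton \ openSegment ℝ v b := by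
  have hPA := T.isConvexPolygon A hA
  have hPB := T.isConvexPolygon B hB
  have hvb : v ≠ b := by rintro rfl; simp [cross_zero_right] at hgv
  have hP : IsConvexPolygon (A ∪ B) := hPA.union hPB
    (convex_union_of_adjacent hPA.convex hPB.convex hd hdb hgv hgb hsA hsB hAd hBd hv hb)
  have hdis : ∀ c ∈ T.cells, c ≠ A → c ≠ B → Disjoint (interior c) (interior (A ∪ B)) := by
    intro c hc hcA hcB
    refine disjoint_left.2 fun z hz hz' => ?_
    rcases interior_subset hz' with h | h
    · rw [← hPA.closure_interior] at h
      obtain ⟨w, hw, hw'⟩ := mem_closure_iff.1 h _ isOpen_interior hz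
      exact disjoint_left.1 (T.disjoint_interior c hc A hA hcA) hw hw'
    · rw [← hPB.closure_interior] at h
      obtain ⟨w, hw, hw'⟩ := mem_closure_iff.1 h _ isOpen_interior hz
      exact disjoint_left.1 (T.disjoint_interior c hc B hB hcB) hw hw'
  let T' : Tessellation D :=
    { cells := T.cells \ {A, B} ∪ {A ∪ B}
      finite_cells := (T.finite_cells.subset sdiff_subset).union (by simp)
      isConvexPolygon := by
        rintro c (h | rfl)
        · exact T.isConvexPolygon c h.1
        · exact hP
      sUnion_cells := by
        rw [sUnion_union, sUnion_singleton]
        nth_rewrite 2 [← T.sUnion_cells]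
        rw [← sUnion_pair A B, ← sUnion_union, sdiff_union_of_subset]
        rintro c (rfl | rfl) <;> assumption
      disjoint_interior := by
        have h2 : ∀ c ∈ T.cells \ {A, B}, Disjoint (interior c) (interior (A ∪ B)) :=
          fun c hc => hdis c hc.1 (fun h => hc.2 (by simp [h])) (fun h => hc.2 (by simp [h]))
        rintro c₁ (h₁ | rfl) c₂ (h₂ | rfl) hne
        · exact T.disjoint_interior c₁ h₁.1 c₂ h₂.1 hne
        · exact h2 c₁ h₁
        · exact (h2 c₂ h₂).symm
        · exact absurd rfl hne }
  refine ⟨T', ?_⟩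
  -- the part of the skeleton inside the new cell
  have hint : ∀ z ∈ T.skeleton, (z ∈ interior (A ∪ B) ↔ z ∈ openSegment ℝ v b) := by
    intro z hz
    rw [mem_skeleton_iff] at hz
    constructor
    · intro hi
      have h1 : 0 < cross gv (z - v) := by
        have := interior_mono hv hi
        rwa [interior_leftOf (by rintro rfl; simp [cross_zero_left] at hgv)] at this
      have h2 : 0 < cross gb (z - b) := by
        have := interior_mono hb hi
        rwa [interior_leftOf (by rintro rfl; simp [cross_zero_left] at hgb)] at this
      refine mem_oseg_of_halfplanes hd hdb hgv hgb ?_ h1 h2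
      rcases interior_subset hi with h | h
      · have h0 : 0 ≤ cross d (z - v) := hAd h
        -- The part of the interior of the union strictly to the left of the line is an open subset
        -- of `A`, and the interior of `A` avoids the skeleton.
        by_contra hne
        refine hz.2 A hA (interior_maximal (s := A)
          (t := interior (A ∪ B) ∩ {w | 0 < cross d (w - v)}) ?_
          (isOpen_interior.inter (isOpen_cross_pos d v)) ⟨hi, lt_of_le_of_ne h0 (Ne.symm hne)⟩)
        rintro w ⟨hw, hw'⟩
        rcases interior_subset hw with h | h
        · exact h
        · have k : 0 ≤ cross (-d) (w - v) := hBd h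
          have hw' : 0 < cross d (w - v) := hw'
          rw [cross_neg_left] at k; linarith
      · have h0 : 0 ≤ cross (-d) (z - v) := hBd h
        by_contra hne
        have hne' : cross (-d) (z - v) ≠ 0 := by rwa [cross_neg_left, neg_ne_zero]
        refine hz.2 B hB (interior_maximal (s := B)
          (t := interior (A ∪ B) ∩ {w | 0 < cross (-d) (w - v)}) ?_
          (isOpen_interior.inter (isOpen_cross_pos (-d) v)) ⟨hi, lt_of_le_of_ne h0 (Ne.symm hne')⟩)
        rintro w ⟨hw, hw'⟩
        rcases interior_subset hw with h | h
        · have k : 0 ≤ cross d (w - v) := hAd h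
          have hw' : 0 < cross (-d) (w - v) := hw'
          rw [cross_neg_left] at hw'; linarith
        · exact h
    · intro ho
      by_contra hi
      have hfr : z ∈ frontier (A ∪ B) := hP.mem_frontier.2
        ⟨Or.inl (hsA (openSegment_subset_segment ℝ _ _ ho)), hi⟩
      -- A supporting line at a point inside `[v, b]` contains the segment and is therefore its
      -- line; but `A` and `B` lie on opposite sides of that line.
      obtain ⟨f, hf, hpos, hle⟩ := hP.exists_support hfr
      have k1 : 0 ≤ cross f (v - z) := hle (Or.inl (hsA (left_mem_segment ℝ v b)))
      have k2 : 0 ≤ cross f (b - z) := hle (Or.inl (hsA (right_mem_segment ℝ v b)))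
      obtain ⟨τ, h0, h1, hτ⟩ := mem_oseg.1 ho
      rw [show v - z = (-τ) • (b - v) by rw [hτ]; module, cross_smul_right] at k1
      rw [show b - z = (1 - τ) • (b - v) by rw [hτ]; module, cross_smul_right] at k2
      have k3 := nonneg_of_mul_nonneg_right k2 (by linarith)
      have hfb : cross f (b - v) = 0 := by nlinarith
      have hbv : b - v ≠ 0 := sub_ne_zero.2 hvb.symm
      obtain ⟨κ, hκ⟩ := exists_smul_of_cross_eq_zero hbv (u := f)
        (by rw [cross_swap, hfb, neg_zero])
      obtain ⟨μ, hμ⟩ := exists_smul_of_cross_eq_zero hbv (u := d)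
        (by rw [cross_swap, hdb, neg_zero])
      have hzv : ∀ w, cross (b - v) (w - z) = cross (b - v) (w - v) := fun w => by
        rw [hτ, show w - (v + τ • (b - v)) = (w - v) - τ • (b - v) by module, cross_sub_right,
          cross_smul_right, cross_self]; ring
      obtain ⟨o, ho⟩ := hPA.1
      obtain ⟨o', ho'⟩ := hPB.1
      have p1 := hpos o (interior_mono subset_union_left ho)
      have p2 := hpos o' (interior_mono subset_union_right ho')
      have q1 : 0 ≤ cross d (o - v) := hAd (interior_subset ho)
      have q2 : 0 ≤ cross (-d) (o' - v) := hBd (interior_subset ho')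
      rw [hκ, cross_smul_left, hzv] at p1 p2
      rw [hμ, cross_smul_left] at q1
      rw [cross_neg_left, hμ, cross_smul_left] at q2
      have hμ0 : μ ≠ 0 := by rintro rfl; rw [zero_smul] at hμ; exact hd hμ
      rcases lt_or_gt_of_ne hμ0 with hlt | hgt
      · have r1 : cross (b - v) (o - v) ≤ 0 := by nlinarith
        have r2 : 0 ≤ cross (b - v) (o' - v) := by nlinarith
        rcases le_total 0 κ with h | h <;> nlinarith
      · have r1 : 0 ≤ cross (b - v) (o - v) := by nlinarith
        have r2 : cross (b - v) (o' - v) ≤ 0 := by nlinarith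
        rcases le_total 0 κ with h | h <;> nlinarith
  ext z
  rw [Set.mem_sdiff]
  constructor
  · intro hz
    rw [mem_skeleton_iff] at hz
    have hzK : z ∈ T.skeleton := by
      refine T.mem_skeleton_iff.2 ⟨hz.1, fun c hc => ?_⟩
      have hn := hz.2 (A ∪ B) (Or.inr rfl)
      by_cases h1 : c = A
      · subst h1; exact fun h => hn (interior_mono subset_union_left h)
      by_cases h2 : c = B
      · subst h2; exact fun h => hn (interior_mono subset_union_right h)
      · exact hz.2 c (Or.inl ⟨hc, by simp [h1, h2]⟩)
    exact ⟨hzK, fun h => hz.2 (A ∪ B) (Or.inr rfl) ((hint z hzK).2 h)⟩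
  · rintro ⟨hz, hzo⟩
    have hz' := T.mem_skeleton_iff.1 hz
    refine T'.mem_skeleton_iff.2 ⟨hz'.1, ?_⟩
    rintro c (h | rfl)
    · exact hz'.2 c h.1
    · exact fun h => hzo ((hint z hz).1 h)

end Tessellation

/-! ### Ends of internal segments -/

theorem oseg_subset_interior {D : Set Plane} (hD : IsConvexPolygon D) {x y : Plane}
    (hs : segment ℝ x y ⊆ D) (hf : ¬ segment ℝ x y ⊆ frontier D) :
    openSegment ℝ x y ⊆ interior D := by
  obtain ⟨q, hq, hqf⟩ := not_subset.1 hf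
  have hqi : q ∈ interior D := by
    by_contra h
    exact hqf (hD.mem_frontier.2 ⟨hs hq, h⟩)
  intro z hz
  obtain ⟨σ, h0, h1, rfl⟩ := mem_seg.1 hq
  obtain ⟨τ, k0, k1, rfl⟩ := mem_oseg.1 hz
  have ex : x = x + (0 : ℝ) • (y - x) := by module
  have ey : y = x + (1 : ℝ) • (y - x) := by module
  rcases lt_trichotomy τ σ with h | h | h
  · have := add_smul_mem_oseg (p := x) (d := y - x) k0 h
    rw [← ex] at this
    exact hD.convex.openSegment_self_interior_subset_interior (hs (left_mem_segment ℝ _ _)) hqi this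
  · rwa [h]
  · have := add_smul_mem_oseg (p := x) (d := y - x) h k1
    rw [← ey] at this
    exact hD.convex.openSegment_interior_self_subset_interior hqi (hs (right_mem_segment ℝ _ _)) this

theorem left_notMem_oseg {x y : Plane} (h : x ≠ y) : x ∉ openSegment ℝ x y :=
  fun hx => (sub_ne_zero_of_oseg h hx).1 rfl

theorem right_notMem_oseg {x y : Plane} (h : x ≠ y) : y ∉ openSegment ℝ x y :=
  fun hx => (sub_ne_zero_of_oseg h hx).2 rfl

/-- Removing the stem of a T-junction leaves a line. -/
theorem IsTeeAt.flat_of_remove {K : Set Plane} {a b f g : Plane} (h : IsTeeAt K b f g) {κ : ℝ}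
    (hκ : 0 < κ) (hab : a - b = κ • g) : IsFlatAt (K \ openSegment ℝ a b) b f := by
  refine ⟨ne_zero_left_of_cross h.1.ne', ?_⟩
  filter_upwards [h.2, eventually_ray b h.1 hκ] with z h1 h2
  rw [Set.mem_sdiff, h1]
  constructor
  · rintro ⟨h3 | ⟨h3, h4⟩, h5⟩
    · exact h3
    · obtain ⟨τ, k0, k1, rfl⟩ := h2 h3 h4
      rcases k0.eq_or_lt with rfl | k0
      · simp [cross_zero_right]
      · refine absurd (mem_oseg.2 ⟨1 - τ / κ, ?_, ?_, ?_⟩) h5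
        · rw [sub_pos, div_lt_one hκ]; exact k1
        · have := div_pos k0 hκ; linarith
        · have e : a = b + κ • g := by rw [← hab]; abel
          have e2 : τ • g = (τ / κ * κ) • g := by rw [div_mul_cancel₀ _ hκ.ne']
          rw [e2, e]; module
  · intro h3
    refine ⟨Or.inl h3, fun h4 => ?_⟩
    obtain ⟨τ, k0, k1, rfl⟩ := mem_oseg.1 h4
    rw [show a + τ • (b - a) - b = (1 - τ) • (a - b) by module, hab, cross_smul_right,
      cross_smul_right] at h3
    have : 0 < (1 - τ) * (κ * cross f g) := mul_pos (by linarith) (mul_pos hκ h.1)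
    linarith

/-- A segment in the union of a closed set and of a set which it meets at most once. -/
theorem segment_subset_of_subsingleton {K M : Set Plane} (hK : IsClosed K) {x y : Plane}
    (hxy : x ≠ y) (h : segment ℝ x y ⊆ K ∪ M) (hM : (segment ℝ x y ∩ M).Subsingleton) :
    segment ℝ x y ⊆ K := by
  intro z hz
  by_contra hzK
  have hzM : z ∈ M := (h hz).resolve_left hzK
  have hd : y - x ≠ 0 := sub_ne_zero.2 hxy.symm
  obtain ⟨τ, h0, h1, rfl⟩ := mem_seg.1 hz
  obtain ⟨δ, hδ, H⟩ := exists_small (d := y - x) (hK.isOpen_compl.mem_nhds hzK)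
  -- A second point of the segment near `z`, moved towards its middle so as not to leave the
  -- segment.
  obtain ⟨σ, hσ0, hσ, s0, s1⟩ : ∃ σ : ℝ, σ ≠ 0 ∧ |σ| ≤ δ ∧ 0 ≤ τ + σ ∧ τ + σ ≤ 1 := by
    rcases le_total τ (1 / 2) with h | h
    · exact ⟨min δ (1 / 2), (lt_min hδ (by norm_num)).ne',
        by rw [abs_of_pos (lt_min hδ (by norm_num))]; exact min_le_left _ _,
        by have := lt_min hδ (by norm_num : (0 : ℝ) < 1 / 2); linarith,
        by have := min_le_right δ (1 / 2); linarith⟩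
    · exact ⟨-min δ (1 / 2), (neg_lt_zero.2 (lt_min hδ (by norm_num))).ne,
        by rw [abs_neg, abs_of_pos (lt_min hδ (by norm_num))]; exact min_le_left _ _,
        by have := min_le_right δ (1 / 2); linarith,
        by have := lt_min hδ (by norm_num : (0 : ℝ) < 1 / 2); linarith⟩
  have hw : x + (τ + σ) • (y - x) ∈ segment ℝ x y := mem_seg.2 ⟨_, s0, s1, rfl⟩
  have hwK : x + (τ + σ) • (y - x) ∉ K := by
    have := H σ hσ
    rwa [show x + τ • (y - x) + σ • (y - x) = x + (τ + σ) • (y - x) by module] at this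
  have := hM ⟨hz, hzM⟩ ⟨hw, (h hw).resolve_left hwK⟩
  have h2 : σ • (y - x) = 0 := by
    rw [show σ • (y - x) = x + (τ + σ) • (y - x) - (x + τ • (y - x)) by module, ← this, sub_self]
  rcases smul_eq_zero.1 h2 with h | h
  · exact hσ0 h
  · exact hd h

/-- A point of a core off a closed set belongs to the core of the rest. -/
theorem mem_core_of_notMem {K M : Set Plane} (hM : IsClosed M) {p d : Plane}
    (hp : p ∈ core (K ∪ M) d) (hpM : p ∉ M) : p ∈ core K d := by
  obtain ⟨τ, hτ, hs⟩ := hp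
  obtain ⟨δ, hδ, H⟩ := exists_small (d := τ • d) (hM.isOpen_compl.mem_nhds hpM)
  have hm : 0 < min δ 1 := lt_min hδ one_pos
  refine ⟨min δ 1 * τ, mul_ne_zero hm.ne' hτ, fun z hz => ?_⟩
  obtain ⟨σ, h0, h1, rfl⟩ := mem_seg.1 hz
  rw [show p + σ • (p + (min δ 1 * τ) • d - p) = p + (σ * min δ 1) • τ • d by module]
  have hb : 0 ≤ σ * min δ 1 := mul_nonneg h0 hm.le
  have hb' : σ * min δ 1 ≤ min δ 1 := by nlinarith
  refine (hs (mem_seg.2 ⟨σ * min δ 1, hb, hb'.trans (min_le_right _ _), by module⟩)).resolve_right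
    (H _ ?_)
  rw [abs_of_nonneg hb]; exact hb'.trans (min_le_left _ _)

theorem mem_core_of_mem_segment {K : Set Plane} {p d q : Plane} {τ : ℝ} (hτ : τ ≠ 0)
    (hs : segment ℝ p (p + τ • d) ⊆ K) (hq : q ∈ segment ℝ p (p + τ • d)) : q ∈ core K d := by
  have := mem_core_of_segment hs hq
  rwa [add_sub_cancel_left, core_smul hτ] at this

namespace TTessellation

variable {D : Set Plane} (T : TTessellation D)

theorem tee_of_mem_vertices {v : Plane} (hv : v ∈ T.vertices) (hD : v ∉ D.extremePoints ℝ) :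
    ∃ d e, IsTeeAt T.skeleton v d e :=
  Tessellation.isTeeAt_of_isTVertex hv (T.isTVertex v hv hD)

variable {T}

/-- Otherwise aligned convexity would prolong the segment up to `p`, against its maximality. -/
theorem mem_segment_of_core {a b : Plane} (hs : T.IsSegment (segment ℝ a b)) {p : Plane}
    (hp : p ∈ core T.skeleton (b - a)) (hl : cross (b - a) (p - a) = 0) : p ∈ segment ℝ a b := by
  obtain ⟨hab, -, -, hK⟩ := hs.endpoints
  have hd : b - a ≠ 0 := sub_ne_zero.2 hab.symm
  obtain ⟨τ, hτ⟩ := exists_smul_of_cross_eq_zero hd hl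
  have hp' : p = a + τ • (b - a) := by rw [← hτ]; abel
  have ea : a = a + (0 : ℝ) • (b - a) := by module
  have eb : b = a + (1 : ℝ) • (b - a) := by module
  have hmax := (Tessellation.isSegment_iff.1 hs).2.2
  rcases le_total τ 1 with h | h
  · rcases le_total 0 τ with h' | h'
    · exact mem_seg.2 ⟨τ, h', h, hp'⟩
    · refine hmax p b ?_ ?_ (left_mem_segment ℝ _ _)
      · refine (convex_segment p b).segment_subset ?_ (right_mem_segment ℝ _ _)
        have := add_smul_mem_seg (p := a) (d := b - a) h' zero_le_one
        rwa [← ea, ← eb, ← hp'] at this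
      · refine T.alignedConvex _ hd p hp b (mem_core_of_segment hK (right_mem_segment ℝ _ _)) ?_
        rw [hp', show b - (a + τ • (b - a)) = (1 - τ) • (b - a) by module, cross_smul_right,
          cross_self, mul_zero]
  · refine hmax a p ?_ ?_ (right_mem_segment ℝ _ _)
    · refine (convex_segment a p).segment_subset (left_mem_segment ℝ _ _) ?_
      have := add_smul_mem_seg (p := a) (d := b - a) zero_le_one h
      rwa [← ea, ← eb, ← hp'] at this
    · exact T.alignedConvex _ hd a (mem_core_of_segment hK (left_mem_segment ℝ _ _)) p hp hl

/-- The end of a segment, when it is not a vertex of the domain, lies inside another segment. -/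
theorem tee_at_end {a b : Plane} (hs : T.IsSegment (segment ℝ a b)) (hb : b ∉ D.extremePoints ℝ) :
    ∃ f g, IsTeeAt T.skeleton b f g ∧ ∃ κ : ℝ, 0 < κ ∧ a - b = κ • g := by
  obtain ⟨hab, -, hbV, hK⟩ := hs.endpoints
  obtain ⟨f, g, htee⟩ := T.tee_of_mem_vertices hbV hb
  refine ⟨f, g, htee, ?_⟩
  have hne : a - b ≠ 0 := sub_ne_zero.2 hab
  rcases htee.cross_eq_zero (u := a - b) ⟨1, one_pos, fun τ h0 h1 => hK (by
    rw [segment_symm]; exact mem_seg.2 ⟨τ, h0, h1, rfl⟩)⟩ with h | ⟨h, h'⟩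
  · exfalso
    obtain ⟨κ, hκ⟩ := exists_smul_of_cross_eq_zero (ne_zero_left_of_cross htee.1.ne') h
    have hκ0 : κ ≠ 0 := by rintro rfl; rw [zero_smul] at hκ; exact hne hκ
    obtain ⟨δ, hδ, H⟩ := htee.exists_small
    -- prolong the segment beyond `b`
    have hδκ : 0 < δ / |κ| := div_pos hδ (abs_pos.2 hκ0)
    have hb1 : b + (δ / |κ|) • (b - a) ∈ core T.skeleton (b - a) := by
      refine ⟨-(δ / |κ|), by linarith [hδκ], ?_⟩
      rw [show b + (δ / |κ|) • (b - a) + -(δ / |κ|) • (b - a) = b by module, segment_symm]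
      intro z hz
      obtain ⟨τ, h0, h1, rfl⟩ := mem_seg.1 hz
      have e : b + τ • (b + (δ / |κ|) • (b - a) - b) = b + (-(τ * (δ / |κ|) * κ)) • f := by
        rw [show b - a = -(a - b) by abel, hκ]; module
      rw [e]
      refine (H _ ?_).1
      rw [abs_neg, abs_mul, abs_mul, abs_of_nonneg h0, abs_of_pos hδκ]
      field_simp; nlinarith
    have := mem_segment_of_core hs hb1 (by
      rw [show b + (δ / |κ|) • (b - a) - a = (1 + δ / |κ|) • (b - a) by module, cross_smul_right,
        cross_self, mul_zero])
    obtain ⟨τ, h0, h1, h2⟩ := mem_seg.1 this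
    have h3 : (1 + δ / |κ| - τ) • (b - a) = 0 := by
      rw [show (1 + δ / |κ| - τ) • (b - a) = b + (δ / |κ|) • (b - a) - (a + τ • (b - a)) by module,
        h2, sub_self]
    rcases smul_eq_zero.1 h3 with h | h
    · linarith
    · exact hab (sub_eq_zero.1 h).symm
  · obtain ⟨κ, hκ⟩ := exists_smul_of_cross_eq_zero (ne_zero_right_of_cross htee.1.ne') h
    rw [hκ, cross_smul_right] at h'
    have := nonneg_of_mul_nonneg_left h' htee.1
    refine ⟨κ, lt_of_le_of_ne this ?_, hκ⟩
    rintro rfl; rw [zero_smul] at hκ; exact hne hκ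

theorem extreme_notMem_interior (hD : IsConvexPolygon D) {b : Plane} (hb : b ∈ interior D) :
    b ∉ D.extremePoints ℝ := fun h =>
  (hD.mem_frontier.1 (hD.extremePoints_subset_frontier h)).2 hb

/-- The cells along an internal segment do not extend beyond its end. -/
theorem exists_halfplane_at_end (hD : IsConvexPolygon D) {a b : Plane}
    (hs : T.IsInternalSegment (segment ℝ a b)) :
    ∃ g, 0 < cross g (a - b) ∧ ∀ c ∈ T.cells, b ∈ c → (∃ z ∈ c, z ∈ openSegment ℝ a b) →
      c ⊆ leftOf g b := by
  obtain ⟨hab, -, hbV, hK⟩ := hs.1.endpoints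
  have hint := oseg_subset_interior hD (hK.trans T.skeleton_subset) hs.2
  -- Inside `D`, the half-plane is bounded by the line on which `[a, b]` ends; on the boundary of
  -- `D`, by a supporting line of `D`.
  by_cases hb : b ∈ interior D
  · obtain ⟨f, g, htee, κ, hκ, hκg⟩ := tee_at_end hs.1 (extreme_notMem_interior hD hb)
    refine ⟨f, ?_, fun c hc hbc hz => ?_⟩
    · rw [hκg, cross_smul_right]; exact mul_pos hκ htee.1
    · obtain ⟨δ, hδ, H⟩ := htee.exists_small
      rcases T.one_side hc hbc (ne_zero_left_of_cross htee.1.ne')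
        ⟨δ, hδ, fun τ hτ => (H τ hτ).1⟩ with h | h
      · exact h
      · exfalso
        obtain ⟨z, hzc, hz⟩ := hz
        obtain ⟨τ, h0, h1, rfl⟩ := mem_oseg.1 hz
        have h2 : 0 ≤ cross (-f) (a + τ • (b - a) - b) := h hzc
        rw [show a + τ • (b - a) - b = (1 - τ) • (a - b) by module, hκg, cross_neg_left,
          cross_smul_right, cross_smul_right] at h2
        have : 0 < (1 - τ) * (κ * cross f g) := mul_pos (by linarith) (mul_pos hκ htee.1)
        linarith
  · obtain ⟨f, -, hpos, hle⟩ := hD.exists_support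
      (hD.mem_frontier.2 ⟨T.skeleton_subset (hK (right_mem_segment ℝ a b)), hb⟩)
    refine ⟨f, ?_, fun c hc _ _ => (T.cell_subset hc).trans hle⟩
    obtain ⟨z, hz⟩ := oseg_nonempty a b
    have := hpos z (hint hz)
    obtain ⟨τ, h0, h1, rfl⟩ := mem_oseg.1 hz
    rw [show a + τ • (b - a) - b = (1 - τ) • (a - b) by module, cross_smul_right] at this
    exact pos_of_mul_pos_right this (by linarith)

/-- Needed for the closures in the definitions of merges and flips: they put back the end `b`,
because points of the skeleton off the line of `[a, b]` accumulate there. -/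
theorem end_mem_closure (hD : IsConvexPolygon D) {a b : Plane}
    (hs : T.IsInternalSegment (segment ℝ a b)) :
    b ∈ closure (T.skeleton \ {z | cross (b - a) (z - b) = 0}) := by
  obtain ⟨hab, -, hbV, hK⟩ := hs.1.endpoints
  have hint := oseg_subset_interior hD (hK.trans T.skeleton_subset) hs.2
  have hd : b - a ≠ 0 := sub_ne_zero.2 hab.symm
  -- An internal segment may end at a corner of `D`; the boundary of `D` then supplies the points.
  -- Otherwise they are on the line of the tee at `b`.
  by_cases hb : b ∈ D.extremePoints ℝ
  · have hbf := hD.extremePoints_subset_frontier hb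
    have h1 := hD.mem_closure_frontier_diff hbf
    rw [mem_closure_iff_nhds] at h1 ⊢
    intro U hU
    obtain ⟨z, ⟨hzU, hz1⟩, hzf, hzb⟩ := h1 _ (inter_mem hU (eventually_line b hd one_pos))
    refine ⟨z, hzU, T.frontier_subset_skeleton hzf, fun h0 => ?_⟩
    obtain ⟨τ, hτ, rfl⟩ := hz1 h0
    have hτ' := abs_lt.1 hτ
    rcases lt_trichotomy τ 0 with h | rfl | h
    · refine (hD.mem_frontier.1 hzf).2 (hint (mem_oseg.2 ⟨1 + τ, by linarith, by linarith, ?_⟩))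
      module
    · exact hzb (by simp)
    · have hzD := hD.frontier_subset hzf
      refine hab (hb.2 (T.skeleton_subset (hK (left_mem_segment ℝ _ _))) hzD ?_)
      have h2 := add_smul_mem_oseg (p := b) (d := b - a) (neg_one_lt_zero (R := ℝ)) h
      rwa [show b + (-1 : ℝ) • (b - a) = a by module, show b + (0 : ℝ) • (b - a) = b by module] at h2
  · obtain ⟨f, g, htee, κ, hκ, hκg⟩ := tee_at_end hs.1 hb
    obtain ⟨δ, hδ, H⟩ := htee.exists_small
    refine mem_closure_of_tendsto (f := fun τ : ℝ => b + τ • f) (b := 𝓝[>] 0)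
      ((oseg_ray_tendsto b f).mono_left nhdsWithin_le_nhds) ?_
    filter_upwards [Ioo_mem_nhdsGT hδ] with τ hτ
    refine ⟨(H τ (by rw [abs_of_pos hτ.1]; exact hτ.2.le)).1, fun h0 => ?_⟩
    have h0 : cross (b - a) (b + τ • f - b) = 0 := h0
    rw [add_sub_cancel_left, show b - a = -(a - b) by abel, hκg, cross_neg_left, cross_smul_left,
      cross_smul_right, cross_swap] at h0
    have : 0 < κ * (τ * cross f g) := mul_pos hκ (mul_pos hτ.1 htee.1)
    nlinarith

/-- A cell containing the part near `v` of an open convex set avoiding the skeleton. -/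
theorem exists_cell_near {v : Plane} (hv : v ∈ interior D) {P : Set Plane} (hP : Convex ℝ P)
    (hvP : v ∈ closure P) (hK : ∀ᶠ z in 𝓝 v, z ∈ T.skeleton → z ∉ P) :
    ∃ A ∈ T.cells, ∃ ε > 0, Metric.ball v ε ∩ P ⊆ interior A := by
  obtain ⟨ε, hε, H⟩ := Metric.eventually_nhds_iff_ball.1
    (hK.and (isOpen_interior.mem_nhds hv))
  obtain ⟨A, hA, h⟩ := T.exists_cell_of_isPreconnected
    ((convex_ball v ε).inter hP).isPreconnected
    (mem_closure_iff_nhds.1 hvP _ (Metric.ball_mem_nhds v hε))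
    (fun z hz => interior_subset (H z hz.1).2)
    (disjoint_left.2 fun z hz hzK => (H z hz.1).1 hzK hz.2)
  exact ⟨A, hA, ε, hε, h⟩

/-- A side of `c` through `p` contains an edge through `p`, and only one edge passes through a point
which is not a vertex. -/
theorem segment_subset_cell {c : Set Plane} (hc : c ∈ T.cells) {v b p : Plane}
    (he : T.IsEdge (segment ℝ v b)) (hp : p ∈ openSegment ℝ v b) (hpc : p ∈ c) :
    segment ℝ v b ⊆ c := by
  have hpV := disjoint_left.1 he.disjoint.2.2.2 hp
  have hps := openSegment_subset_segment ℝ _ _ hp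
  have hP := T.isConvexPolygon c hc
  obtain ⟨s, hs, hps'⟩ := hP.exists_side (hP.mem_frontier.2 ⟨hpc, fun h =>
    disjoint_left.1 (T.disjoint_interior_skeleton hc) h (he.subset_skeleton hps)⟩)
  obtain ⟨e, he', hpe, hes⟩ := T.exists_edge_subset_side hc hs hps'
  obtain ⟨-, -, -, -, -, -, hsf⟩ := hs
  rw [he.eq_of_mem he' hps hpe hpV]
  exact (hes.trans hsf).trans hP.frontier_subset

theorem mem_interior_of_edge (hD : IsConvexPolygon D) {a b p : Plane}
    (hs : T.IsInternalSegment (segment ℝ a b)) (hp : p ∈ openSegment ℝ a b) : p ∈ interior D :=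
  oseg_subset_interior hD (hs.1.endpoints.2.2.2.trans T.skeleton_subset) hs.2 hp

theorem isInternalSegment_symm {a b : Plane} (hs : T.IsInternalSegment (segment ℝ a b)) :
    T.IsInternalSegment (segment ℝ b a) := by rwa [segment_symm]

end TTessellation

theorem eventually_notMem_of_isClosed {M : Set Plane} (hM : IsClosed M) {p : Plane} (hp : p ∉ M) :
    ∀ᶠ z in 𝓝 p, z ∉ M := hM.isOpen_compl.mem_nhds hp

theorem mem_closure_cross_pos {d p v : Plane} (hd : d ≠ 0) (hv : cross d (v - p) = 0) :
    v ∈ closure {z | 0 < cross d (z - p)} := by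
  obtain ⟨n, hn⟩ := exists_cross_pos hd
  refine mem_closure_of_tendsto (f := fun τ : ℝ => v + τ • n) (b := 𝓝[>] 0)
    ((oseg_ray_tendsto v n).mono_left nhdsWithin_le_nhds) ?_
  filter_upwards [self_mem_nhdsWithin] with τ hτ
  rw [show v + τ • n - p = (v - p) + τ • n by module, cross_add_right, hv, cross_smul_right, zero_add]
  exact mul_pos hτ hn

/-! ### Deleting a non-blocking segment -/

namespace TTessellation

variable {D : Set Plane} {T : TTessellation D}

theorem isFlatAt_of_mem_oseg {a b p : Plane} (hab : a ≠ b) (hK : segment ℝ a b ⊆ T.skeleton)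
    (hp : p ∈ openSegment ℝ a b) (hpV : p ∉ T.vertices) : IsFlatAt T.skeleton p (b - a) :=
  Tessellation.exists_flat_of_edge hab hK hp hpV

/-- A segment of the skeleton which crosses an edge at an inner point is aligned with it. -/
theorem cross_eq_zero_of_crossing {a b z p q : Plane} (hab : a ≠ b)
    (hK : segment ℝ a b ⊆ T.skeleton) (hz : z ∈ openSegment ℝ a b) (hzV : z ∉ T.vertices)
    (hpq : segment ℝ p q ⊆ T.skeleton) (hzs : z ∈ openSegment ℝ p q) :
    cross (b - a) (q - p) = 0 := by
  obtain ⟨δ, hδ, H⟩ := Tessellation.smul_mem_of_oseg hzs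
  exact (isFlatAt_of_mem_oseg hab hK hz hzV).cross_eq_zero
    ⟨δ, hδ, fun τ h0 h1 => hpq (H τ (by rwa [abs_of_nonneg h0]))⟩

theorem mem_oseg_of_ne {x y z : Plane} (hz : z ∈ segment ℝ x y) (h1 : z ≠ x) (h2 : z ≠ y) :
    z ∈ openSegment ℝ x y := by
  rcases mem_seg_iff_oseg.1 hz with h | h | h
  · exact absurd h h1
  · exact absurd h h2
  · exact h

theorem cross_eq_zero_trans {d e f : Plane} (hd : d ≠ 0) (h1 : cross d e = 0) (h2 : cross d f = 0) :
    cross e f = 0 := by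
  obtain ⟨α, rfl⟩ := exists_smul_of_cross_eq_zero hd h1
  obtain ⟨β, rfl⟩ := exists_smul_of_cross_eq_zero hd h2
  rw [cross_smul_left, cross_smul_right, cross_self]; simp

/-- The deletion of an internal segment consisting of one edge. -/
theorem exists_merge (hD : IsConvexPolygon D) {a b : Plane}
    (hs : T.IsInternalSegment (segment ℝ a b)) (he : T.IsEdge (segment ℝ a b)) :
    ∃ T' : TTessellation D, T'.skeleton = T.skeleton \ openSegment ℝ a b := by
  obtain ⟨hab, haV, hbV, hK⟩ := hs.1.endpoints
  have hdis := he.disjoint.2.2.2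
  set d := b - a with hd
  have hd0 : d ≠ 0 := sub_ne_zero.2 hab.symm
  obtain ⟨p, hp⟩ := oseg_nonempty a b
  have hpV := disjoint_left.1 hdis hp
  have hpD := mem_interior_of_edge hD hs hp
  have hps := openSegment_subset_segment ℝ _ _ hp
  have hflat := isFlatAt_of_mem_oseg hab hK hp hpV
  have hpa : cross d (p - a) = 0 := cross_eq_zero_of_mem_seg hps
  obtain ⟨gb, hgb, hgb'⟩ := exists_halfplane_at_end hD hs
  obtain ⟨ga, hga, hga'⟩ := exists_halfplane_at_end hD (isInternalSegment_symm hs)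
  -- The cell on the left of `f`: it contains a half-disc at the point `p` inside the edge, hence
  -- the whole edge.
  have cell : ∀ f : Plane, f ≠ 0 → IsFlatAt T.skeleton p f → (∀ z, cross f (z - p) = cross f (z - a)) →
      ∃ A ∈ T.cells, segment ℝ a b ⊆ A ∧ A ⊆ leftOf f a ∧ ∃ z ∈ A, 0 < cross f (z - a) := by
    intro f hf hfl hfa
    obtain ⟨A, hA, ε, hε, hsub⟩ := exists_cell_near hpD (convex_cross_pos f p)
      (mem_closure_cross_pos hf (by rw [sub_self, cross_zero_right])) (by
        filter_upwards [hfl.2] with z hz hzK h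
        have h : 0 < cross f (z - p) := h
        rw [hz.1 hzK] at h; exact lt_irrefl _ h)
    have hPA := T.isConvexPolygon A hA
    have hpA : p ∈ A := by
      rw [← hPA.closure_interior]
      refine closure_mono hsub ?_
      rw [mem_closure_iff_nhds]
      intro U hU
      obtain ⟨z, hz, hz'⟩ := mem_closure_iff_nhds.1
        (mem_closure_cross_pos (p := p) (v := p) hf (by rw [sub_self, cross_zero_right])) _
        (inter_mem hU (Metric.ball_mem_nhds p hε))
      exact ⟨z, hz.1, hz.2, hz'⟩
    obtain ⟨z, hz, hz'⟩ := mem_closure_iff_nhds.1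
        (mem_closure_cross_pos (p := p) (v := p) hf (by rw [sub_self, cross_zero_right])) _
        (Metric.ball_mem_nhds p hε)
    have hzA := interior_subset (hsub ⟨hz, hz'⟩)
    have hz' : 0 < cross f (z - p) := hz'
    refine ⟨A, hA, segment_subset_cell hA he hp hpA, ?_, z, hzA, by rwa [← hfa]⟩
    rcases T.one_side hA hpA hf hfl.exists_small with h | h
    · intro w hw
      have : 0 ≤ cross f (w - p) := h hw
      rwa [hfa] at this
    · exfalso
      have : 0 ≤ cross (-f) (z - p) := h hzA
      rw [cross_neg_left] at this
      linarith
  have hfa : ∀ z, cross d (z - p) = cross d (z - a) := fun z => by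
    rw [show z - p = (z - a) - (p - a) by abel, cross_sub_right, hpa, sub_zero]
  obtain ⟨A, hA, hsA, hAd, zA, hzA, hzA'⟩ := cell d hd0 hflat hfa
  obtain ⟨B, hB, hsB, hBd, -⟩ := cell (-d) (neg_ne_zero.2 hd0) hflat.neg
    (fun z => by rw [cross_neg_left, cross_neg_left, hfa])
  have hAB : A ≠ B := by
    rintro rfl
    have : 0 ≤ cross (-d) (zA - a) := hBd hzA
    rw [cross_neg_left] at this
    linarith
  have hA' : ∀ c, segment ℝ a b ⊆ c → ∃ z ∈ c, z ∈ openSegment ℝ a b := fun c h => ⟨p, h hps, hp⟩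
  obtain ⟨T₁, hT₁⟩ := T.exists_mergeCells hA hB hAB hd0 (d := d) (v := a) (b := b)
    (by rw [← hd, cross_self]) hga hgb hsA hsB hAd hBd
    (union_subset
      (hga' A hA (hsA (left_mem_segment ℝ _ _)) (by rw [openSegment_symm]; exact hA' A hsA))
      (hga' B hB (hsB (left_mem_segment ℝ _ _)) (by rw [openSegment_symm]; exact hA' B hsB)))
    (union_subset (hgb' A hA (hsA (right_mem_segment ℝ _ _)) (hA' A hsA))
      (hgb' B hB (hsB (right_mem_segment ℝ _ _)) (hA' B hsB)))
  have hsub : T₁.skeleton ⊆ T.skeleton := by rw [hT₁]; exact sdiff_subset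
  refine ⟨TTessellation.ofSkeleton hD T₁ ?_ ?_, hT₁⟩
  · intro q hq hqD
    by_cases hqs : q ∈ segment ℝ a b
    · rcases mem_seg_iff_oseg.1 hqs with rfl | rfl | h
      · obtain ⟨f, g, htee, κ, hκ, hκg⟩ := tee_at_end (isInternalSegment_symm hs).1 hqD
        left
        rw [hT₁, openSegment_symm]
        exact ⟨f, htee.flat_of_remove hκ hκg⟩
      · obtain ⟨f, g, htee, κ, hκ, hκg⟩ := tee_at_end hs.1 hqD
        left
        rw [hT₁]
        exact ⟨f, htee.flat_of_remove hκ hκg⟩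
      · rw [hT₁] at hq; exact absurd h hq.2
    · have hev : ∀ᶠ z in 𝓝 q, (z ∈ T₁.skeleton ↔ z ∈ T.skeleton) := by
        filter_upwards [eventually_notMem_of_isClosed (isClosed_seg a b) hqs] with z hz
        rw [hT₁]
        exact ⟨fun h => h.1, fun h => ⟨h, fun h' => hz (openSegment_subset_segment ℝ _ _ h')⟩⟩
      rcases T.isFlatAt_or_isTeeAt (hsub hq) hqD with ⟨f, h⟩ | ⟨f, g, h⟩
      · exact Or.inl ⟨f, h.congr hev⟩
      · exact Or.inr ⟨f, g, h.congr hev⟩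
  · intro δ hδ q hq q' hq' hc z hz
    have hzK := T.alignedConvex δ hδ q (core_mono hsub δ hq) q' (core_mono hsub δ hq') hc
    rw [hT₁]
    -- If the segment from `q` to `q'` met the deleted open segment, which contains no vertex, both
    -- would be aligned. The piece of the new skeleton at `q` would then lie on `[a, b]`, of which
    -- only the ends remain.
    refine ⟨hzK hz, fun hzo => ?_⟩
    have hqn : ∀ w ∈ T₁.skeleton, w ≠ z := fun w hw => by
      rintro rfl; rw [hT₁] at hw; exact hw.2 hzo
    have hq1 := hqn q (core_subset _ _ hq)
    have hq2 := hqn q' (core_subset _ _ hq')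
    have hcr := cross_eq_zero_of_crossing hab hK hzo (disjoint_left.1 hdis hzo) hzK
      (mem_oseg_of_ne hz hq1.symm hq2.symm)
    have hqq : q' - q ≠ 0 := by
      intro h
      rw [sub_eq_zero] at h
      rw [h, segment_same] at hz
      exact hq1 (mem_singleton_iff.1 hz).symm
    -- the direction is that of the segment
    have hdδ : cross d δ = 0 :=
      cross_eq_zero_trans hqq (by rw [cross_swap, hcr, neg_zero]) (by rw [cross_swap, hc, neg_zero])
    obtain ⟨k, rfl⟩ := exists_smul_of_cross_eq_zero hd0 hdδ
    have hk : k ≠ 0 := by rintro rfl; simp at hδ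
    rw [core_smul hk] at hq
    obtain ⟨τ, hτ, hτs⟩ := hq
    have hqa : cross d (q - a) = 0 := by
      have h1 : cross d (z - a) = 0 := cross_eq_zero_of_mem_seg (openSegment_subset_segment ℝ _ _ hzo)
      obtain ⟨σ, -, -, hσ⟩ := mem_seg.1 hz
      have h2 : q - a = (z - a) - σ • (q' - q) := by rw [hσ]; module
      rw [h2, cross_sub_right, cross_smul_right, h1, hcr]; simp
    have hends : ∀ w ∈ segment ℝ q (q + τ • d), w = a ∨ w = b := by
      intro w hw
      have h1 := core_mono hsub d (mem_core_of_mem_segment hτ hτs hw)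
      obtain ⟨σ, -, -, hσ⟩ := mem_seg.1 hw
      have h2 := mem_segment_of_core hs.1 h1 (by
        rw [← hd, show w - a = (q - a) + (σ * τ) • d by rw [hσ]; module, cross_add_right, hqa,
          cross_smul_right, cross_self]; simp)
      have h3 := hτs hw
      rw [hT₁] at h3
      rcases mem_seg_iff_oseg.1 h2 with h | h | h
      · exact Or.inl h
      · exact Or.inr h
      · exact absurd h h3.2
    have hne : ∀ σ σ' : ℝ, σ ≠ σ' → q + (σ * τ) • d ≠ q + (σ' * τ) • d := by
      intro σ σ' h h'
      have : ((σ - σ') * τ) • d = 0 := by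
        rw [show ((σ - σ') * τ) • d = q + (σ * τ) • d - (q + (σ' * τ) • d) by module, h', sub_self]
      rcases smul_eq_zero.1 this with h'' | h''
      · rcases mul_eq_zero.1 h'' with h3 | h3
        · exact h (sub_eq_zero.1 h3)
        · exact hτ h3
      · exact hd0 h''
    -- Three distinct points of a segment cannot all belong to `{a, b}`.
    have hm : ∀ σ : ℝ, 0 ≤ σ → σ ≤ 1 → q + (σ * τ) • d = a ∨ q + (σ * τ) • d = b :=
      fun σ h0 h1 => hends _ (mem_seg.2 ⟨σ, h0, h1, by module⟩)
    have n1 := hne 0 (1 / 2) (by norm_num)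
    have n2 := hne 0 1 (by norm_num)
    have n3 := hne (1 / 2) 1 (by norm_num)
    rcases hm 0 le_rfl zero_le_one with h0 | h0 <;>
      rcases hm (1 / 2) (by norm_num) (by norm_num) with h1 | h1 <;>
      rcases hm 1 zero_le_one le_rfl with h2 | h2
    · exact n1 (h0.trans h1.symm)
    · exact n1 (h0.trans h1.symm)
    · exact n2 (h0.trans h2.symm)
    · exact n3 (h1.trans h2.symm)
    · exact n3 (h1.trans h2.symm)
    · exact n2 (h0.trans h2.symm)
    · exact n1 (h0.trans h1.symm)
    · exact n1 (h0.trans h1.symm)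

/-- The closure adds exactly the two ends, which are limits of the rest of the skeleton by
`end_mem_closure`. -/
theorem closure_skeleton_diff (hD : IsConvexPolygon D) {a b : Plane}
    (hs : T.IsInternalSegment (segment ℝ a b)) {T' : TTessellation D}
    (h : T'.skeleton = T.skeleton \ openSegment ℝ a b) :
    closure (T.skeleton \ segment ℝ a b) = T'.skeleton := by
  obtain ⟨hab, haV, hbV, hK⟩ := hs.1.endpoints
  have e1 : ∀ {a b : Plane} {z : Plane}, z ∈ segment ℝ a b → cross (b - a) (z - b) = 0 := by
    intro a b z hz
    rw [cross_sub_base (cross_self _)]; exact cross_eq_zero_of_mem_seg hz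
  refine subset_antisymm (closure_minimal ?_ T'.isClosed_skeleton) ?_
  · rw [h]; exact sdiff_subset_sdiff_right (openSegment_subset_segment ℝ _ _)
  · rw [h]
    rintro z ⟨hz, hzo⟩
    by_cases hzs : z ∈ segment ℝ a b
    · rcases mem_seg_iff_oseg.1 hzs with rfl | rfl | h
      · refine closure_mono ?_ (end_mem_closure hD (isInternalSegment_symm hs))
        exact sdiff_subset_sdiff_right fun w hw => e1 (by rwa [segment_symm])
      · exact closure_mono (sdiff_subset_sdiff_right fun w hw => e1 hw) (end_mem_closure hD hs)
      · exact absurd h hzo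
    · exact subset_closure ⟨hz, hzs⟩

theorem exists_isMerge (hD : IsConvexPolygon D) {a b : Plane}
    (hs : T.IsInternalSegment (segment ℝ a b)) (he : T.IsEdge (segment ℝ a b)) :
    ∃ T', IsMerge T T' := by
  obtain ⟨T', h⟩ := exists_merge hD hs he
  exact ⟨T', _, hs, he, (closure_skeleton_diff hD hs h).symm⟩

theorem skeleton_of_isMerge (hD : IsConvexPolygon D) {T' : TTessellation D} (h : IsMerge T T') :
    ∃ a b, T.IsInternalSegment (segment ℝ a b) ∧ T.IsEdge (segment ℝ a b) ∧
      T'.skeleton = T.skeleton \ openSegment ℝ a b := by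
  obtain ⟨s, hs, he, hsk⟩ := h
  obtain ⟨a, b, -, -, -, rfl, -⟩ := hs.1.exists_endpoints
  obtain ⟨T₁, h₁⟩ := exists_merge hD hs he
  refine ⟨a, b, hs, he, ?_⟩
  rw [hsk, closure_skeleton_diff hD hs h₁, h₁]

end TTessellation

/-! ### Splits -/

theorem IsConvexPolygon.exists_chord {c : Set Plane} (hc : IsConvexPolygon c) {q f : Plane}
    (hq : q ∈ interior c) (hf : f ≠ 0) : ∃ β : ℝ, 0 < β ∧ q + β • f ∈ frontier c ∧
      (∀ τ, β < τ → q + τ • f ∉ c) ∧ ∀ τ, 0 ≤ τ → τ < β → q + τ • f ∈ interior c := by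
  have hcont : Continuous fun τ : ℝ => q + τ • f := by fun_prop
  let S : Set ℝ := {τ | 0 ≤ τ ∧ q + τ • f ∈ c}
  have hScl : IsClosed S :=
    (isClosed_le continuous_const continuous_id).inter (hc.isClosed.preimage hcont)
  obtain ⟨R, hR⟩ := hc.isCompact.isBounded.subset_closedBall q
  have hfn : 0 < ‖f‖ := norm_pos_iff.2 hf
  have hSb : BddAbove S := ⟨R / ‖f‖, fun τ hτ => by
    have := hR hτ.2
    rw [Metric.mem_closedBall, dist_eq_norm, add_sub_cancel_left, norm_smul, Real.norm_eq_abs,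
      abs_of_nonneg hτ.1] at this
    rwa [le_div_iff₀ hfn]⟩
  have hSn : S.Nonempty := ⟨0, le_rfl, by simpa using interior_subset hq⟩
  have hmem := hScl.csSup_mem hSn hSb
  set β := sSup S
  obtain ⟨δ, hδ, H⟩ := exists_small (d := f) (isOpen_interior.mem_nhds hq)
  have hβδ : δ ≤ β := le_csSup hSb ⟨hδ.le, interior_subset (H δ (by rw [abs_of_pos hδ]))⟩
  have hout : ∀ τ, β < τ → q + τ • f ∉ c := fun τ hτ h =>
    absurd (le_csSup hSb ⟨by linarith, h⟩) (not_le.2 hτ)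
  refine ⟨β, by linarith, hc.mem_frontier.2 ⟨hmem.2, fun hi => ?_⟩, hout, fun τ h0 h1 => ?_⟩
  · obtain ⟨δ', hδ', H'⟩ := exists_small (d := f) (isOpen_interior.mem_nhds hi)
    refine hout (β + δ') (by linarith) ?_
    have := interior_subset (H' δ' (by rw [abs_of_pos hδ']))
    rwa [add_assoc, ← add_smul] at this
  · rcases h0.eq_or_lt with rfl | h0
    · simpa using hq
    · have := add_smul_mem_oseg (p := q) (d := f) h0 h1
      rw [zero_smul, add_zero] at this
      exact hc.convex.openSegment_interior_self_subset_interior hq hmem.2 this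

namespace TTessellation

variable {D : Set Plane} {T : TTessellation D}

/-- The germ of the skeleton at the end of a chord of a cell. -/
theorem tee_at_chord_end {c : Set Plane} (hc : c ∈ T.cells) {q f : Plane} (hq : q ∈ interior c)
    {β : ℝ} (hβ : 0 < β) (hw : q + β • f ∈ frontier c) (hwV : q + β • f ∉ T.vertices) :
    ∃ d e, IsTeeAt (T.skeleton ∪ c ∩ {z | cross f (z - q) = 0}) (q + β • f) d e := by
  have hP := T.isConvexPolygon c hc
  set w := q + β • f with hwdef
  have hwl : cross f (w - q) = 0 := by
    rw [hwdef, add_sub_cancel_left, cross_smul_right, cross_self, mul_zero]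
  have hwc := hP.frontier_subset hw
  obtain ⟨d₀, hd₀⟩ := Tessellation.exists_isFlatAt (T.frontier_cell_subset hc hw) hwV
  obtain ⟨d, hd, hcd⟩ : ∃ d, IsFlatAt T.skeleton w d ∧ c ⊆ leftOf d w := by
    rcases T.one_side hc hwc hd₀.1 hd₀.exists_small with h | h
    · exact ⟨d₀, hd₀, h⟩
    · exact ⟨-d₀, hd₀.neg, h⟩
  have hpos : 0 < cross d (-f) := by
    have h1 := interior_mono hcd hq
    rw [interior_leftOf hd.1] at h1
    have h1 : 0 < cross d (q - w) := h1
    rw [show q - w = β • -f by rw [hwdef]; module, cross_smul_right] at h1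
    exact pos_of_mul_pos_right h1 hβ.le
  -- The line of the tee is the flat germ met by the chord; the stem goes back along the chord, in
  -- the direction `-f`.
  refine ⟨d, -f, hpos, ?_⟩
  filter_upwards [hd.2, eventually_ray w hpos hβ] with z h1 h2
  have hzl : cross f (z - q) = cross f (z - w) := by
    rw [show z - q = (z - w) + (w - q) by abel, cross_add_right, hwl, add_zero]
  rw [mem_union, h1]
  refine or_congr_right ?_
  constructor
  · rintro ⟨hzc, hz⟩
    have hz : cross f (z - q) = 0 := hz
    exact ⟨by rw [cross_neg_left, ← hzl, hz, neg_zero], hcd hzc⟩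
  · rintro ⟨hz, hz'⟩
    obtain ⟨τ, h0, h3, rfl⟩ := h2 hz hz'
    refine ⟨hP.convex.segment_subset hwc (interior_subset hq) (mem_seg.2
      ⟨τ / β, by positivity, by rw [div_le_one hβ]; exact h3.le, ?_⟩), ?_⟩
    · have : τ • f = (τ / β * β) • f := by rw [div_mul_cancel₀ _ hβ.ne']
      rw [smul_neg, this, hwdef]; module
    · change cross f _ = 0
      rw [hzl, add_sub_cancel_left, cross_smul_right, cross_neg_right, cross_self]; simp

theorem inter_line_subsingleton {f q p δ : Plane} {τ : ℝ}
    (h : cross f δ ≠ 0 ∨ cross f (p - q) ≠ 0) :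
    (segment ℝ p (p + τ • δ) ∩ {z | cross f (z - q) = 0}).Subsingleton := by
  rintro z ⟨hz, hzl⟩ w ⟨hw, hwl⟩
  have hzl : cross f (z - q) = 0 := hzl
  have hwl : cross f (w - q) = 0 := hwl
  obtain ⟨σ, -, -, rfl⟩ := mem_seg.1 hz
  obtain ⟨ρ, -, -, rfl⟩ := mem_seg.1 hw
  rw [show p + σ • (p + τ • δ - p) - q = (p - q) + (σ * τ) • δ by module, cross_add_right,
    cross_smul_right] at hzl
  rw [show p + ρ • (p + τ • δ - p) - q = (p - q) + (ρ * τ) • δ by module, cross_add_right,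
    cross_smul_right] at hwl
  have h0 : cross f δ ≠ 0 := by
    intro h0
    rw [h0, mul_zero, add_zero] at hzl
    rcases h with h | h
    · exact h h0
    · exact h hzl
  have h1 : (σ * τ - ρ * τ) * cross f δ = 0 := by linarith
  have h2 := (mul_eq_zero.1 h1).resolve_right h0
  rw [show p + σ • (p + τ • δ - p) = p + (σ * τ) • δ by module,
    show p + ρ • (p + τ • δ - p) = p + (ρ * τ) • δ by module, show σ * τ = ρ * τ by linarith]

/-- The core along any direction is not changed by adding parts of other lines. -/
theorem mem_core_of_union_line {K : Set Plane} (hK : IsClosed K) {c : Set Plane} {f q p δ : Plane}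
    (hδ : δ ≠ 0) (h : cross f δ ≠ 0 ∨ cross f (p - q) ≠ 0)
    (hp : p ∈ core (K ∪ c ∩ {z | cross f (z - q) = 0}) δ) : p ∈ core K δ := by
  obtain ⟨τ, hτ, hs⟩ := hp
  refine ⟨τ, hτ, segment_subset_of_subsingleton hK ?_ hs
    ((inter_line_subsingleton h).anti (inter_subset_inter_right _ inter_subset_right))⟩
  intro h'
  have : τ • δ = 0 := by simpa using h'.symm
  rcases smul_eq_zero.1 this with h | h
  · exact hτ h
  · exact hδ h

/-- A segment of the skeleton can be prolonged along its line up to a vertex (`exists_extension`),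
but this line contains none. -/
theorem notMem_core_of_line {f q p : Plane} (hf : f ≠ 0)
    (hV : ∀ z ∈ T.vertices, cross f (z - q) ≠ 0) (hp : cross f (p - q) = 0) :
    p ∉ core T.skeleton f := by
  rintro ⟨τ, hτ, hs⟩
  obtain ⟨α, -, hα, -⟩ := Tessellation.exists_extension (T := T.toTessellation) (x := p) (y := p + τ • f)
    (fun h => by
      have : τ • f = 0 := by simpa using h.symm
      rcases smul_eq_zero.1 this with h | h
      · exact hτ h
      · exact hf h) hs
  refine hV _ hα ?_
  rw [show p + α • (p + τ • f - p) - q = (p - q) + (α * τ) • f by module, cross_add_right, hp,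
    cross_smul_right, cross_self]; simp

/-- The division of a cell by a line containing no vertex. -/
theorem exists_split (hD : IsConvexPolygon D) {c : Set Plane} (hc : c ∈ T.cells) {q f : Plane}
    (hq : q ∈ interior c) (hf : f ≠ 0) (hV : ∀ z ∈ T.vertices, cross f (z - q) ≠ 0) :
    ∃ T' : TTessellation D, T'.skeleton = T.skeleton ∪ c ∩ {z | cross f (z - q) = 0} := by
  have hP := T.isConvexPolygon c hc
  have near : ∀ g : Plane, g ≠ 0 → ∃ z ∈ interior c, 0 < cross g (z - q) := by
    intro g hg
    obtain ⟨z, hz, hz'⟩ := mem_closure_iff_nhds.1 (mem_closure_cross_pos (p := q) (v := q) hg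
      (by rw [sub_self, cross_zero_right])) _ (isOpen_interior.mem_nhds hq)
    exact ⟨z, hz, hz'⟩
  obtain ⟨T₁, -, hT₁⟩ := T.exists_splitCell hc hf (near f hf) (near (-f) (neg_ne_zero.2 hf))
  have hneg : {z | cross f (z - q) = 0} = {z | cross (-f) (z - q) = 0} := by
    ext z; simp [cross_neg_left]
  have hlcl : IsClosed (c ∩ {z | cross f (z - q) = 0}) := hP.isClosed.inter
    (isClosed_eq ((continuous_cross f).comp (continuous_id.sub continuous_const)) continuous_const)
  have hlc : Convex ℝ (c ∩ {z | cross f (z - q) = 0}) := by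
    have : c ∩ {z | cross f (z - q) = 0} = c ∩ (leftOf f q ∩ leftOf (-f) q) := by
      ext z
      simp only [leftOf, mem_inter_iff, mem_ofPred_eq, cross_neg_left]
      constructor
      · rintro ⟨h1, h2⟩; exact ⟨h1, by linarith, by linarith⟩
      · rintro ⟨h1, h2, h3⟩; exact ⟨h1, by linarith⟩
    rw [this]
    exact hP.convex.inter ((convex_leftOf _ _).inter (convex_leftOf _ _))
  refine ⟨TTessellation.ofSkeleton hD T₁ ?_ ?_, hT₁⟩
  · intro p hp hpD
    rw [hT₁]
    by_cases hpl : p ∈ c ∩ {z | cross f (z - q) = 0}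
    · by_cases hpi : p ∈ interior c
      · left
        refine ⟨f, hf, ?_⟩
        filter_upwards [isOpen_interior.mem_nhds hpi] with z hz
        have e : cross f (z - p) = cross f (z - q) := by
          have h : cross f (p - q) = 0 := hpl.2
          rw [show z - p = (z - q) - (p - q) by abel, cross_sub_right, h, sub_zero]
        rw [e]
        constructor
        · rintro (h | h)
          · exact absurd h (disjoint_left.1 (T.disjoint_interior_skeleton hc) hz)
          · exact h.2
        · exact fun h => Or.inr ⟨interior_subset hz, h⟩
      · right
        have hpf := hP.mem_frontier.2 ⟨hpl.1, hpi⟩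
        have hpV : p ∉ T.vertices := fun h => hV p h hpl.2
        obtain ⟨β, hβ⟩ := exists_smul_of_cross_eq_zero hf hpl.2
        have hpe : p = q + β • f := by rw [← hβ]; abel
        rcases lt_trichotomy β 0 with h | rfl | h
        · rw [hneg]
          rw [show p = q + (-β) • (-f) by rw [hpe]; module] at hpf hpV ⊢
          exact tee_at_chord_end hc hq (by linarith) hpf hpV
        · rw [zero_smul, add_zero] at hpe
          rw [hpe] at hpi; exact absurd hq hpi
        · rw [hpe] at hpf hpV ⊢
          exact tee_at_chord_end hc hq h hpf hpV
    · have hev : ∀ᶠ z in 𝓝 p, (z ∈ T.skeleton ∪ c ∩ {z | cross f (z - q) = 0} ↔ z ∈ T.skeleton) := by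
        filter_upwards [eventually_notMem_of_isClosed hlcl hpl] with z hz
        exact ⟨fun h => h.resolve_right hz, Or.inl⟩
      rw [hT₁] at hp
      rcases T.isFlatAt_or_isTeeAt (hp.resolve_right hpl) hpD with ⟨d, h⟩ | ⟨d, e, h⟩
      · exact Or.inl ⟨d, h.congr hev⟩
      · exact Or.inr ⟨d, e, h.congr hev⟩
  · intro δ hδ p hp p' hp' hcr
    rw [hT₁] at hp hp' ⊢
    -- On the dividing line only the chord matters, and it is convex. Any other line meets the
    -- dividing line at most once, so its core points are those of the old skeleton.
    by_cases h : cross f δ = 0 ∧ cross f (p - q) = 0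
    · obtain ⟨k, rfl⟩ := exists_smul_of_cross_eq_zero hf h.1
      have hk : k ≠ 0 := by rintro rfl; simp at hδ
      rw [core_smul hk] at hp hp'
      rw [cross_smul_left] at hcr
      have hcr := (mul_eq_zero.1 hcr).resolve_left hk
      have hp'q : cross f (p' - q) = 0 := by
        rw [show p' - q = (p' - p) + (p - q) by abel, cross_add_right, hcr, h.2, add_zero]
      have key : ∀ r, r ∈ core (T.skeleton ∪ c ∩ {z | cross f (z - q) = 0}) f →
          cross f (r - q) = 0 → r ∈ c ∩ {z | cross f (z - q) = 0} := by
        intro r hr hrq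
        by_contra hn
        exact notMem_core_of_line hf hV hrq (mem_core_of_notMem hlcl hr hn)
      exact (hlc.segment_subset (key p hp h.2) (key p' hp' hp'q)).trans subset_union_right
    · have h1 : cross f δ ≠ 0 ∨ cross f (p - q) ≠ 0 := by tauto
      have h2 : cross f δ ≠ 0 ∨ cross f (p' - q) ≠ 0 := by
        by_contra! hn
        obtain ⟨k, rfl⟩ := exists_smul_of_cross_eq_zero hf hn.1
        have hk : k ≠ 0 := by rintro rfl; simp at hδ
        rw [cross_smul_left] at hcr
        have hcr := (mul_eq_zero.1 hcr).resolve_left hk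
        refine h ⟨hn.1, ?_⟩
        rw [show p - q = (p' - q) - (p' - p) by abel, cross_sub_right, hcr, hn.2, sub_zero]
      exact (T.alignedConvex δ hδ p (mem_core_of_union_line T.isClosed_skeleton hδ h1 hp) p'
        (mem_core_of_union_line T.isClosed_skeleton hδ h2 hp') hcr).trans subset_union_left

end TTessellation

end TTess

/-! ### Flips -/

namespace TTess

/-- The skeleton after a flip: the edge `[v, b]` is replaced by `[v, x]`. -/
def flipSkeleton (K : Set Plane) (v b x : Plane) : Set Plane :=
  K \ openSegment ℝ v b ∪ segment ℝ v x

theorem cross_add_smul_self (d v : Plane) (τ : ℝ) : cross d (v + τ • d - v) = 0 := by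
  rw [add_sub_cancel_left, cross_smul_right, cross_self, mul_zero]

theorem openSegment_subset_of_mem {a b v : Plane} (h : v ∈ openSegment ℝ a b) :
    openSegment ℝ v b ⊆ openSegment ℝ a b := by
  obtain ⟨τ, h0, h1, hv⟩ := mem_oseg.1 h
  intro z hz
  obtain ⟨σ, k0, k1, rfl⟩ := mem_oseg.1 hz
  refine mem_oseg.2 ⟨τ + σ * (1 - τ), by nlinarith, by nlinarith, ?_⟩
  rw [hv]; module

theorem mem_closure_of_ray {P : Set Plane} {q n : Plane} (h : ∀ τ : ℝ, 0 < τ → q + τ • n ∈ P) :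
    q ∈ closure P :=
  mem_closure_of_tendsto (f := fun τ : ℝ => q + τ • n) (b := 𝓝[>] 0)
    ((oseg_ray_tendsto q n).mono_left nhdsWithin_le_nhds)
    (by filter_upwards [self_mem_nhdsWithin] with τ hτ using h τ hτ)

theorem IsConvexPolygon.mem_of_near {A P : Set Plane} (hA : IsConvexPolygon A) {v q : Plane} {ε : ℝ}
    (h : Metric.ball v ε ∩ P ⊆ interior A) (hq : q ∈ Metric.ball v ε) (hqP : q ∈ closure P) :
    q ∈ A := by
  rw [← hA.closure_interior]
  exact closure_mono h (Metric.isOpen_ball.inter_closure ⟨hq, hqP⟩)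

theorem seg_subset_union_base (v e : Plane) (α β : ℝ) :
    segment ℝ (v + α • e) (v + β • e) ⊆ segment ℝ (v + α • e) v ∪ segment ℝ v (v + β • e) := by
  have hv : v = v + (0 : ℝ) • e := by simp
  have key : ∀ {α β γ : ℝ}, α ≤ γ → γ ≤ β → v + γ • e ∈
      segment ℝ (v + α • e) v ∪ segment ℝ v (v + β • e) := by
    intro α β γ h1 h2
    rcases le_total γ 0 with h | h
    · left
      have := add_smul_mem_seg (p := v) (d := e) h1 h
      rwa [← hv] at this
    · right
      have := add_smul_mem_seg (p := v) (d := e) h h2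
      rwa [← hv] at this
  intro z hz
  rcases le_total α β with h | h
  · obtain ⟨γ, h1, h2, rfl⟩ := mem_seg_add_smul h hz
    exact key h1 h2
  · rw [segment_symm] at hz
    obtain ⟨γ, h1, h2, rfl⟩ := mem_seg_add_smul h hz
    have := key h1 h2
    rwa [union_comm, segment_symm ℝ v (v + α • e), segment_symm ℝ (v + β • e) v] at this

namespace TTessellation

variable {D : Set Plane} {T : TTessellation D}

/-- The configuration of a flip which deletes the edge `[v, b]` at the end `b` of the internal
segment `[a, b]` and extends the segment arriving at `v` in the direction `-e` by a new edge, up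
to the point `x`. -/
structure FlipData (T : TTessellation D) (a b v x d e : Plane) (κ ξ : ℝ) : Prop where
  seg : T.IsInternalSegment (segment ℝ a b)
  mem : v ∈ openSegment ℝ a b
  edge : T.IsEdge (segment ℝ v b)
  tee : IsTeeAt T.skeleton v d e
  kappa : κ ≠ 0
  hb : b = v + κ • d
  xi : 0 < ξ
  hx : x = v - ξ • e
  x_mem : x ∈ T.skeleton
  disj : Disjoint (openSegment ℝ v x) T.skeleton

namespace FlipData

variable {a b v x d e : Plane} {κ ξ : ℝ}

theorem v_mem_interior (F : FlipData T a b v x d e κ ξ) (hD : IsConvexPolygon D) : v ∈ interior D :=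
  mem_interior_of_edge hD F.seg F.mem

theorem sub_eq (F : FlipData T a b v x d e κ ξ) : b - v = κ • d := by rw [F.hb]; module

theorem d_ne (F : FlipData T a b v x d e κ ξ) : d ≠ 0 := ne_zero_left_of_cross F.tee.1.ne'

theorem e_ne (F : FlipData T a b v x d e κ ξ) : e ≠ 0 := ne_zero_right_of_cross F.tee.1.ne'

theorem cross_x (F : FlipData T a b v x d e κ ξ) : cross d (x - v) = -(ξ * cross d e) := by
  rw [F.hx, show v - ξ • e - v = (-ξ) • e by module, cross_smul_right]; ring

theorem seg_x_line (F : FlipData T a b v x d e κ ξ) {z : Plane} (hz : z ∈ segment ℝ v x) :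
    ∃ τ : ℝ, 0 ≤ τ ∧ τ ≤ ξ ∧ z = v - τ • e := by
  obtain ⟨σ, h0, h1, rfl⟩ := mem_seg.1 hz
  refine ⟨σ * ξ, mul_nonneg h0 F.xi.le, by nlinarith [F.xi], ?_⟩
  rw [F.hx]; module

theorem mem_seg_x (F : FlipData T a b v x d e κ ξ) {τ : ℝ} (h0 : 0 ≤ τ) (h1 : τ ≤ ξ) :
    v - τ • e ∈ segment ℝ v x := by
  refine mem_seg.2 ⟨τ / ξ, div_nonneg h0 F.xi.le, (div_le_one F.xi).2 h1, ?_⟩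
  have : τ • e = (τ / ξ * ξ) • e := by rw [div_mul_cancel₀ _ F.xi.ne']
  rw [F.hx, this]; module

theorem mem_oseg_x (F : FlipData T a b v x d e κ ξ) {τ : ℝ} (h0 : 0 < τ) (h1 : τ < ξ) :
    v - τ • e ∈ openSegment ℝ v x := by
  refine mem_oseg.2 ⟨τ / ξ, div_pos h0 F.xi, (div_lt_one F.xi).2 h1, ?_⟩
  have : τ • e = (τ / ξ * ξ) • e := by rw [div_mul_cancel₀ _ F.xi.ne']
  rw [F.hx, this]; module

theorem cross_d_of_mem_seg_b (F : FlipData T a b v x d e κ ξ) {z : Plane}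
    (hz : z ∈ segment ℝ v b) : cross d (z - v) = 0 := by
  obtain ⟨σ, -, -, rfl⟩ := mem_seg.1 hz
  rw [add_sub_cancel_left, F.sub_eq, cross_smul_right, cross_smul_right, cross_self]; simp

theorem eq_v_of_mem (F : FlipData T a b v x d e κ ξ) {z : Plane} (hz : z ∈ segment ℝ v x)
    (hd : cross d (z - v) = 0) : z = v := by
  obtain ⟨τ, -, -, rfl⟩ := F.seg_x_line hz
  rw [show v - τ • e - v = (-τ) • e by module, cross_smul_right] at hd
  have h := (mul_eq_zero.1 hd).resolve_right F.tee.1.ne'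
  rw [neg_eq_zero.1 h]; simp

theorem disjoint_oseg (F : FlipData T a b v x d e κ ξ) :
    Disjoint (segment ℝ v x) (openSegment ℝ v b) := disjoint_left.2 fun z hz hz' => by
  have := F.eq_v_of_mem hz (F.cross_d_of_mem_seg_b (openSegment_subset_segment ℝ _ _ hz'))
  rw [this] at hz'
  exact left_notMem_oseg F.edge.disjoint.1 hz'

theorem flipSkeleton_disjoint (F : FlipData T a b v x d e κ ξ) :
    Disjoint (flipSkeleton T.skeleton v b x) (openSegment ℝ v b) :=
  disjoint_union_left.2 ⟨disjoint_sdiff_left, F.disjoint_oseg⟩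

/-- The cell on the other side of `[a, b]`, into which the segment is extended. -/
theorem exists_far_cell (F : FlipData T a b v x d e κ ξ) (hD : IsConvexPolygon D) :
    ∃ C ∈ T.cells, (∃ ε : ℝ, 0 < ε ∧ Metric.ball v ε ∩ {z | 0 < cross (-d) (z - v)} ⊆ interior C) ∧
      segment ℝ v b ⊆ C ∧ C ⊆ leftOf (-d) v ∧ openSegment ℝ v x ⊆ interior C ∧
      C ∩ {z | cross e (z - v) = 0} = segment ℝ v x := by
  have hde := F.tee.1
  -- On the side of a tee opposite to its stem there is locally no skeleton.
  obtain ⟨C, hC, ε, hε, hsub⟩ := exists_cell_near (F.v_mem_interior hD) (convex_cross_pos (-d) v)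
    (mem_closure_cross_pos (neg_ne_zero.2 F.d_ne) (by rw [sub_self, cross_zero_right])) (by
      filter_upwards [F.tee.2] with z hz hzK h
      have h : 0 < cross (-d) (z - v) := h
      rw [cross_neg_left] at h
      rcases hz.1 hzK with h' | h' <;> linarith)
  have hP := T.isConvexPolygon C hC
  obtain ⟨δ, hδ, H⟩ := exists_small (d := b - v) (Metric.ball_mem_nhds v hε)
  have hmemC : ∀ q ∈ Metric.ball v ε, cross d (q - v) = 0 → q ∈ C := fun q hq hqd =>
    hP.mem_of_near hsub hq (mem_closure_cross_pos (neg_ne_zero.2 F.d_ne)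
      (by rw [cross_neg_left, hqd, neg_zero]))
  have hvC : v ∈ C := hmemC v (Metric.mem_ball_self hε) (by rw [sub_self, cross_zero_right])
  obtain ⟨δ', hδ', H'⟩ := exists_small (d := e) (Metric.ball_mem_nhds v hε)
  have hz : ∀ τ : ℝ, 0 < τ → τ ≤ δ' → v - τ • e ∈ interior C := by
    intro τ h0 h1
    have hb := H' (-τ) (by rw [abs_neg, abs_of_pos h0]; exact h1)
    rw [neg_smul, ← sub_eq_add_neg] at hb
    refine hsub ⟨hb, ?_⟩
    change 0 < cross (-d) (v - τ • e - v)
    rw [show v - τ • e - v = (-τ) • e by module, cross_smul_right, cross_neg_left]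
    nlinarith
  have hoC : openSegment ℝ v x ⊆ interior C := by
    refine T.subset_interior_of_meets (convex_openSegment v x).isPreconnected F.disj hC
      ⟨v - (min δ' (ξ / 2)) • e, F.mem_oseg_x (lt_min hδ' (by linarith [F.xi]))
        ((min_le_right _ _).trans_lt (by linarith [F.xi])),
        hz _ (lt_min hδ' (by linarith [F.xi])) (min_le_left _ _)⟩
  have hCd : C ⊆ leftOf (-d) v := by
    obtain ⟨r, hr, Hr⟩ := F.tee.exists_small
    rcases T.one_side hC hvC F.d_ne ⟨r, hr, fun τ hτ => (Hr τ hτ).1⟩ with h | h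
    · exfalso
      have h1 : 0 ≤ cross d (v - δ' • e - v) := h (interior_subset (hz δ' hδ' le_rfl))
      rw [show v - δ' • e - v = (-δ') • e by module, cross_smul_right] at h1
      nlinarith
    · exact h
  refine ⟨C, hC, ⟨ε, hε, hsub⟩, ?_, hCd, hoC, ?_⟩
  · have hm : 0 < min δ (1 / 2) := lt_min hδ (by norm_num)
    refine segment_subset_cell hC F.edge (p := v + (min δ (1 / 2)) • (b - v))
      (mem_oseg.2 ⟨_, hm, (min_le_right _ _).trans_lt (by norm_num), rfl⟩)
      (hmemC _ (H _ (by rw [abs_of_pos hm]; exact min_le_left _ _)) ?_)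
    rw [add_sub_cancel_left, F.sub_eq, cross_smul_right, cross_smul_right, cross_self]; simp
  · refine subset_antisymm ?_ ?_
    · rintro z ⟨hzC, hze⟩
      have hze : cross e (z - v) = 0 := hze
      obtain ⟨τ, hτ⟩ := exists_smul_of_cross_eq_zero F.e_ne hze
      have hzv : z = v + τ • e := by rw [← hτ]; abel
      have h1 : 0 ≤ cross (-d) (z - v) := hCd hzC
      rw [hτ, cross_neg_left, cross_smul_right] at h1
      have h2 : τ ≤ 0 := by
        by_contra! h
        nlinarith [mul_pos h hde]
      rw [show z = v - (-τ) • e by rw [hzv]; module]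
      refine F.mem_seg_x (by linarith) ?_
      -- A point of `C` beyond `x` would make `x` interior to `C`, although `x` is in the skeleton.
      by_contra! h3
      have hw := hoC (F.mem_oseg_x (τ := ξ / 2) (by linarith [F.xi]) (by linarith [F.xi]))
      have hxo : x ∈ openSegment ℝ (v - (ξ / 2) • e) z := by
        have := add_smul_mem_oseg (p := v) (d := -e) (α := ξ / 2) (β := ξ) (γ := -τ)
          (by linarith [F.xi]) h3
        rw [F.hx, hzv]
        convert this using 2 <;> module
      exact disjoint_left.1 (T.disjoint_interior_skeleton hC)
        (hP.convex.openSegment_interior_self_subset_interior hw hzC hxo) F.x_mem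
    · intro z hz'
      refine ⟨?_, ?_⟩
      · rcases mem_seg_iff_oseg.1 hz' with rfl | rfl | h
        · exact hvC
        · have h := closure_mono (hoC.trans interior_subset)
            (segment_subset_closure_openSegment hz')
          rwa [hP.isClosed.closure_eq] at h
        · exact interior_subset (hoC h)
      · obtain ⟨τ, -, -, rfl⟩ := F.seg_x_line hz'
        change cross e _ = 0
        rw [show v - τ • e - v = (-τ) • e by module, cross_smul_right, cross_self, mul_zero]

/-- The cell between the edge `[v, b]` and the segment arriving at `v`. -/
theorem exists_near_cell (F : FlipData T a b v x d e κ ξ) (hD : IsConvexPolygon D) :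
    ∃ A ∈ T.cells, segment ℝ v b ⊆ A ∧ A ⊆ leftOf d v ∧ A ⊆ leftOf ((-κ) • e) v ∧
      ∃ z ∈ A, 0 < cross d (z - v) := by
  have hde := F.tee.1
  have hk2 : 0 < κ * κ := mul_self_pos.2 F.kappa
  -- The sector between the stem and `[v, b]`. As `b - v = κ • d` with `κ` of either sign, the
  -- factor `-κ` selects the side of the stem which contains `b`.
  let P : Set Plane := {z | 0 < cross d (z - v)} ∩ {z | 0 < cross ((-κ) • e) (z - v)}
  have hP : Convex ℝ P := (convex_cross_pos d v).inter (convex_cross_pos _ v)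
  have hform : ∀ σ ρ : ℝ, cross d (v + σ • (b - v) + ρ • e - v) = ρ * cross d e ∧
      cross ((-κ) • e) (v + σ • (b - v) + ρ • e - v) = σ * (κ * κ * cross d e) := by
    intro σ ρ
    rw [show v + σ • (b - v) + ρ • e - v = (σ * κ) • d + ρ • e by rw [F.sub_eq]; module]
    simp only [cross_add_right, cross_smul_right, cross_smul_left, cross_self]
    rw [cross_swap e d]
    exact ⟨by ring, by ring⟩
  have hmemP : ∀ σ ρ : ℝ, 0 < σ → 0 < ρ → v + σ • (b - v) + ρ • e ∈ P := fun σ ρ h1 h2 =>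
    ⟨by change 0 < cross _ _; rw [(hform σ ρ).1]; positivity,
      by change 0 < cross _ _; rw [(hform σ ρ).2]; positivity⟩
  have hclP : ∀ σ ρ : ℝ, 0 ≤ σ → 0 ≤ ρ → v + σ • (b - v) + ρ • e ∈ closure P := by
    intro σ ρ h1 h2
    refine mem_closure_of_ray (n := (b - v) + e) fun τ hτ => ?_
    have := hmemP (σ + τ) (ρ + τ) (by linarith) (by linarith)
    rwa [show v + (σ + τ) • (b - v) + (ρ + τ) • e
      = v + σ • (b - v) + ρ • e + τ • (b - v + e) by module] at this
  have hvP : v ∈ closure P := by simpa using hclP 0 0 le_rfl le_rfl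
  obtain ⟨A, hA, ε, hε, hsub⟩ := exists_cell_near (F.v_mem_interior hD) hP hvP (by
      filter_upwards [F.tee.2] with z hz hzK h
      obtain ⟨h1, h2⟩ := h
      have h1 : 0 < cross d (z - v) := h1
      have h2 : 0 < cross ((-κ) • e) (z - v) := h2
      rcases hz.1 hzK with h' | h'
      · linarith
      · rw [cross_smul_left, h'.1, mul_zero] at h2; linarith)
  have hPA := T.isConvexPolygon A hA
  obtain ⟨δ₁, hδ₁, H₁⟩ := exists_small (d := b - v) (Metric.ball_mem_nhds v hε)
  obtain ⟨δ₂, hδ₂, H₂⟩ := exists_small (d := e) (Metric.ball_mem_nhds v hε)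
  obtain ⟨δ₃, hδ₃, H₃⟩ := exists_small (d := b - v + e) (Metric.ball_mem_nhds v hε)
  obtain ⟨r, hr, Hr⟩ := F.tee.exists_small
  have hvA : v ∈ A := hPA.mem_of_near hsub (Metric.mem_ball_self hε) hvP
  obtain ⟨z, hzA, hz1, hz2⟩ : ∃ z ∈ A, 0 < cross d (z - v) ∧ 0 < cross ((-κ) • e) (z - v) := by
    have h1 := H₃ δ₃ (by rw [abs_of_pos hδ₃])
    have h2 := hmemP δ₃ δ₃ hδ₃ hδ₃
    rw [show v + δ₃ • (b - v) + δ₃ • e = v + δ₃ • (b - v + e) by module] at h2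
    exact ⟨_, interior_subset (hsub ⟨h1, h2⟩), h2.1, h2.2⟩
  refine ⟨A, hA, ?_, ?_, ?_, z, hzA, hz1⟩
  · have hm : 0 < min δ₁ (1 / 2) := lt_min hδ₁ (by norm_num)
    refine segment_subset_cell hA F.edge (p := v + (min δ₁ (1 / 2)) • (b - v))
      (mem_oseg.2 ⟨_, hm, (min_le_right _ _).trans_lt (by norm_num), rfl⟩)
      (hPA.mem_of_near hsub (H₁ _ (by rw [abs_of_pos hm]; exact min_le_left _ _)) ?_)
    simpa using hclP (min δ₁ (1 / 2)) 0 hm.le le_rfl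
  · rcases T.one_side hA hvA F.d_ne ⟨r, hr, fun τ hτ => (Hr τ hτ).1⟩ with h | h
    · exact h
    · exfalso
      have h1 : 0 ≤ cross (-d) (z - v) := h hzA
      rw [cross_neg_left] at h1
      linarith
  -- At `v` the skeleton contains only a half-line in the direction of `e`; `one_side` is therefore
  -- applied at the point `v + μ • e`, inside the stem.
  · have hm : 0 < min δ₂ (r / 2) := lt_min hδ₂ (by linarith)
    set μ := min δ₂ (r / 2)
    have hpA : v + μ • e ∈ A :=
      hPA.mem_of_near hsub (H₂ μ (by rw [abs_of_pos hm]; exact min_le_left _ _))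
        (by simpa using hclP 0 μ le_rfl hm.le)
    have hbase : ∀ (f : Plane) w, cross f e = 0 → cross f (w - (v + μ • e)) = cross f (w - v) := by
      intro f w hf
      rw [show w - (v + μ • e) = (w - v) - μ • e by abel, cross_sub_right, cross_smul_right, hf]
      ring
    have hge : cross ((-κ) • e) e = 0 := by rw [cross_smul_left, cross_self, mul_zero]
    have hK : ∃ δ > 0, ∀ τ : ℝ, |τ| ≤ δ → v + μ • e + τ • (-κ) • e ∈ T.skeleton := by
      refine ⟨μ / |κ|, div_pos hm (abs_pos.2 F.kappa), fun τ hτ => ?_⟩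
      rw [show v + μ • e + τ • (-κ) • e = v + (μ - τ * κ) • e by module]
      have h1 : |τ * κ| ≤ μ := by
        rw [abs_mul]; rwa [le_div_iff₀ (abs_pos.2 F.kappa)] at hτ
      have h2 := abs_le.1 h1
      have h3 : μ ≤ r / 2 := min_le_right _ _
      exact (Hr _ (by rw [abs_of_nonneg (by linarith)]; linarith)).2 (by linarith)
    rcases T.one_side hA hpA (smul_ne_zero (neg_ne_zero.2 F.kappa) F.e_ne) hK with h | h
    · intro w hw
      have h1 : 0 ≤ cross ((-κ) • e) (w - (v + μ • e)) := h hw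
      rwa [hbase _ _ hge] at h1
    · exfalso
      have h1 : 0 ≤ cross (-((-κ) • e)) (z - (v + μ • e)) := h hzA
      rw [cross_neg_left, hbase _ _ hge] at h1
      linarith

end FlipData

end TTessellation

end TTess

namespace TTess.TTessellation.FlipData

/-! ### The result of a flip is a T-tessellation -/

variable {D : Set Plane} {T : TTessellation D} {a b v x d e : Plane} {κ ξ : ℝ}

theorem oseg_subset (F : FlipData T a b v x d e κ ξ) : openSegment ℝ v b ⊆ openSegment ℝ a b :=
  openSegment_subset_of_mem F.mem

theorem exists_sub_smul (F : FlipData T a b v x d e κ ξ) :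
    ∃ ρ : ℝ, 1 < ρ ∧ b - a = ρ • (b - v) := by
  obtain ⟨τ, h0, h1, hv⟩ := mem_oseg.1 F.mem
  refine ⟨1 / (1 - τ), ?_, ?_⟩
  · rw [lt_div_iff₀ (by linarith)]; linarith
  · have : b - v = (1 - τ) • (b - a) := by rw [hv]; module
    rw [this, smul_smul, one_div, inv_mul_cancel₀ (by linarith), one_smul]

/-- In terms of cells, a flip cuts the far cell along the prolonged stem and glues the piece
adjacent to `[v, b]` to the near cell. -/
theorem exists_cells (F : FlipData T a b v x d e κ ξ) (hD : IsConvexPolygon D) :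
    ∃ T₂ : Tessellation D, T₂.skeleton = flipSkeleton T.skeleton v b x := by
  obtain ⟨C, hC, ⟨ε, hε, hsub⟩, hbC, hCd, -, hline⟩ := F.exists_far_cell hD
  obtain ⟨A, hA, hbA, hAd, hAg, zA, hzA, hzA'⟩ := F.exists_near_cell hD
  have hde := F.tee.1
  have hk2 : 0 < κ * κ := mul_self_pos.2 F.kappa
  have hg : (-κ) • e ≠ 0 := smul_ne_zero (neg_ne_zero.2 F.kappa) F.e_ne
  have hnotC : ∀ {C' : Set Plane}, C' ⊆ C → A ≠ C' := by
    rintro C' h rfl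
    have : 0 ≤ cross (-d) (zA - v) := hCd (h hzA)
    rw [cross_neg_left] at this; linarith
  -- Points of the far cell in the direction `s • (b - v) - e` from `v`; the values `1` and `-1` of
  -- `s` give the two sides of the cut.
  have near : ∀ s : ℝ, ∃ z ∈ interior C, ∃ τ : ℝ, 0 < τ ∧
      cross ((-κ) • e) (z - v) = τ * s * (κ * κ * cross d e) := by
    intro s
    obtain ⟨δ, hδ, H⟩ := exists_small (d := s • (b - v) - e) (Metric.ball_mem_nhds v hε)
    refine ⟨v + δ • (s • (b - v) - e), hsub ⟨H δ (by rw [abs_of_pos hδ]), ?_⟩, δ, hδ, ?_⟩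
    · change 0 < cross (-d) (v + δ • (s • (b - v) - e) - v)
      rw [add_sub_cancel_left, F.sub_eq]
      simp only [cross_sub_right, cross_smul_right, cross_neg_left, cross_self]
      nlinarith [mul_pos hδ hde]
    · rw [add_sub_cancel_left, F.sub_eq]
      simp only [cross_sub_right, cross_smul_right, cross_smul_left, cross_self]
      rw [cross_swap e d]; ring
  have hpos : ∃ z ∈ interior C, 0 < cross ((-κ) • e) (z - v) := by
    obtain ⟨z, hz, τ, hτ, h⟩ := near 1
    exact ⟨z, hz, by rw [h]; positivity⟩
  have hneg : ∃ z ∈ interior C, 0 < cross (-((-κ) • e)) (z - v) := by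
    obtain ⟨z, hz, τ, hτ, h⟩ := near (-1)
    refine ⟨z, hz, ?_⟩
    rw [cross_neg_left, h]
    have : 0 < τ * (κ * κ * cross d e) := by positivity
    linarith
  obtain ⟨T₁, hcells, hT₁⟩ := T.exists_splitCell hC hg hpos hneg
  have hl : C ∩ {z | cross ((-κ) • e) (z - v) = 0} = segment ℝ v x := by
    rw [← hline]
    ext z
    simp only [mem_inter_iff, mem_ofPred_eq, cross_smul_left, mul_eq_zero, neg_eq_zero, F.kappa,
      false_or]
  rw [hl] at hT₁
  have hA₁ : A ∈ T₁.cells := by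
    rw [hcells]; exact Or.inl ⟨hA, fun h => hnotC subset_rfl (mem_singleton_iff.1 h)⟩
  have hC₁ : C ∩ leftOf ((-κ) • e) v ∈ T₁.cells := by rw [hcells]; exact Or.inr (Or.inl rfl)
  have hcb : cross ((-κ) • e) (b - v) = κ * κ * cross d e := by
    rw [F.sub_eq, cross_smul_left, cross_smul_right, cross_swap e d]; ring
  have hbC₁ : segment ℝ v b ⊆ C ∩ leftOf ((-κ) • e) v := fun z hz => ⟨hbC hz, by
    obtain ⟨σ, h0, -, rfl⟩ := mem_seg.1 hz
    change 0 ≤ cross _ _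
    rw [add_sub_cancel_left, cross_smul_right, hcb]
    positivity⟩
  obtain ⟨gb, hgb, hgb'⟩ := exists_halfplane_at_end hD F.seg
  obtain ⟨p, hp⟩ := oseg_nonempty v b
  have hpo := F.oseg_subset hp
  have hps := openSegment_subset_segment ℝ _ _ hp
  obtain ⟨ρ, hρ, hba⟩ := F.exists_sub_smul
  obtain ⟨T₂, hT₂⟩ := T₁.exists_mergeCells hA₁ hC₁ (hnotC inter_subset_left) F.d_ne
    (by rw [F.sub_eq, cross_smul_right, cross_self, mul_zero])
    (by rw [hcb]; positivity)
    (by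
      rw [show a - b = ρ • (v - b) by rw [← neg_sub b a, hba]; module, cross_smul_right] at hgb
      exact pos_of_mul_pos_right hgb (by linarith))
    hbA hbC₁ hAd (inter_subset_left.trans hCd) (union_subset hAg inter_subset_right)
    (union_subset (hgb' A hA (hbA (right_mem_segment ℝ _ _)) ⟨p, hbA hps, hpo⟩)
      (inter_subset_left.trans
        (hgb' C hC (hbC (right_mem_segment ℝ _ _)) ⟨p, hbC hps, hpo⟩)))
  refine ⟨T₂, ?_⟩
  rw [hT₂, hT₁, union_sdiff_distrib, F.disjoint_oseg.sdiff_eq_left]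
  rfl

/-- The roles are exchanged: the stem and its prolongation become the line, and the rest of `[a, b]`
becomes the stem, pointing away from `b`. The factors `κ` provide the orientation. -/
theorem tee_at_v (F : FlipData T a b v x d e κ ξ) :
    IsTeeAt (flipSkeleton T.skeleton v b x) v (κ • e) ((-κ) • d) := by
  have hde := F.tee.1
  have hk2 : 0 < κ * κ := mul_self_pos.2 F.kappa
  have hcr : cross (κ • e) ((-κ) • d) = κ * κ * cross d e := by
    rw [cross_smul_left, cross_smul_right, cross_swap e d]; ring
  refine ⟨by rw [hcr]; positivity, ?_⟩
  filter_upwards [F.tee.2, eventually_line v F.d_ne (abs_pos.2 F.kappa),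
    eventually_line v F.e_ne F.xi] with z h1 h2 h3
  simp only [flipSkeleton, mem_union, Set.mem_sdiff, h1, cross_smul_left, mul_eq_zero, F.kappa,
    neg_eq_zero, false_or]
  have hvb : ∀ τ : ℝ, v + τ • d ∈ openSegment ℝ v b ↔ 0 < τ / κ ∧ τ / κ < 1 := by
    intro τ
    rw [mem_oseg]
    constructor
    · rintro ⟨σ, k0, k1, h⟩
      rw [F.sub_eq, smul_smul] at h
      have : (τ - σ * κ) • d = 0 := by rw [sub_smul, sub_eq_zero]; exact add_left_cancel h
      have h := (smul_eq_zero.1 this).resolve_right F.d_ne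
      have : τ / κ = σ := by rw [div_eq_iff F.kappa]; linarith
      rw [this]; exact ⟨k0, k1⟩
    · rintro ⟨k0, k1⟩
      exact ⟨τ / κ, k0, k1, by rw [F.sub_eq, smul_smul, div_mul_cancel₀ _ F.kappa]⟩
  constructor
  · rintro (⟨h | h, hn⟩ | h)
    · right
      refine ⟨h, ?_⟩
      obtain ⟨τ, hτ, rfl⟩ := h2 h
      rw [add_sub_cancel_left, cross_smul_right, cross_swap e d]
      have : ¬ 0 < τ / κ := fun h0 => hn ((hvb τ).2 ⟨h0, by
        have := (abs_lt.1 (show |τ / κ| < 1 by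
          rw [abs_div, div_lt_one (abs_pos.2 F.kappa)]; exact hτ)).2
        exact this⟩)
      have h4 : κ * τ ≤ 0 := by
        have : τ = τ / κ * κ := by rw [div_mul_cancel₀ _ F.kappa]
        rw [this]; nlinarith
      nlinarith
    · exact Or.inl h.1
    · left
      obtain ⟨τ, -, -, rfl⟩ := F.seg_x_line h
      rw [show v - τ • e - v = (-τ) • e by module, cross_smul_right, cross_self, mul_zero]
  · rintro (h | ⟨h, h'⟩)
    · obtain ⟨τ, hτ, rfl⟩ := h3 h
      rcases le_total 0 τ with h0 | h0
      · left
        refine ⟨Or.inr ⟨h, ?_⟩, fun hn => ?_⟩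
        · rw [add_sub_cancel_left, cross_smul_right]; positivity
        · have h5 := F.cross_d_of_mem_seg_b (openSegment_subset_segment ℝ _ _ hn)
          rw [add_sub_cancel_left, cross_smul_right] at h5
          rw [(mul_eq_zero.1 h5).resolve_right hde.ne', zero_smul, add_zero] at hn
          exact left_notMem_oseg F.edge.disjoint.1 hn
      · right
        rw [show v + τ • e = v - (-τ) • e by module]
        exact F.mem_seg_x (by linarith) (by linarith [(abs_lt.1 hτ).1])
    · left
      refine ⟨Or.inl h, fun hn => ?_⟩
      obtain ⟨τ, hτ, rfl⟩ := h2 h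
      rw [hvb] at hn
      rw [add_sub_cancel_left, cross_smul_right, cross_swap e d] at h'
      have : 0 < κ * τ := by
        have : τ = τ / κ * κ := by rw [div_mul_cancel₀ _ F.kappa]
        rw [this]; nlinarith [mul_pos hn.1 hk2]
      nlinarith [mul_pos this hde]

theorem flat_on_oseg (F : FlipData T a b v x d e κ ξ) (hD : IsConvexPolygon D) {q : Plane}
    (hq : q ∈ openSegment ℝ v x) : IsFlatAt (flipSkeleton T.skeleton v b x) q e := by
  obtain ⟨C, hC, -, -, -, hoC, hline⟩ := F.exists_far_cell hD
  refine ⟨F.e_ne, ?_⟩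
  have hqe : cross e (q - v) = 0 := (hline.ge (openSegment_subset_segment ℝ _ _ hq)).2
  filter_upwards [isOpen_interior.mem_nhds (hoC hq)] with z hz
  rw [cross_sub_base hqe]
  have hzK := disjoint_left.1 (T.disjoint_interior_skeleton hC) hz
  constructor
  · rintro (h | h)
    · exact absurd h.1 hzK
    · exact (hline.ge h).2
  · exact fun h => Or.inr (hline.le ⟨interior_subset hz, h⟩)

theorem x_notMem_seg_b (F : FlipData T a b v x d e κ ξ) : x ∉ segment ℝ v b := fun h => by
  have := F.cross_d_of_mem_seg_b h
  rw [F.cross_x] at this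
  nlinarith [mul_pos F.xi F.tee.1]

/-- Reduces to `tee_at_chord_end`, with the midpoint of `[v, x]` as the point inside the far cell.
It is here that `x` must not be a vertex. -/
theorem tee_at_x (F : FlipData T a b v x d e κ ξ) (hD : IsConvexPolygon D) (hxV : x ∉ T.vertices) :
    ∃ f g, IsTeeAt (flipSkeleton T.skeleton v b x) x f g := by
  obtain ⟨C, hC, -, -, -, hoC, hline⟩ := F.exists_far_cell hD
  have hP := T.isConvexPolygon C hC
  have hq := hoC (F.mem_oseg_x (τ := ξ / 2) (by linarith [F.xi]) (by linarith [F.xi]))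
  have hx : x = v - (ξ / 2) • e + (ξ / 2) • (-e) := by rw [F.hx]; module
  have hxf : x ∈ frontier C := hP.mem_frontier.2 ⟨(hline.ge (right_mem_segment ℝ _ _)).1,
    fun h => disjoint_left.1 (T.disjoint_interior_skeleton hC) h F.x_mem⟩
  obtain ⟨f, g, h⟩ := tee_at_chord_end hC hq (f := -e) (β := ξ / 2) (by linarith [F.xi])
    (by rwa [← hx]) (by rw [← hx]; exact hxV)
  rw [← hx] at h
  refine ⟨f, g, h.congr ?_⟩
  have hl : C ∩ {z | cross (-e) (z - (v - (ξ / 2) • e)) = 0} = segment ℝ v x := by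
    rw [← hline]
    ext z
    simp only [mem_inter_iff, mem_ofPred_eq]
    rw [show z - (v - (ξ / 2) • e) = (z - v) + (ξ / 2) • e by abel, cross_add_right,
      cross_smul_right, cross_neg_left, cross_neg_left, cross_self]
    simp
  rw [hl]
  filter_upwards [eventually_notMem_of_isClosed (isClosed_seg v b) F.x_notMem_seg_b] with z hz
  have : z ∉ openSegment ℝ v b := fun h => hz (openSegment_subset_segment ℝ _ _ h)
  simp only [flipSkeleton, mem_union, Set.mem_sdiff, this, not_false_eq_true, and_true]

/-- Germs change only on `[v, x]` and `[v, b]`. At `b`, unless it is a corner of `D`, the stem of a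
tee has been removed and the point becomes flat. -/
theorem germs (F : FlipData T a b v x d e κ ξ) (hD : IsConvexPolygon D) (hxV : x ∉ T.vertices)
    {q : Plane} (hq : q ∈ flipSkeleton T.skeleton v b x) (hqD : q ∉ D.extremePoints ℝ) :
    (∃ f, IsFlatAt (flipSkeleton T.skeleton v b x) q f) ∨
      ∃ f g, IsTeeAt (flipSkeleton T.skeleton v b x) q f g := by
  by_cases h1 : q ∈ segment ℝ v x
  · rcases mem_seg_iff_oseg.1 h1 with rfl | rfl | h
    · exact Or.inr ⟨_, _, F.tee_at_v⟩
    · exact Or.inr (F.tee_at_x hD hxV)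
    · exact Or.inl ⟨_, F.flat_on_oseg hD h⟩
  have ev1 := eventually_notMem_of_isClosed (isClosed_seg v x) h1
  have hqK : q ∈ T.skeleton \ openSegment ℝ v b := hq.resolve_right h1
  by_cases h2 : q ∈ segment ℝ v b
  · rcases mem_seg_iff_oseg.1 h2 with rfl | rfl | h
    · exact absurd (left_mem_segment ℝ _ _) h1
    · obtain ⟨f, g, htee, μ, hμ, hμg⟩ := tee_at_end F.seg.1 hqD
      left
      obtain ⟨ρ, hρ, hba⟩ := F.exists_sub_smul
      have hvq : v - q = (μ / ρ) • g := by
        have h3 : ρ • (v - q) = μ • g := by rw [← hμg, ← neg_sub q a, hba]; module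
        rw [div_eq_inv_mul, mul_smul, ← h3, inv_smul_smul₀ (by linarith)]
      refine ⟨f, (htee.flat_of_remove (div_pos hμ (by linarith)) hvq).congr ?_⟩
      filter_upwards [ev1] with z hz
      exact or_iff_left hz
    · exact absurd h hqK.2
  · have hev : ∀ᶠ z in 𝓝 q, (z ∈ flipSkeleton T.skeleton v b x ↔ z ∈ T.skeleton) := by
      filter_upwards [ev1, eventually_notMem_of_isClosed (isClosed_seg v b) h2] with z hz hz'
      have : z ∉ openSegment ℝ v b := fun h => hz' (openSegment_subset_segment ℝ _ _ h)
      simp only [flipSkeleton, mem_union, Set.mem_sdiff, this, hz, not_false_eq_true, and_true, or_false]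
    rcases T.isFlatAt_or_isTeeAt hqK.1 hqD with ⟨f, h⟩ | ⟨f, g, h⟩
    · exact Or.inl ⟨f, h.congr hev⟩
    · exact Or.inr ⟨f, g, h.congr hev⟩

theorem segs_a (F : FlipData T a b v x d e κ ξ) : segment ℝ a v ⊆ segment ℝ a b :=
  (convex_segment a b).segment_subset (left_mem_segment ℝ _ _)
    (openSegment_subset_segment ℝ _ _ F.mem)

theorem mem_seg_a_or (F : FlipData T a b v x d e κ ξ) {z : Plane} (hz : z ∈ segment ℝ a b)
    (hzo : z ∉ openSegment ℝ v b) : z ∈ segment ℝ a v ∨ z = b := by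
  rcases segment_subset_union_of_mem (openSegment_subset_segment ℝ _ _ F.mem) hz with h | h
  · exact Or.inl h
  · rcases mem_seg_iff_oseg.1 h with rfl | rfl | h
    · exact Or.inl (right_mem_segment ℝ _ _)
    · exact Or.inr rfl
    · exact absurd h hzo

theorem oseg_subset_of_mem (F : FlipData T a b v x d e κ ξ) {z : Plane}
    (hz : z ∈ segment ℝ a v) : openSegment ℝ v b ⊆ segment ℝ z b := by
  obtain ⟨τ, h0, h1, hv⟩ := mem_oseg.1 F.mem
  obtain ⟨σ, k0, k1, rfl⟩ := mem_seg.1 hz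
  intro w hw
  obtain ⟨ρ, l0, l1, rfl⟩ := mem_oseg.1 hw
  have hστ : σ * τ ≤ τ := mul_le_of_le_one_left h0.le k1
  have e1 : a + σ • (v - a) = a + (σ * τ) • (b - a) := by rw [hv]; module
  have e2 : v + ρ • (b - v) = a + (τ + ρ * (1 - τ)) • (b - a) := by rw [hv]; module
  have e3 : b = a + (1 : ℝ) • (b - a) := by module
  have := add_smul_mem_seg (p := a) (d := b - a) (α := σ * τ) (β := τ + ρ * (1 - τ)) (γ := 1)
    (by nlinarith) (by nlinarith)
  rwa [← e1, ← e2, ← e3] at this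

theorem disjoint_seg_a (F : FlipData T a b v x d e κ ξ) :
    Disjoint (segment ℝ a v) (openSegment ℝ v b) := disjoint_left.2 fun z hz hz' => by
  obtain ⟨τ, h0, h1, hv⟩ := mem_oseg.1 F.mem
  obtain ⟨σ, k0, k1, rfl⟩ := mem_seg.1 hz
  obtain ⟨ρ, l0, l1, h⟩ := mem_oseg.1 hz'
  have e1 : a + σ • (v - a) = a + (σ * τ) • (b - a) := by rw [hv]; module
  have e2 : v + ρ • (b - v) = a + (τ + ρ * (1 - τ)) • (b - a) := by rw [hv]; module
  rw [e1, e2, add_right_inj] at h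
  have : (τ + ρ * (1 - τ) - σ * τ) • (b - a) = 0 := by rw [sub_smul, ← h, sub_self]
  rcases smul_eq_zero.1 this with h | h
  · have hστ : σ * τ ≤ τ := mul_le_of_le_one_left h0.le k1
    nlinarith [mul_pos l0 (show (0 : ℝ) < 1 - τ by linarith)]
  · exact F.seg.1.endpoints.1 (sub_eq_zero.1 h).symm

theorem sub_eq_smul (F : FlipData T a b v x d e κ ξ) : ∃ μ : ℝ, μ ≠ 0 ∧ b - a = μ • d := by
  obtain ⟨ρ, hρ, h⟩ := F.exists_sub_smul
  exact ⟨ρ * κ, mul_ne_zero (by linarith) F.kappa, by rw [h, F.sub_eq, smul_smul]⟩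

theorem core_ab (F : FlipData T a b v x d e κ ξ) (K : Set Plane) : core K (b - a) = core K d := by
  obtain ⟨μ, hμ, h⟩ := F.sub_eq_smul
  rw [h, core_smul hμ]

theorem cross_ab_iff (F : FlipData T a b v x d e κ ξ) (z : Plane) :
    cross (b - a) (z - a) = 0 ↔ cross d (z - v) = 0 := by
  obtain ⟨μ, hμ, h⟩ := F.sub_eq_smul
  have h1 := cross_eq_zero_of_mem_seg (openSegment_subset_segment ℝ _ _ F.mem)
  rw [← cross_sub_base h1 z, h, cross_smul_left, mul_eq_zero, or_iff_right hμ]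

theorem mem_seg_of_core (F : FlipData T a b v x d e κ ξ) {q : Plane} (hq : q ∈ core T.skeleton d)
    (hl : cross d (q - v) = 0) : q ∈ segment ℝ a b :=
  mem_segment_of_core F.seg.1 (by rwa [F.core_ab]) ((F.cross_ab_iff q).2 hl)

theorem flipSkeleton_subset :
    flipSkeleton T.skeleton v b x ⊆ T.skeleton ∪ segment ℝ v x :=
  union_subset_union_left _ sdiff_subset

theorem inter_seg_x_subsingleton (F : FlipData T a b v x d e κ ξ) {q δ : Plane}
    (h : cross e δ ≠ 0 ∨ cross e (q - v) ≠ 0) {τ : ℝ} :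
    (segment ℝ q (q + τ • δ) ∩ segment ℝ v x).Subsingleton := by
  refine (inter_line_subsingleton (f := e) (q := v) h).anti (inter_subset_inter_right _ ?_)
  intro z hz
  obtain ⟨σ, -, -, rfl⟩ := F.seg_x_line hz
  change cross e _ = 0
  rw [show v - σ • e - v = (-σ) • e by module, cross_smul_right, cross_self, mul_zero]

theorem seg_subset_skeleton (F : FlipData T a b v x d e κ ξ) {q δ : Plane}
    (h : cross e δ ≠ 0 ∨ cross e (q - v) ≠ 0) {τ : ℝ} (hτ : τ • δ ≠ 0)
    (hq : segment ℝ q (q + τ • δ) ⊆ flipSkeleton T.skeleton v b x) :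
    segment ℝ q (q + τ • δ) ⊆ T.skeleton :=
  segment_subset_of_subsingleton T.isClosed_skeleton (fun h' => hτ (by simpa using h'.symm))
    (hq.trans flipSkeleton_subset) (F.inter_seg_x_subsingleton h)

/-- The part of the new skeleton which lies on the line of `[a, b]`. -/
theorem mem_seg_a_of_core (F : FlipData T a b v x d e κ ξ) {q : Plane}
    (hq : q ∈ core (flipSkeleton T.skeleton v b x) d) (hl : cross d (q - v) = 0) :
    q ∈ segment ℝ a v := by
  obtain ⟨τ, hτ, hs⟩ := hq
  have hτd : τ • d ≠ 0 := smul_ne_zero hτ F.d_ne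
  have hK := F.seg_subset_skeleton (Or.inl (by rw [cross_swap, neg_ne_zero]; exact F.tee.1.ne')) hτd hs
  have key : ∀ w ∈ segment ℝ q (q + τ • d), w ∈ segment ℝ a v ∨ w = b := by
    intro w hw
    refine F.mem_seg_a_or (F.mem_seg_of_core (mem_core_of_mem_segment hτ hK hw) ?_)
      (disjoint_left.1 F.flipSkeleton_disjoint (hs hw))
    obtain ⟨σ, -, -, rfl⟩ := mem_seg.1 hw
    rw [show q + σ • (q + τ • d - q) - v = (q - v) + (σ * τ) • d by module, cross_add_right, hl,
      cross_smul_right, cross_self]; simp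
  rcases key q (left_mem_segment ℝ _ _) with h | rfl
  · exact h
  -- If `q` is the end `b`, the other end of its piece of the new skeleton is on `[a, v]`, so this
  -- piece contains the deleted edge.
  · exfalso
    have h1 := (key _ (right_mem_segment ℝ _ _)).resolve_right (fun h => hτd (by simpa using h))
    obtain ⟨p, hp⟩ := oseg_nonempty v q
    have := F.oseg_subset_of_mem h1 hp
    rw [segment_symm] at this
    exact disjoint_left.1 F.flipSkeleton_disjoint (hs this) hp

theorem core_stem (F : FlipData T a b v x d e κ ξ) : v ∈ core T.skeleton e := by
  obtain ⟨δ, hδ, H⟩ := F.tee.exists_small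
  refine ⟨δ, hδ.ne', fun z hz => ?_⟩
  obtain ⟨τ, h0, h1, rfl⟩ := mem_seg.1 hz
  rw [add_sub_cancel_left, smul_smul]
  exact (H _ (by rw [abs_of_nonneg (by positivity)]; nlinarith)).2 (by positivity)

/-- The part of the new skeleton which lies on the line of `[v, x]`. -/
theorem mem_core_or_of_core {q : Plane}
    (hq : q ∈ core (flipSkeleton T.skeleton v b x) e) :
    q ∈ core T.skeleton e ∨ q ∈ segment ℝ v x := by
  by_cases h : q ∈ segment ℝ v x
  · exact Or.inr h
  · exact Or.inl (core_mono sdiff_subset _ (mem_core_of_notMem (isClosed_seg v x) hq h))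

theorem seg_stem_subset (F : FlipData T a b v x d e κ ξ) {q : Plane}
    (hq : q ∈ core T.skeleton e) (hl : cross e (q - v) = 0) :
    segment ℝ q v ⊆ T.skeleton \ openSegment ℝ v b := by
  intro z hz
  refine ⟨T.alignedConvex e F.e_ne q hq v F.core_stem ?_ hz, fun hzo => ?_⟩
  · rw [← neg_sub, cross_neg_right, hl, neg_zero]
  · obtain ⟨k, hk⟩ := exists_smul_of_cross_eq_zero F.e_ne hl
    obtain ⟨σ, -, -, rfl⟩ := mem_seg.1 hz
    have hzv : q + σ • (v - q) = v + ((1 - σ) * k) • e := by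
      rw [show q = v + k • e by rw [← hk]; abel]; module
    have h1 := F.cross_d_of_mem_seg_b (openSegment_subset_segment ℝ _ _ hzo)
    rw [hzv, add_sub_cancel_left, cross_smul_right] at h1
    rw [hzv, (mul_eq_zero.1 h1).resolve_right F.tee.1.ne', zero_smul, add_zero] at hzo
    exact left_notMem_oseg F.edge.disjoint.1 hzo

/-- Three kinds of lines occur. On the line of the stem, everything is joined to `v`. On the line of
`[a, b]`, only `[a, v]` is left. On any other line, the core points are those of the old skeleton,
and crossing the deleted edge, which has no vertex inside, would force alignment with it. -/
theorem aligned (F : FlipData T a b v x d e κ ξ) :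
    AlignedConvex (flipSkeleton T.skeleton v b x) := by
  intro δ hδ q hq q' hq' hc
  by_cases ht : cross e δ = 0 ∧ cross e (q - v) = 0
  · obtain ⟨k, rfl⟩ := exists_smul_of_cross_eq_zero F.e_ne ht.1
    have hk : k ≠ 0 := by rintro rfl; simp at hδ
    rw [core_smul hk] at hq hq'
    rw [cross_smul_left] at hc
    have hc := (mul_eq_zero.1 hc).resolve_left hk
    have hl' : cross e (q' - v) = 0 := by
      rw [show q' - v = (q' - q) + (q - v) by abel, cross_add_right, hc, ht.2, add_zero]
    have key : ∀ r, r ∈ core (flipSkeleton T.skeleton v b x) e → cross e (r - v) = 0 →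
        segment ℝ r v ⊆ flipSkeleton T.skeleton v b x := by
      intro r hr hrl
      rcases mem_core_or_of_core hr with h | h
      · exact (F.seg_stem_subset h hrl).trans subset_union_left
      · exact ((convex_segment v x).segment_subset h (left_mem_segment ℝ _ _)).trans
          subset_union_right
    obtain ⟨α, hα⟩ := exists_smul_of_cross_eq_zero F.e_ne ht.2
    obtain ⟨β, hβ⟩ := exists_smul_of_cross_eq_zero F.e_ne hl'
    have h1 := key q hq ht.2
    have h2 := key q' hq' hl'
    rw [show q = v + α • e by rw [← hα]; abel] at h1 ⊢
    rw [show q' = v + β • e by rw [← hβ]; abel] at h2 ⊢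
    rw [segment_symm] at h2
    exact (seg_subset_union_base v e α β).trans (union_subset h1 h2)
  have ht1 : cross e δ ≠ 0 ∨ cross e (q - v) ≠ 0 := by tauto
  have ht2 : cross e δ ≠ 0 ∨ cross e (q' - v) ≠ 0 := by
    by_contra! hn
    obtain ⟨k, rfl⟩ := exists_smul_of_cross_eq_zero F.e_ne hn.1
    have hk : k ≠ 0 := by rintro rfl; simp at hδ
    rw [cross_smul_left] at hc
    have hc := (mul_eq_zero.1 hc).resolve_left hk
    refine ht ⟨hn.1, ?_⟩
    rw [show q - v = (q' - v) - (q' - q) by abel, cross_sub_right, hc, hn.2, sub_zero]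
  by_cases hs : cross d δ = 0 ∧ cross d (q - v) = 0
  · obtain ⟨k, rfl⟩ := exists_smul_of_cross_eq_zero F.d_ne hs.1
    have hk : k ≠ 0 := by rintro rfl; simp at hδ
    rw [core_smul hk] at hq hq'
    rw [cross_smul_left] at hc
    have hc := (mul_eq_zero.1 hc).resolve_left hk
    have hl' : cross d (q' - v) = 0 := by
      rw [show q' - v = (q' - q) + (q - v) by abel, cross_add_right, hc, hs.2, add_zero]
    intro z hz
    have hz' := (convex_segment a v).segment_subset (F.mem_seg_a_of_core hq hs.2)
      (F.mem_seg_a_of_core hq' hl') hz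
    exact Or.inl ⟨F.seg.1.endpoints.2.2.2 (F.segs_a hz'), disjoint_left.1 F.disjoint_seg_a hz'⟩
  have hcore : ∀ r ∈ core (flipSkeleton T.skeleton v b x) δ,
      (cross e δ ≠ 0 ∨ cross e (r - v) ≠ 0) → r ∈ core T.skeleton δ := by
    rintro r ⟨τ, hτ, h⟩ hr
    exact ⟨τ, hτ, F.seg_subset_skeleton hr (smul_ne_zero hτ hδ) h⟩
  have hzK := T.alignedConvex δ hδ q (hcore q hq ht1) q' (hcore q' hq' ht2) hc
  intro z hz
  refine Or.inl ⟨hzK hz, fun hzo => ?_⟩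
  have hne : ∀ w ∈ flipSkeleton T.skeleton v b x, z ≠ w := by
    rintro w hw rfl
    exact disjoint_left.1 F.flipSkeleton_disjoint hw hzo
  have hq1 := hne q (core_subset _ _ hq)
  have hq2 := hne q' (core_subset _ _ hq')
  have hqq : q' - q ≠ 0 := by
    intro h
    rw [sub_eq_zero] at h
    rw [h, segment_same] at hz
    exact hq1 (mem_singleton_iff.1 hz)
  have hed := F.edge.disjoint
  have hcr := cross_eq_zero_of_crossing hed.1 F.edge.subset_skeleton hzo
    (disjoint_left.1 hed.2.2.2 hzo) hzK (mem_oseg_of_ne hz hq1 hq2)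
  rw [F.sub_eq, cross_smul_left] at hcr
  have hcr := (mul_eq_zero.1 hcr).resolve_left F.kappa
  refine hs ⟨cross_eq_zero_trans hqq (by rw [cross_swap, hcr, neg_zero])
    (by rw [cross_swap, hc, neg_zero]), ?_⟩
  obtain ⟨σ, -, -, hσ⟩ := mem_seg.1 hz
  rw [show q - v = (z - v) - σ • (q' - q) by rw [hσ]; module, cross_sub_right, cross_smul_right, hcr,
    F.cross_d_of_mem_seg_b (openSegment_subset_segment ℝ _ _ hzo)]
  simp

theorem exists_flip (F : FlipData T a b v x d e κ ξ) (hD : IsConvexPolygon D)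
    (hxV : x ∉ T.vertices) :
    ∃ T₂ : TTessellation D, T₂.skeleton = flipSkeleton T.skeleton v b x := by
  obtain ⟨T₁, hT₁⟩ := F.exists_cells hD
  refine ⟨TTessellation.ofSkeleton hD T₁ ?_ ?_, hT₁⟩
  · rw [hT₁]; exact fun q hq hqD => F.germs hD hxV hq hqD
  · rw [hT₁]; exact F.aligned

/-- The segment which is extended by the flip. -/
theorem exists_stem (F : FlipData T a b v x d e κ ξ) :
    ∃ c, T.IsSegment (segment ℝ c v) ∧ ∃ γ : ℝ, 0 < γ ∧ c = v + γ • e := by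
  obtain ⟨δ, hδ, H⟩ := F.core_stem
  have hde : δ • e ≠ 0 := smul_ne_zero hδ F.e_ne
  obtain ⟨s, hs, hsub⟩ := T.exists_isSegment (x := v) (y := v + δ • e)
    (fun h => hde (by simpa using h.symm)) H
  obtain ⟨y, z, hyz, -, -, rfl, hK⟩ := hs.exists_endpoints
  have hline : ∀ w ∈ segment ℝ y z, ∃ τ : ℝ, w = v + τ • e := by
    have h1 := cross_eq_zero_of_mem_seg (hsub (left_mem_segment ℝ _ _))
    have h2 := cross_eq_zero_of_mem_seg (hsub (right_mem_segment ℝ _ _))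
    rw [show v + δ • e - y = (v - y) + δ • e by abel, cross_add_right, h1, zero_add,
      cross_smul_right] at h2
    have h3 := (mul_eq_zero.1 h2).resolve_left hδ
    intro w hw
    have h4 := cross_eq_zero_of_mem_seg hw
    have h5 : cross (z - y) (w - v) = 0 := by
      rw [show w - v = (w - y) - (v - y) by abel, cross_sub_right, h4, h1, sub_zero]
    obtain ⟨τ, hτ⟩ := exists_smul_of_cross_eq_zero F.e_ne
      (cross_eq_zero_trans (sub_ne_zero.2 hyz.symm) h3 h5)
    exact ⟨τ, by rw [← hτ]; abel⟩
  -- The segment cannot go beyond `v`, because the open segment from `v` to `x` avoids the skeleton;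
  -- so `v` is one of its ends.
  have hneg : ∀ τ : ℝ, v + τ • e ∈ segment ℝ y z → 0 ≤ τ := by
    intro τ hτ
    by_contra! hlt
    have hsx : segment ℝ v (v + τ • e) ⊆ T.skeleton :=
      ((convex_segment y z).segment_subset (hsub (left_mem_segment ℝ _ _)) hτ).trans hK
    have hm : 0 < min (-τ) (ξ / 2) := lt_min (by linarith) (by linarith [F.xi])
    refine disjoint_left.1 F.disj (F.mem_oseg_x hm
      ((min_le_right _ _).trans_lt (by linarith [F.xi]))) (hsx (mem_seg.2
        ⟨min (-τ) (ξ / 2) / (-τ), div_nonneg hm.le (by linarith), ?_, ?_⟩))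
    · rw [div_le_one (by linarith)]; exact min_le_left _ _
    · rw [add_sub_cancel_left, smul_smul, div_neg, neg_mul, div_mul_cancel₀ _ hlt.ne]; module
  have hvs := hsub (left_mem_segment ℝ _ _)
  obtain ⟨α, hα⟩ := hline y (left_mem_segment ℝ _ _)
  obtain ⟨β, hβ⟩ := hline z (right_mem_segment ℝ _ _)
  have hα0 := hneg α (hα ▸ left_mem_segment ℝ _ _)
  have hβ0 := hneg β (hβ ▸ right_mem_segment ℝ _ _)
  have hv : y = v ∨ z = v := by
    by_contra! h
    have hα1 : α ≠ 0 := fun h0 => h.1 (by rw [hα, h0]; simp)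
    have hβ1 : β ≠ 0 := fun h0 => h.2 (by rw [hβ, h0]; simp)
    obtain ⟨σ, h0, h1, h2⟩ := mem_seg.1 hvs
    rw [hα, hβ] at h2
    have h3 : ((1 - σ) * α + σ * β) • e = 0 := by
      have : v + ((1 - σ) * α + σ * β) • e = v + α • e + σ • (v + β • e - (v + α • e)) := by module
      rw [← this] at h2
      simpa using h2.symm
    have h4 := (smul_eq_zero.1 h3).resolve_right F.e_ne
    have hα2 := lt_of_le_of_ne hα0 hα1.symm
    have hβ2 := lt_of_le_of_ne hβ0 hβ1.symm
    rcases h0.eq_or_lt with rfl | h0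
    · nlinarith
    · nlinarith [mul_pos h0 hβ2, mul_nonneg (sub_nonneg.2 h1) hα2.le]
  rcases hv with rfl | rfl
  · refine ⟨z, by rwa [segment_symm], β, lt_of_le_of_ne hβ0 ?_, hβ⟩
    rintro rfl; exact hyz (by rw [hβ]; simp)
  · refine ⟨y, hs, α, lt_of_le_of_ne hα0 ?_, hα⟩
    rintro rfl; exact hyz (by rw [hα]; simp)

variable {T₂ : TTessellation D}

theorem v_mem_vertices (F : FlipData T a b v x d e κ ξ) : v ∈ T.vertices := F.edge.disjoint.2.1

theorem not_isEdge (F : FlipData T a b v x d e κ ξ) : ¬ T.IsEdge (segment ℝ a b) := fun h =>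
  disjoint_left.1 h.disjoint.2.2.2 F.mem F.v_mem_vertices

theorem mem_oseg_stem (F : FlipData T a b v x d e κ ξ) {γ : ℝ} (hγ : 0 < γ) :
    v ∈ openSegment ℝ (v + γ • e) x := by
  have := add_smul_mem_oseg (p := v) (d := -e) (α := -γ) (β := 0) (γ := ξ) (by linarith) F.xi
  rw [F.hx]
  convert this using 2 <;> module

theorem mem_stem_of_core {c : Plane} {γ : ℝ} (hγ : 0 < γ) (hc : c = v + γ • e)
    (hs : T.IsSegment (segment ℝ c v)) {q : Plane} (hq : q ∈ core T.skeleton e)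
    (hl : cross e (q - v) = 0) : q ∈ segment ℝ c v := by
  have h1 : v - c = (-γ) • e := by rw [hc]; module
  refine mem_segment_of_core hs (by rwa [h1, core_smul (neg_ne_zero.2 hγ.ne')]) ?_
  rw [h1, cross_smul_left, show q - c = (q - v) - γ • e by rw [hc]; abel, cross_sub_right, hl,
    cross_smul_right, cross_self]
  simp

/-- The closure puts back `b` by `end_mem_closure`; `v` belongs to the new edge. -/
theorem isFlip (F : FlipData T a b v x d e κ ξ) (hD : IsConvexPolygon D)
    (h : T₂.skeleton = flipSkeleton T.skeleton v b x) : IsFlip T T₂ := by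
  obtain ⟨c, hs, γ, hγ, hc⟩ := F.exists_stem
  refine ⟨a, b, v, c, x, F.seg, F.not_isEdge, F.mem, F.edge, hs, ?_, F.x_mem, F.disj, ?_⟩
  · rw [hc]; exact F.mem_oseg_stem hγ
  · refine subset_antisymm ?_ (union_subset ?_ ?_)
    · rw [h]
      rintro z (⟨hz, hzo⟩ | hz)
      · by_cases hzs : z ∈ segment ℝ v b
        · rcases mem_seg_iff_oseg.1 hzs with rfl | rfl | h'
          · exact Or.inr (left_mem_segment ℝ _ _)
          · refine Or.inl (closure_mono (sdiff_subset_sdiff_right fun w hw => ?_)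
              (end_mem_closure hD F.seg))
            change cross _ _ = 0
            rw [cross_sub_base (cross_self _), F.cross_ab_iff]
            exact F.cross_d_of_mem_seg_b hw
          · exact absurd h' hzo
        · exact Or.inl (subset_closure ⟨hz, hzs⟩)
      · exact Or.inr hz
    · refine closure_minimal ?_ T₂.isClosed_skeleton
      rw [h]
      exact (sdiff_subset_sdiff_right (openSegment_subset_segment ℝ _ _)).trans subset_union_left
    · rw [h]; exact subset_union_right

/-- The reverse of a flip is a flip. -/
theorem isFlip_symm (F : FlipData T a b v x d e κ ξ) (hD : IsConvexPolygon D)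
    (h : T₂.skeleton = flipSkeleton T.skeleton v b x) : IsFlip T₂ T := by
  obtain ⟨c, hs, γ, hγ, hc⟩ := F.exists_stem
  have hvcx : v ∈ openSegment ℝ c x := by rw [hc]; exact F.mem_oseg_stem hγ
  have hce : cross e (c - v) = 0 := by rw [hc, cross_add_smul_self]
  have hxe : cross e (x - v) = 0 := by
    rw [F.hx, show v - ξ • e - v = (-ξ) • e by module, cross_smul_right, cross_self, mul_zero]
  have hcv := hs.endpoints
  have hcx : c ≠ x := by
    rintro rfl
    rw [openSegment_same] at hvcx
    exact hcv.1 (mem_singleton_iff.1 hvcx).symm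
  have hcK : segment ℝ c v ⊆ T₂.skeleton := by
    rw [h]
    refine (F.seg_stem_subset ?_ hce).trans subset_union_left
    have := mem_core_of_segment hcv.2.2.2 (left_mem_segment ℝ _ _)
    rwa [show v - c = (-γ) • e by rw [hc]; module, core_smul (neg_ne_zero.2 hγ.ne')] at this
  have hxK : segment ℝ v x ⊆ T₂.skeleton := by rw [h]; exact subset_union_right
  have hvx : v ≠ x := fun h' => F.x_notMem_seg_b (h' ▸ left_mem_segment ℝ _ _)
  have hcxK : segment ℝ c x ⊆ T₂.skeleton :=
    (segment_subset_union_of_mem (openSegment_subset_segment ℝ _ _ hvcx)).trans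
      (union_subset hcK hxK)
  have hvcxs := openSegment_subset_segment ℝ _ _ hvcx
  have hcvs : segment ℝ c v ⊆ segment ℝ c x :=
    (convex_segment c x).segment_subset (left_mem_segment ℝ _ _) hvcxs
  have hvxs : segment ℝ v x ⊆ segment ℝ c x :=
    (convex_segment c x).segment_subset hvcxs (right_mem_segment ℝ _ _)
  -- Maximality of a segment `s` through `v`: a longer one would consist of core points of the new
  -- skeleton on the same line, and these are all in `s`.
  have hmax : ∀ {s : Set Plane} {y z f : Plane}, s ⊆ segment ℝ y z → segment ℝ y z ⊆ T₂.skeleton →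
      f ≠ 0 → y ≠ z → cross (z - y) f = 0 → v ∈ s →
      (∀ q ∈ core (flipSkeleton T.skeleton v b x) f, cross f (q - v) = 0 → q ∈ s) →
      segment ℝ y z ⊆ s := by
    intro s y z f hsub hyzK hf hyz hpar hvs H w hw
    have hzy := sub_ne_zero.2 hyz.symm
    have hwc := mem_core_of_segment hyzK hw
    obtain ⟨k, rfl⟩ := exists_smul_of_cross_eq_zero hzy hpar
    have hk : k ≠ 0 := by rintro rfl; simp at hf
    refine H w (by rw [core_smul hk, ← h]; exact hwc) ?_
    rw [cross_smul_left, show w - v = (w - y) - (v - y) by abel, cross_sub_right,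
      cross_eq_zero_of_mem_seg hw, cross_eq_zero_of_mem_seg (hsub hvs)]
    simp
  have hpar : ∀ {p q y z f : Plane} {k : ℝ}, segment ℝ p q ⊆ segment ℝ y z → k ≠ 0 → q - p = k • f →
      cross (z - y) f = 0 := by
    intro p q y z f k hsub hk hf
    have h1 := cross_eq_zero_of_mem_seg (hsub (left_mem_segment ℝ _ _))
    have h2 := cross_eq_zero_of_mem_seg (hsub (right_mem_segment ℝ _ _))
    rw [show q - y = (p - y) + k • f by rw [← hf]; abel, cross_add_right, h1, zero_add,
      cross_smul_right] at h2
    exact (mul_eq_zero.1 h2).resolve_left hk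
  have hneyz : ∀ {p q y z : Plane}, segment ℝ p q ⊆ segment ℝ y z → p ≠ q → y ≠ z := by
    rintro p q y z hsub hpq rfl
    rw [segment_same] at hsub
    exact hpq ((hsub (left_mem_segment ℝ _ _)).trans (hsub (right_mem_segment ℝ _ _)).symm)
  have hseg : T₂.IsInternalSegment (segment ℝ c x) := by
    refine ⟨Tessellation.isSegment_iff.2 ⟨⟨c, x, hcx, rfl⟩, hcxK, fun y z hsub hyzK => ?_⟩,
      fun hf => (hf hvcxs).2 (F.v_mem_interior hD)⟩
    refine hmax hsub hyzK F.e_ne (hneyz hsub hcx) (hpar (k := -(γ + ξ)) hsub ?_ ?_) hvcxs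
      fun q hq hl => ?_
    · have := F.xi; linarith
    · rw [hc, F.hx]; module
    · rcases mem_core_or_of_core hq with h' | h'
      · exact hcvs (mem_stem_of_core hγ hc hs h' hl)
      · exact hvxs h'
  have hvV : v ∈ T₂.vertices := by
    by_contra hn
    obtain ⟨f, hf⟩ := Tessellation.exists_isFlatAt (hcxK hvcxs) hn
    rw [h] at hf
    exact hf.not_tee F.tee_at_v
  have hxV : x ∈ T₂.vertices := hseg.1.endpoints.2.2.1
  obtain ⟨μ, hμ, hba⟩ := F.sub_eq_smul
  obtain ⟨ρ, hρ, hbv⟩ := F.exists_sub_smul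
  have hav : a ≠ v := fun h' => by
    have := F.mem
    rw [← h'] at this
    exact left_notMem_oseg F.seg.1.endpoints.1 this
  have hva : v - a = (μ - κ) • d := by
    rw [show v - a = (b - a) - (b - v) by abel, hba, F.sub_eq]; module
  have haK : segment ℝ a v ⊆ T₂.skeleton := by
    rw [h]
    exact fun z hz => Or.inl ⟨F.seg.1.endpoints.2.2.2 (F.segs_a hz), disjoint_left.1 F.disjoint_seg_a hz⟩
  -- In the reverse flip the blocking segment is `[c, x]`, with last edge `[v, x]`, and the blocked
  -- segment `[a, v]` is prolonged to `b`.
  refine ⟨c, x, v, a, b, hseg, ?_, hvcx, ?_, ?_, F.mem, ?_, ?_, ?_⟩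
  · exact fun he => disjoint_left.1 he.disjoint.2.2.2 hvcx hvV
  · refine Tessellation.isEdge_of_disjoint hvV hxV hvx hxK (disjoint_left.2 fun z hz => ?_)
    have := F.flat_on_oseg hD hz
    rw [← h] at this
    exact Tessellation.not_mem_vertices_of_isFlatAt hD this
  · refine Tessellation.isSegment_iff.2 ⟨⟨a, v, hav, rfl⟩, haK, fun y z hsub hyzK => ?_⟩
    refine hmax hsub hyzK F.d_ne (hneyz hsub hav) (hpar (k := μ - κ) hsub ?_ hva)
      (right_mem_segment ℝ _ _) fun q hq hl => F.mem_seg_a_of_core hq hl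
    intro h0
    rw [h0, zero_smul, sub_eq_zero] at hva
    exact hav hva.symm
  · rw [h]
    exact Or.inl ⟨F.edge.subset_skeleton (right_mem_segment ℝ _ _),
      right_notMem_oseg F.edge.disjoint.1⟩
  · rw [h]; exact F.flipSkeleton_disjoint.symm
  · refine subset_antisymm (fun z hz => ?_) (union_subset ?_ F.edge.subset_skeleton)
    · by_cases hzb : z ∈ segment ℝ v b
      · exact Or.inr hzb
      left
      by_cases hzx : z ∈ segment ℝ v x
      · rcases mem_seg_iff_oseg.1 hzx with rfl | rfl | h'
        · exact absurd (left_mem_segment ℝ _ _) hzb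
        · refine closure_mono (sdiff_subset_sdiff_right fun w hw => ?_) (end_mem_closure hD hseg)
          change cross _ _ = 0
          rw [cross_sub_base (cross_self _)]
          exact cross_eq_zero_of_mem_seg (hvxs hw)
        · exact absurd hz (disjoint_left.1 F.disj h')
      · refine subset_closure ⟨?_, hzx⟩
        rw [h]
        exact Or.inl ⟨hz, fun h' => hzb (openSegment_subset_segment ℝ _ _ h')⟩
    · refine closure_minimal ?_ T.isClosed_skeleton
      rintro z ⟨hz, hzx⟩
      rw [h] at hz
      exact (hz.resolve_right hzx).1

end TTess.TTessellation.FlipData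

/-! ### Carrier lines -/

namespace TTess

/-- The line through two points. -/
def lineOf (x y : Plane) : Set Plane := {z | cross (y - x) (z - x) = 0}

def IsLine (L : Set Plane) : Prop := ∃ x y, x ≠ y ∧ L = lineOf x y

theorem mem_lineOf {x y z : Plane} : z ∈ lineOf x y ↔ cross (y - x) (z - x) = 0 := Iff.rfl

theorem left_mem_lineOf (x y : Plane) : x ∈ lineOf x y := by
  rw [mem_lineOf, sub_self, cross_zero_right]

theorem right_mem_lineOf (x y : Plane) : y ∈ lineOf x y := cross_self _

theorem segment_subset_lineOf (x y : Plane) : segment ℝ x y ⊆ lineOf x y :=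
  fun _ hz => cross_eq_zero_of_mem_seg hz

theorem lineOf_eq {x y p q : Plane} (hxy : x ≠ y) (hp : p ∈ lineOf x y) (hq : q ∈ lineOf x y)
    (hpq : p ≠ q) : lineOf p q = lineOf x y := by
  have hd := sub_ne_zero.2 hxy.symm
  have h1 : cross (y - x) (q - p) = 0 := by
    rw [show q - p = (q - x) - (p - x) by abel, cross_sub_right, mem_lineOf.1 hp, mem_lineOf.1 hq,
      sub_zero]
  obtain ⟨k, hk⟩ := exists_smul_of_cross_eq_zero hd h1
  have hk0 : k ≠ 0 := by
    rintro rfl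
    rw [zero_smul, sub_eq_zero] at hk
    exact hpq hk.symm
  ext z
  rw [mem_lineOf, mem_lineOf, hk, cross_smul_left, mul_eq_zero, or_iff_right hk0,
    ← cross_sub_base (mem_lineOf.1 hp)]

theorem setOf_cross_eq (f q : Plane) : {z | cross f (z - q) = 0} = lineOf q (q + f) := by
  ext z; rw [mem_lineOf, add_sub_cancel_left]; rfl

theorem isLine_setOf_cross {f : Plane} (hf : f ≠ 0) (q : Plane) :
    IsLine {z | cross f (z - q) = 0} :=
  ⟨q, q + f, fun h => hf (by simpa using h.symm), setOf_cross_eq f q⟩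

theorem IsLine.eq_of_mem {L M : Set Plane} (hL : IsLine L) (hM : IsLine M) {p q : Plane}
    (hpq : p ≠ q) (h1 : p ∈ L) (h2 : q ∈ L) (h3 : p ∈ M) (h4 : q ∈ M) : L = M := by
  obtain ⟨x, y, hxy, rfl⟩ := hL
  obtain ⟨x', y', hxy', rfl⟩ := hM
  rw [← lineOf_eq hxy h1 h2 hpq, lineOf_eq hxy' h3 h4 hpq]

theorem IsLine.inter_subsingleton {L M : Set Plane} (hL : IsLine L) (hM : IsLine M) (h : L ≠ M) :
    (L ∩ M).Subsingleton := by
  intro p hp q hq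
  by_contra hpq
  exact h (hL.eq_of_mem hM hpq hp.1 hq.1 hp.2 hq.2)

/-- A segment in the union of a closed set and of a part of another line. -/
theorem segment_subset_of_lineOf_ne {K M c : Set Plane} (hK : IsClosed K) (hM : IsLine M)
    {x y : Plane} (hxy : x ≠ y) (h : segment ℝ x y ⊆ K ∪ c) (hc : c ⊆ M) (hne : lineOf x y ≠ M) :
    segment ℝ x y ⊆ K :=
  segment_subset_of_subsingleton hK hxy h ((IsLine.inter_subsingleton ⟨x, y, hxy, rfl⟩ hM hne).anti
    (inter_subset_inter (segment_subset_lineOf x y) hc))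

namespace TTessellation

variable {D : Set Plane} {T T' : TTessellation D}

/-- The lines which carry segments of a tessellation. -/
def carriers (T : TTessellation D) : Set (Set Plane) :=
  {L | ∃ x y, x ≠ y ∧ L = lineOf x y ∧ segment ℝ x y ⊆ T.skeleton}

/-- The lines which carry internal segments of a tessellation. -/
def innerCarriers (T : TTessellation D) : Set (Set Plane) :=
  {L | ∃ x y, x ≠ y ∧ L = lineOf x y ∧ segment ℝ x y ⊆ T.skeleton ∧ ¬ segment ℝ x y ⊆ frontier D}

/-- The vertices of the segments carried by a line. -/
def nodes (T : TTessellation D) (L : Set Plane) : Set Plane :=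
  {z | z ∈ T.vertices ∧ z ∈ L ∧ ∃ y ∈ L, y ≠ z ∧ segment ℝ z y ⊆ T.skeleton}

theorem innerCarriers_subset : T.innerCarriers ⊆ T.carriers :=
  fun _ ⟨x, y, h1, h2, h3, _⟩ => ⟨x, y, h1, h2, h3⟩

theorem isLine_of_mem_carriers {L : Set Plane} (h : L ∈ T.carriers) : IsLine L := by
  obtain ⟨x, y, h1, h2, -⟩ := h
  exact ⟨x, y, h1, h2⟩

theorem finite_carriers (T : TTessellation D) : T.carriers.Finite := by
  refine ((T.finite_vertices.prod T.finite_vertices).image fun p => lineOf p.1 p.2).subset ?_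
  rintro L ⟨x, y, hxy, rfl, hK⟩
  obtain ⟨s, hs, hsub⟩ := T.exists_isSegment hxy hK
  obtain ⟨p, q, hpq, hp, hq, rfl, -⟩ := hs.exists_endpoints
  refine ⟨(p, q), ⟨hp, hq⟩, ?_⟩
  exact (lineOf_eq hpq (segment_subset_lineOf _ _ (hsub (left_mem_segment ℝ _ _)))
    (segment_subset_lineOf _ _ (hsub (right_mem_segment ℝ _ _))) hxy).symm

theorem finite_innerCarriers (T : TTessellation D) : T.innerCarriers.Finite :=
  T.finite_carriers.subset innerCarriers_subset

theorem finite_nodes (T : TTessellation D) (L : Set Plane) : (T.nodes L).Finite :=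
  T.finite_vertices.subset fun _ h => h.1

theorem carriers_mono (h : T'.skeleton ⊆ T.skeleton) : T'.carriers ⊆ T.carriers :=
  fun _ ⟨x, y, h1, h2, h3⟩ => ⟨x, y, h1, h2, h3.trans h⟩

theorem innerCarriers_mono (h : T'.skeleton ⊆ T.skeleton) : T'.innerCarriers ⊆ T.innerCarriers :=
  fun _ ⟨x, y, h1, h2, h3, h4⟩ => ⟨x, y, h1, h2, h3.trans h, h4⟩

/-- Segments with a point in the interior of the domain are internal. -/
theorem lineOf_mem_innerCarriers {x y z : Plane} (hxy : x ≠ y) (hK : segment ℝ x y ⊆ T.skeleton)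
    (hz : z ∈ segment ℝ x y) (hzD : z ∈ interior D) : lineOf x y ∈ T.innerCarriers :=
  ⟨x, y, hxy, rfl, hK, fun h => (h hz).2 hzD⟩

theorem exists_internal_of_mem_innerCarriers {L : Set Plane} (hL : L ∈ T.innerCarriers) :
    ∃ a b, T.IsInternalSegment (segment ℝ a b) ∧ L = lineOf a b := by
  obtain ⟨x, y, hxy, rfl, hK, hf⟩ := hL
  obtain ⟨s, hs, hsub⟩ := T.exists_isSegment hxy hK
  obtain ⟨p, q, hpq, hp, hq, rfl, -⟩ := hs.exists_endpoints
  exact ⟨p, q, ⟨hs, fun h => hf (hsub.trans h)⟩,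
    lineOf_eq hpq (segment_subset_lineOf _ _ (hsub (left_mem_segment ℝ _ _)))
      (segment_subset_lineOf _ _ (hsub (right_mem_segment ℝ _ _))) hxy⟩

theorem mem_core_of_lineOf {a b z y : Plane} (hab : a ≠ b) (hz : z ∈ lineOf a b)
    (hy : y ∈ lineOf a b) (hyz : y ≠ z) {K : Set Plane} (hK : segment ℝ z y ⊆ K) :
    z ∈ core K (b - a) := by
  have h1 : cross (b - a) (y - z) = 0 := by
    rw [show y - z = (y - a) - (z - a) by abel, cross_sub_right, mem_lineOf.1 hz, mem_lineOf.1 hy,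
      sub_zero]
  obtain ⟨k, hk⟩ := exists_smul_of_cross_eq_zero (sub_ne_zero.2 hab.symm) h1
  refine ⟨k, ?_, by rwa [← hk, add_sub_cancel]⟩
  rintro rfl
  rw [zero_smul, sub_eq_zero] at hk
  exact hyz hk

/-- Points of segments carried by the same line belong to the same segment. -/
theorem mem_segment_of_lineOf {a b z y : Plane} (hs : T.IsSegment (segment ℝ a b))
    (hz : z ∈ lineOf a b) (hy : y ∈ lineOf a b) (hyz : y ≠ z) (hK : segment ℝ z y ⊆ T.skeleton) :
    z ∈ segment ℝ a b :=
  mem_segment_of_core hs (mem_core_of_lineOf hs.endpoints.1 hz hy hyz hK) hz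

/-- Vertices are recognised by the germ of the skeleton: a point of the skeleton which is no vertex
is flat, and a flat point is never a vertex. -/
theorem mem_vertices_congr (hD : IsConvexPolygon D) {z : Plane} (hz : z ∈ T'.vertices)
    (hzK : z ∈ T.skeleton) (h : ∀ᶠ w in 𝓝 z, (w ∈ T'.skeleton ↔ w ∈ T.skeleton)) :
    z ∈ T.vertices := by
  by_contra hn
  obtain ⟨f, hf⟩ := Tessellation.exists_isFlatAt hzK hn
  exact Tessellation.not_mem_vertices_of_isFlatAt hD (hf.congr h) hz

/-! #### Merges -/

/-- Aligned segments being equal, the line of the deleted segment carried nothing else inside `D`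
and disappears. On the other lines no vertex is created. -/
theorem merge_facts (hD : IsConvexPolygon D) (h : IsMerge T T') :
    T'.skeleton ⊆ T.skeleton ∧ T'.innerCarriers ⊂ T.innerCarriers ∧
      ∀ L, T'.nodes L ⊆ T.nodes L := by
  obtain ⟨a, b, hs, he, hsk⟩ := skeleton_of_isMerge hD h
  have hsub : T'.skeleton ⊆ T.skeleton := by rw [hsk]; exact sdiff_subset
  obtain ⟨hab, haV, hbV, hK⟩ := hs.1.endpoints
  refine ⟨hsub, ⟨innerCarriers_mono hsub, fun h' => ?_⟩, fun L z hz => ?_⟩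
  · obtain ⟨x, y, hxy, hl, hxyK, -⟩ := h' (show lineOf a b ∈ T.innerCarriers from
      ⟨a, b, hab, rfl, hK, hs.2⟩)
    have hx : x ∈ segment ℝ a b := mem_segment_of_lineOf hs.1 (hl ▸ left_mem_lineOf x y)
      (hl ▸ right_mem_lineOf x y) hxy.symm (hxyK.trans hsub)
    have hy : y ∈ segment ℝ a b := mem_segment_of_lineOf hs.1 (hl ▸ right_mem_lineOf x y)
      (hl ▸ left_mem_lineOf x y) hxy (by rw [segment_symm]; exact hxyK.trans hsub)
    have key : ∀ z ∈ segment ℝ a b, z ∈ T'.skeleton → z = a ∨ z = b := by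
      intro z hz hzK
      rw [hsk] at hzK
      rcases mem_seg_iff_oseg.1 hz with h | h | h
      · exact Or.inl h
      · exact Or.inr h
      · exact absurd h hzK.2
    obtain ⟨p, hp⟩ := oseg_nonempty a b
    have hpK : segment ℝ a b ⊆ T'.skeleton := by
      rcases key x hx (hxyK (left_mem_segment ℝ _ _)) with h1 | h1 <;>
        rcases key y hy (hxyK (right_mem_segment ℝ _ _)) with h2 | h2
      · exact absurd (h1.trans h2.symm) hxy
      · rwa [h1, h2] at hxyK
      · rwa [h1, h2, segment_symm] at hxyK
      · exact absurd (h1.trans h2.symm) hxy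
    have := hpK (openSegment_subset_segment ℝ _ _ hp)
    rw [hsk] at this
    exact this.2 hp
  · obtain ⟨hzV, hzL, y, hyL, hyz, hyK⟩ := hz
    refine ⟨?_, hzL, y, hyL, hyz, hyK.trans hsub⟩
    have hzK := T'.vertices_subset_skeleton hzV
    by_cases hzs : z ∈ segment ℝ a b
    · rw [hsk] at hzK
      rcases mem_seg_iff_oseg.1 hzs with rfl | rfl | h
      · exact haV
      · exact hbV
      · exact absurd h hzK.2
    · refine mem_vertices_congr hD hzV (hsub hzK) ?_
      filter_upwards [eventually_notMem_of_isClosed (isClosed_seg a b) hzs] with w hw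
      rw [hsk]
      exact ⟨fun h => h.1, fun h => ⟨h, fun h' => hw (openSegment_subset_segment ℝ _ _ h')⟩⟩

/-! #### Flips -/

namespace FlipData

variable {a b v x d e : Plane} {κ ξ : ℝ}

theorem seg_x_subset (F : FlipData T a b v x d e κ ξ) :
    segment ℝ v x ⊆ {z | cross e (z - v) = 0} := by
  intro z hz
  obtain ⟨τ, -, -, rfl⟩ := F.seg_x_line hz
  change cross e _ = 0
  rw [show v - τ • e - v = (-τ) • e by module, cross_smul_right, cross_self, mul_zero]

theorem stem_line_mem (F : FlipData T a b v x d e κ ξ) (hD : IsConvexPolygon D) :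
    {z | cross e (z - v) = 0} ∈ T.innerCarriers := by
  obtain ⟨c, hs, γ, hγ, hc⟩ := F.exists_stem
  obtain ⟨hcv, -, -, hK⟩ := hs.endpoints
  have : {z | cross e (z - v) = 0} = lineOf c v := by
    rw [setOf_cross_eq]
    refine (lineOf_eq (fun h => F.e_ne (by simpa using h.symm)) ?_ (left_mem_lineOf _ _) hcv).symm
    rw [mem_lineOf, add_sub_cancel_left, hc, cross_add_smul_self]
  rw [this]
  exact lineOf_mem_innerCarriers hcv hK (right_mem_segment ℝ _ _) (F.v_mem_interior hD)

/-- The only new edge is on the line of the stem, which already carried an internal segment, ending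
at `v` inside `D`. -/
theorem flip_carriers (F : FlipData T a b v x d e κ ξ) (hD : IsConvexPolygon D)
    (h : T'.skeleton = flipSkeleton T.skeleton v b x) :
    T'.carriers ⊆ T.carriers ∧ T'.innerCarriers ⊆ T.innerCarriers := by
  have key : ∀ y z : Plane, y ≠ z → segment ℝ y z ⊆ T'.skeleton →
      lineOf y z ≠ {z | cross e (z - v) = 0} → segment ℝ y z ⊆ T.skeleton := by
    intro y z hyz hK hne
    rw [h] at hK
    exact segment_subset_of_lineOf_ne T.isClosed_skeleton (isLine_setOf_cross F.e_ne v) hyz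
      (hK.trans flipSkeleton_subset) F.seg_x_subset hne
  constructor
  · rintro L ⟨y, z, hyz, rfl, hK⟩
    by_cases hl : lineOf y z = {z | cross e (z - v) = 0}
    · rw [hl]; exact innerCarriers_subset (F.stem_line_mem hD)
    · exact ⟨y, z, hyz, rfl, key y z hyz hK hl⟩
  · rintro L ⟨y, z, hyz, rfl, hK, hf⟩
    by_cases hl : lineOf y z = {z | cross e (z - v) = 0}
    · rw [hl]; exact F.stem_line_mem hD
    · exact ⟨y, z, hyz, rfl, key y z hyz hK hl, hf⟩

theorem flip_lineOf_mem (F : FlipData T a b v x d e κ ξ) (hD : IsConvexPolygon D)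
    (h : T'.skeleton = flipSkeleton T.skeleton v b x) : lineOf a b ∈ T'.innerCarriers := by
  have hav : a ≠ v := fun h' => by
    have := F.mem
    rw [← h'] at this
    exact left_notMem_oseg F.seg.1.endpoints.1 this
  rw [← lineOf_eq F.seg.1.endpoints.1 (left_mem_lineOf _ _)
    (segment_subset_lineOf _ _ (openSegment_subset_segment ℝ _ _ F.mem)) hav]
  refine lineOf_mem_innerCarriers hav ?_ (right_mem_segment ℝ _ _) (F.v_mem_interior hD)
  rw [h]
  exact fun z hz => Or.inl ⟨F.seg.1.endpoints.2.2.2 (F.segs_a hz), disjoint_left.1 F.disjoint_seg_a hz⟩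

/-- The progress made by a flip. On the line of `[a, b]` only `[a, v]` remains, whose vertices were
vertices before, and the node `b` is lost. -/
theorem flip_nodes (F : FlipData T a b v x d e κ ξ) (hD : IsConvexPolygon D)
    (h : T'.skeleton = flipSkeleton T.skeleton v b x) :
    T'.nodes (lineOf a b) ⊂ T.nodes (lineOf a b) := by
  have hab := F.seg.1.endpoints.1
  have key : ∀ z ∈ T'.nodes (lineOf a b), z ∈ segment ℝ a v := by
    rintro z ⟨hzV, hzL, y, hyL, hyz, hyK⟩
    rw [h] at hyK
    refine F.mem_seg_a_of_core ?_ ((F.cross_ab_iff z).1 hzL)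
    rw [← F.core_ab]
    exact mem_core_of_lineOf hab hzL hyL hyz hyK
  have hav : a ≠ v := fun h' => by
    have := F.mem
    rw [← h'] at this
    exact left_notMem_oseg hab this
  refine ⟨fun z hz => ?_, fun h' => ?_⟩
  · have hza := key z hz
    have hzK := F.seg.1.endpoints.2.2.2 (F.segs_a hza)
    refine ⟨?_, hz.2.1, ?_⟩
    · by_cases hzv : z = v
      · rw [hzv]; exact F.v_mem_vertices
      refine mem_vertices_congr hD hz.1 hzK ?_
      have h1 : z ∉ segment ℝ v x := fun h' => hzv (F.eq_v_of_mem h' ((F.cross_ab_iff z).1 hz.2.1))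
      have h2 : z ∉ segment ℝ v b := by
        intro h'
        rcases mem_seg_iff_oseg.1 h' with h' | rfl | h'
        · exact hzv h'
        · obtain ⟨p, hp⟩ := oseg_nonempty v z
          have := F.oseg_subset_of_mem hza hp
          rw [segment_same] at this
          rw [mem_singleton_iff.1 this] at hp
          exact right_notMem_oseg F.edge.disjoint.1 hp
        · exact disjoint_left.1 F.disjoint_seg_a hza h'
      filter_upwards [eventually_notMem_of_isClosed (isClosed_seg v x) h1,
        eventually_notMem_of_isClosed (isClosed_seg v b) h2] with w hw hw'
      rw [h]
      have : w ∉ openSegment ℝ v b := fun h => hw' (openSegment_subset_segment ℝ _ _ h)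
      simp only [flipSkeleton, mem_union, Set.mem_sdiff, this, hw, not_false_eq_true, and_true,
        or_false]
    · have hz' := F.segs_a hza
      rcases eq_or_ne z a with rfl | hza'
      · exact ⟨b, right_mem_lineOf _ _, hab.symm, F.seg.1.endpoints.2.2.2⟩
      · exact ⟨a, left_mem_lineOf _ _, hza'.symm,
          ((convex_segment a b).segment_subset hz' (left_mem_segment ℝ _ _)).trans
            F.seg.1.endpoints.2.2.2⟩
  · have hb : b ∈ T.nodes (lineOf a b) := ⟨F.seg.1.endpoints.2.2.1, right_mem_lineOf _ _, a,
      left_mem_lineOf _ _, hab, by rw [segment_symm]; exact F.seg.1.endpoints.2.2.2⟩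
    have hba := key b (h' hb)
    obtain ⟨p, hp⟩ := oseg_nonempty v b
    have := F.oseg_subset_of_mem hba hp
    rw [segment_same] at this
    rw [mem_singleton_iff.1 this] at hp
    exact right_notMem_oseg F.edge.disjoint.1 hp

end FlipData

end TTessellation

end TTess

namespace TTess.TTessellation

/-! ### Candidates for flips, and generic lines -/

variable {D : Set Plane} {T T' : TTessellation D}

/-- Without internal carriers every edge lies on the boundary of `D`, so this boundary is the
skeleton, which determines the tessellation. -/
theorem eq_emptyTessellation (hD : IsConvexPolygon D) (h : T.innerCarriers = ∅) :
    T = emptyTessellation hD := by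
  have h0 : ∀ T : TTessellation D, T.innerCarriers = ∅ → T.skeleton = frontier D := by
    intro T h
    refine subset_antisymm ?_ T.frontier_subset_skeleton
    rintro z ⟨s, hs, hz⟩
    have hsK := Tessellation.IsEdge.subset_skeleton hs
    obtain ⟨x, -, y, -, hxy, rfl, -⟩ := hs
    by_contra hzf
    have : lineOf x y ∈ T.innerCarriers := ⟨x, y, hxy, rfl, hsK, fun h => hzf (h hz)⟩
    rw [h] at this
    exact this
  refine eq_of_skeleton_eq ((h0 T h).trans (h0 _ ?_).symm)
  refine eq_empty_iff_forall_notMem.2 ?_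
  rintro L ⟨x, y, -, -, hK, hf⟩
  refine hf fun z hz => ?_
  obtain ⟨c, hc, hz⟩ := (Tessellation.mem_skeleton_iff_frontier _).1 (hK hz)
  rwa [mem_singleton_iff.1 hc] at hz

/-- If no merge is applicable, then every line carrying an internal segment offers a candidate for
a flip. -/
theorem exists_flipData (hD : IsConvexPolygon D) (hno : ¬ Applicable .merge T) {L : Set Plane}
    (hL : L ∈ T.innerCarriers) :
    ∃ a b v x d e, ∃ κ ξ : ℝ, FlipData T a b v x d e κ ξ ∧ L = lineOf a b := by
  obtain ⟨a, b, hs, rfl⟩ := exists_internal_of_mem_innerCarriers hL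
  obtain ⟨hab, haV, hbV, hK⟩ := hs.1.endpoints
  have hne : (T.vertices ∩ openSegment ℝ a b).Nonempty := by
    by_contra hn
    refine hno (exists_isMerge hD hs (Tessellation.isEdge_of_disjoint haV hbV hab hK ?_))
    exact (disjoint_iff_inter_eq_empty.2 (not_nonempty_iff_eq_empty.1 hn)).symm
  -- The vertex inside `[a, b]` which is closest to `b`, so that `[v, b]` is an edge.
  obtain ⟨v, ⟨hvV, hv⟩, hmin⟩ := exists_min_image _ (fun z => ‖z - b‖)
    (T.finite_vertices.subset inter_subset_left) hne
  have hvb : v ≠ b := (sub_ne_zero_of_oseg hab hv).2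
  have hvs := openSegment_subset_segment ℝ _ _ hv
  have hedge : T.IsEdge (segment ℝ v b) := by
    refine Tessellation.isEdge_of_disjoint hvV hbV hvb
      (((convex_segment a b).segment_subset hvs (right_mem_segment ℝ _ _)).trans hK)
      (disjoint_left.2 fun w hw hwV => ?_)
    have h1 := hmin w ⟨hwV, openSegment_subset_of_mem hv hw⟩
    obtain ⟨σ, k0, k1, rfl⟩ := mem_oseg.1 hw
    have e1 : v + σ • (b - v) - b = (1 - σ) • (v - b) := by module
    simp only [e1, norm_smul, Real.norm_eq_abs, abs_of_pos (show (0 : ℝ) < 1 - σ by linarith)] at h1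
    have := norm_pos_iff.2 (sub_ne_zero.2 hvb)
    nlinarith
  have hvD := mem_interior_of_edge hD hs hv
  obtain ⟨d, e, htee⟩ := T.tee_of_mem_vertices hvV (extreme_notMem_interior hD hvD)
  have hd := ne_zero_left_of_cross htee.1.ne'
  have he := ne_zero_right_of_cross htee.1.ne'
  have hdu : cross d (b - a) = 0 := by
    obtain ⟨δ, hδ, H⟩ := Tessellation.smul_mem_of_oseg hv
    have h1 := htee.cross_eq_zero (u := b - a)
      ⟨δ, hδ, fun τ h0 h1 => hK (H τ (by rwa [abs_of_nonneg h0]))⟩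
    have h2 := htee.cross_eq_zero (u := -(b - a)) ⟨δ, hδ, fun τ h0 h1 => hK (by
      rw [smul_neg, ← neg_smul]
      exact H (-τ) (by rwa [abs_neg, abs_of_nonneg h0]))⟩
    rw [cross_neg_right, cross_neg_right] at h2
    rcases h1 with h1 | ⟨-, h1⟩
    · exact h1
    · rcases h2 with h2 | ⟨-, h2⟩ <;> linarith
  obtain ⟨τ, k0, k1, hvτ⟩ := mem_oseg.1 hv
  have hbv : b - v = (1 - τ) • (b - a) := by rw [hvτ]; module
  obtain ⟨κ, hκ⟩ := exists_smul_of_cross_eq_zero (u := b - v) hd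
    (by rw [hbv, cross_smul_right, hdu, mul_zero])
  obtain ⟨C, hC, ε, hε, hsub⟩ := exists_cell_near hvD (convex_cross_pos (-d) v)
    (mem_closure_cross_pos (neg_ne_zero.2 hd) (by rw [sub_self, cross_zero_right])) (by
      filter_upwards [htee.2] with z hz hzK h
      have h : 0 < cross (-d) (z - v) := h
      rw [cross_neg_left] at h
      rcases hz.1 hzK with h' | h' <;> linarith)
  obtain ⟨δ, hδ, H⟩ := exists_small (d := e) (Metric.ball_mem_nhds v hε)
  have hnear : ∀ τ : ℝ, 0 < τ → τ ≤ δ → v - τ • e ∈ interior C := by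
    intro τ h0 h1
    have hb := H (-τ) (by rw [abs_neg, abs_of_pos h0]; exact h1)
    rw [neg_smul, ← sub_eq_add_neg] at hb
    refine hsub ⟨hb, ?_⟩
    change 0 < cross (-d) (v - τ • e - v)
    rw [show v - τ • e - v = (-τ) • e by module, cross_smul_right, cross_neg_left]
    nlinarith [htee.1]
  -- From a point slightly beyond `v`, the prolongation follows a chord of the far cell up to its
  -- frontier; this gives `x`.
  obtain ⟨β, hβ, hβf, -, hβi⟩ := (T.isConvexPolygon C hC).exists_chord (hnear δ hδ le_rfl)
    (neg_ne_zero.2 he)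
  have hx : v - δ • e + β • -e = v - (δ + β) • e := by module
  refine ⟨a, b, v, v - (δ + β) • e, d, e, κ, δ + β, ⟨hs, hv, hedge, htee, ?_, ?_, by linarith, rfl,
    T.frontier_cell_subset hC (hx ▸ hβf), disjoint_left.2 fun z hz => ?_⟩, rfl⟩
  · rintro rfl
    rw [zero_smul, sub_eq_zero] at hκ
    exact hvb hκ.symm
  · rw [← hκ]; abel
  · refine disjoint_left.1 (T.disjoint_interior_skeleton hC) ?_
    obtain ⟨σ, l0, l1, rfl⟩ := mem_oseg.1 hz
    rw [show v + σ • (v - (δ + β) • e - v) = v - (σ * (δ + β)) • e by module]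
    rcases le_total (σ * (δ + β)) δ with h | h
    · exact hnear _ (by positivity) h
    · have := hβi (σ * (δ + β) - δ) (by linarith) (by nlinarith)
      rwa [show v - δ • e + (σ * (δ + β) - δ) • -e = v - (σ * (δ + β)) • e by module] at this

theorem setOf_cross_mem_carriers {f p : Plane} (hf : f ≠ 0) {δ : ℝ} (hδ : δ ≠ 0)
    (h : segment ℝ p (p + δ • f) ⊆ T.skeleton) : {z | cross f (z - p) = 0} ∈ T.carriers := by
  have hne : p ≠ p + δ • f := fun h => smul_ne_zero hδ hf (by simpa using h.symm)
  refine ⟨p, p + δ • f, hne, ?_, h⟩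
  rw [setOf_cross_eq]
  refine (lineOf_eq (fun h => hf (by simpa using h.symm)) (left_mem_lineOf _ _) ?_ hne).symm
  rw [mem_lineOf, add_sub_cancel_left, cross_add_smul_self]

/-- Apart from those in `O`, the lines carrying internal segments avoid the corners of the domain,
and no three lines meet on them. -/
def Generic (T : TTessellation D) (O : Set (Set Plane)) : Prop :=
  ∀ L ∈ T.innerCarriers, L ∉ O → (∀ z ∈ L, z ∉ D.extremePoints ℝ) ∧
    ∀ z ∈ L, ∀ M ∈ T.carriers, ∀ M' ∈ T.carriers, M ≠ L → M' ≠ L → M ≠ M' → z ∈ M → z ∉ M'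

theorem Generic.mono {O : Set (Set Plane)} (h : T.Generic O) (h1 : T'.carriers ⊆ T.carriers)
    (h2 : T'.innerCarriers ⊆ T.innerCarriers) : T'.Generic O := fun L hL hLO =>
  ⟨(h L (h2 hL) hLO).1, fun z hz M hM M' hM' => (h L (h2 hL) hLO).2 z hz M (h1 hM) M' (h1 hM')⟩

/-- The line of the stem is not in `O` and hence generic, so `x` is no corner of `D`. If `x` were a
vertex, two carriers with independent directions would cross there. Neither is the line of the stem,
or else aligned convexity would put `[v, x]` in the skeleton; so three carriers would meet on a
generic line. -/
theorem FlipData.x_notMem_vertices {a b v x d e : Plane} {κ ξ : ℝ}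
    (F : FlipData T a b v x d e κ ξ) (hD : IsConvexPolygon D) {O : Set (Set Plane)}
    (hG : T.Generic O) (hO : T.innerCarriers ∩ O = ∅) : x ∉ T.vertices := by
  intro hxV
  have hLt := F.stem_line_mem hD
  obtain ⟨h1, h2⟩ := hG _ hLt (fun h => (eq_empty_iff_forall_notMem.1 hO) _ ⟨hLt, h⟩)
  have hxe : cross e (x - v) = 0 := F.seg_x_subset (right_mem_segment ℝ _ _)
  obtain ⟨f, g, htee⟩ := T.tee_of_mem_vertices hxV (h1 x hxe)
  have hf := ne_zero_left_of_cross htee.1.ne'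
  have hg := ne_zero_right_of_cross htee.1.ne'
  obtain ⟨δ, hδ, H⟩ := htee.exists_small
  have hseg : ∀ {u : Plane}, (∀ τ : ℝ, 0 ≤ τ → τ ≤ δ → x + τ • u ∈ T.skeleton) →
      segment ℝ x (x + δ • u) ⊆ T.skeleton := by
    intro u h z hz
    obtain ⟨σ, k0, k1, rfl⟩ := mem_seg.1 hz
    rw [add_sub_cancel_left, smul_smul]
    exact h _ (by positivity) (by nlinarith)
  have hKf := hseg (u := f) fun τ h0 h1 => (H τ (by rwa [abs_of_nonneg h0])).1
  have hKg := hseg (u := g) fun τ h0 h1 => (H τ (by rwa [abs_of_nonneg h0])).2 h0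
  have hpar : ∀ u : Plane, u ≠ 0 → segment ℝ x (x + δ • u) ⊆ T.skeleton → cross e u ≠ 0 := by
    intro u hu hKu h
    obtain ⟨k, rfl⟩ := exists_smul_of_cross_eq_zero F.e_ne h
    have hk : k ≠ 0 := by rintro rfl; simp at hu
    have hxc : x ∈ core T.skeleton e :=
      ⟨δ * k, mul_ne_zero hδ.ne' hk, by rwa [mul_smul]⟩
    have := T.alignedConvex e F.e_ne v F.core_stem x hxc hxe
    obtain ⟨p, hp⟩ := oseg_nonempty v x
    exact disjoint_left.1 F.disj hp (this (openSegment_subset_segment ℝ _ _ hp))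
  have hne : ∀ u u' w w' : Plane, cross u u' ≠ 0 → cross u (w - w') = 0 →
      {z | cross u' (z - w) = 0} ≠ {z | cross u (z - w') = 0} := by
    intro u u' w w' huu hww h
    have : w + u' ∈ {z | cross u (z - w') = 0} := by
      rw [← h]; change cross _ _ = 0; rw [add_sub_cancel_left, cross_self]
    have : cross u (w + u' - w') = 0 := this
    rw [show w + u' - w' = u' + (w - w') by abel, cross_add_right, hww, add_zero] at this
    exact huu this
  exact h2 x hxe _ (setOf_cross_mem_carriers hf hδ.ne' hKf) _
    (setOf_cross_mem_carriers hg hδ.ne' hKg) (hne e f x v (hpar f hf hKf) hxe)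
    (hne e g x v (hpar g hg hKg) hxe)
    (hne f g x x htee.1.ne' (by rw [sub_self, cross_zero_right])).symm
    (by change cross _ _ = 0; rw [sub_self, cross_zero_right])
    (by change cross _ _ = 0; rw [sub_self, cross_zero_right])

end TTess.TTessellation

/-! ### Splits by generic lines -/

namespace TTess.TTessellation

variable {D : Set Plane} {T T' T'' : TTessellation D}

/-- `T'` is obtained from `T` by dividing the cell `C` by the line through `q` with direction `f`,
which contains no vertex of `T`. -/
structure SplitData (T T' : TTessellation D) (C : Set Plane) (q f : Plane) : Prop where
  cell : C ∈ T.cells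
  q_mem : q ∈ interior C
  f_ne : f ≠ 0
  avoid : ∀ z ∈ T.vertices, cross f (z - q) ≠ 0
  skel : T'.skeleton = T.skeleton ∪ C ∩ {z | cross f (z - q) = 0}

namespace SplitData

variable {C : Set Plane} {q f : Plane}

theorem subset (S : SplitData T T' C q f) : T.skeleton ⊆ T'.skeleton := by
  rw [S.skel]; exact subset_union_left

theorem isLine (S : SplitData T T' C q f) : IsLine {z | cross f (z - q) = 0} :=
  isLine_setOf_cross S.f_ne q

theorem segment_subset (S : SplitData T T' C q f) {x y : Plane} (hxy : x ≠ y)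
    (h : segment ℝ x y ⊆ T'.skeleton) (hne : lineOf x y ≠ {z | cross f (z - q) = 0}) :
    segment ℝ x y ⊆ T.skeleton := by
  rw [S.skel] at h
  exact segment_subset_of_lineOf_ne T.isClosed_skeleton S.isLine hxy h inter_subset_right hne

theorem carriers_subset (S : SplitData T T' C q f) {L : Set Plane} (hL : L ∈ T'.carriers) :
    L = {z | cross f (z - q) = 0} ∨ L ∈ T.carriers := by
  obtain ⟨x, y, hxy, rfl, hK⟩ := hL
  by_cases h : lineOf x y = {z | cross f (z - q) = 0}
  · exact Or.inl h
  · exact Or.inr ⟨x, y, hxy, rfl, S.segment_subset hxy hK h⟩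

theorem innerCarriers_subset (S : SplitData T T' C q f) {L : Set Plane}
    (hL : L ∈ T'.innerCarriers) :
    L = {z | cross f (z - q) = 0} ∨ L ∈ T.innerCarriers := by
  obtain ⟨x, y, hxy, rfl, hK, hf⟩ := hL
  by_cases h : lineOf x y = {z | cross f (z - q) = 0}
  · exact Or.inl h
  · exact Or.inr ⟨x, y, hxy, rfl, S.segment_subset hxy hK h, hf⟩

theorem isClosed_chord (S : SplitData T T' C q f) : IsClosed (C ∩ {z | cross f (z - q) = 0}) :=
  (T.isConvexPolygon C S.cell).isClosed.inter
    (isClosed_eq ((continuous_cross f).comp (continuous_id.sub continuous_const)) continuous_const)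

theorem eventually_iff (S : SplitData T T' C q f) {z : Plane}
    (hz : z ∉ C ∩ {z | cross f (z - q) = 0}) :
    ∀ᶠ w in 𝓝 z, (w ∈ T'.skeleton ↔ w ∈ T.skeleton) := by
  filter_upwards [eventually_notMem_of_isClosed S.isClosed_chord hz] with w hw
  rw [S.skel]
  exact or_iff_left hw

theorem vertices_subset (S : SplitData T T' C q f) (hD : IsConvexPolygon D) :
    T.vertices ⊆ T'.vertices := fun z hz =>
  mem_vertices_congr hD hz (S.subset (T.vertices_subset_skeleton hz))
    ((S.eventually_iff fun h => S.avoid z hz h.2).mono fun _ h => h.symm)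

theorem mem_vertices (S : SplitData T T' C q f) (hD : IsConvexPolygon D) {z : Plane}
    (hz : z ∈ T'.vertices) (hn : z ∉ C ∩ {z | cross f (z - q) = 0}) : z ∈ T.vertices := by
  refine mem_vertices_congr hD hz ?_ (S.eventually_iff hn)
  have := T'.vertices_subset_skeleton hz
  rw [S.skel] at this
  exact this.resolve_right hn

/-- A new vertex would be on the chord, which does not meet `L`. -/
theorem nodes_subset (S : SplitData T T' C q f) (hD : IsConvexPolygon D) {L : Set Plane}
    (hL : IsLine L) (hne : L ≠ {z | cross f (z - q) = 0})
    (hC : ∀ z ∈ C, z ∈ L → cross f (z - q) ≠ 0) : T'.nodes L ⊆ T.nodes L := by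
  rintro z ⟨hzV, hzL, y, hyL, hyz, hyK⟩
  refine ⟨S.mem_vertices hD hzV fun h => hC z h.1 hzL h.2, hzL, y, hyL, hyz,
    S.segment_subset hyz.symm hyK ?_⟩
  rwa [IsLine.eq_of_mem ⟨z, y, hyz.symm, rfl⟩ hL hyz.symm (left_mem_lineOf _ _)
    (right_mem_lineOf _ _) hzL hyL]

theorem flat_inside (S : SplitData T T' C q f) {p : Plane} (hp : p ∈ interior C)
    (hpl : cross f (p - q) = 0) : IsFlatAt T'.skeleton p f := by
  refine ⟨S.f_ne, ?_⟩
  filter_upwards [isOpen_interior.mem_nhds hp] with z hz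
  rw [S.skel, cross_sub_base hpl]
  constructor
  · rintro (h | h)
    · exact absurd h (disjoint_left.1 (T.disjoint_interior_skeleton S.cell) hz)
    · exact h.2
  · exact fun h => Or.inr ⟨interior_subset hz, h⟩

theorem exists_chord (S : SplitData T T' C q f) : ∃ x y, x ≠ y ∧
    C ∩ {z | cross f (z - q) = 0} = segment ℝ x y ∧ x ∈ T.skeleton ∧ y ∈ T.skeleton ∧
      openSegment ℝ x y ⊆ interior C ∧ q ∈ openSegment ℝ x y := by
  have hP := T.isConvexPolygon C S.cell
  obtain ⟨β, hβ, hβf, hβo, hβi⟩ := hP.exists_chord S.q_mem S.f_ne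
  obtain ⟨α, hα, hαf, hαo, hαi⟩ := hP.exists_chord S.q_mem (neg_ne_zero.2 S.f_ne)
  have hneg : ∀ τ : ℝ, q + τ • -f = q + (-τ) • f := fun τ => by module
  simp only [hneg] at hαf hαo hαi
  have hq : q ∈ openSegment ℝ (q + (-α) • f) (q + β • f) := by
    simpa using add_smul_mem_oseg (p := q) (d := f) (neg_neg_of_pos hα) hβ
  refine ⟨q + (-α) • f, q + β • f, ?_, ?_, T.frontier_cell_subset S.cell hαf,
    T.frontier_cell_subset S.cell hβf, ?_, hq⟩
  · intro h
    rw [h, openSegment_same] at hq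
    have : β • f = 0 := by simpa using (mem_singleton_iff.1 hq).symm
    exact (smul_ne_zero hβ.ne' S.f_ne) this
  · refine subset_antisymm ?_ ?_
    · rintro z ⟨hzC, hz⟩
      obtain ⟨τ, hτ⟩ := exists_smul_of_cross_eq_zero S.f_ne hz
      have hzq : z = q + τ • f := by rw [← hτ]; abel
      rw [hzq] at hzC ⊢
      refine add_smul_mem_seg ?_ ?_
      · by_contra! h
        exact hαo (-τ) (by linarith) (by rwa [neg_neg])
      · by_contra! h
        exact hβo τ h hzC
    · intro z hz
      refine ⟨hP.convex.segment_subset (hP.frontier_subset hαf) (hP.frontier_subset hβf) hz, ?_⟩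
      obtain ⟨τ, -, -, rfl⟩ := mem_seg_add_smul (by linarith) hz
      exact cross_add_smul_self f q τ
  · intro z hz
    obtain ⟨τ, h1, h2, rfl⟩ := mem_oseg_add_smul (by linarith) hz
    rcases le_total 0 τ with h | h
    · exact hβi τ h h2
    · have := hαi (-τ) (by linarith) (by linarith)
      rwa [neg_neg] at this

theorem skeleton_diff (S : SplitData T T' C q f) {x y : Plane}
    (hC : C ∩ {z | cross f (z - q) = 0} = segment ℝ x y) (hx : x ∈ T.skeleton)
    (hy : y ∈ T.skeleton) (ho : openSegment ℝ x y ⊆ interior C) :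
    T'.skeleton \ openSegment ℝ x y = T.skeleton := by
  rw [S.skel, hC]
  refine subset_antisymm ?_ ?_
  · rintro z ⟨hz | hz, hzo⟩
    · exact hz
    · rcases mem_seg_iff_oseg.1 hz with rfl | rfl | h
      · exact hx
      · exact hy
      · exact absurd h hzo
  · exact fun z hz => ⟨Or.inl hz, fun h =>
      disjoint_left.1 (T.disjoint_interior_skeleton S.cell) (ho h) hz⟩

/-- The part of the new skeleton on the dividing line. -/
theorem segment_subset_chord (S : SplitData T T' C q f) {x y : Plane} (hxy : x ≠ y)
    (hK : segment ℝ x y ⊆ T'.skeleton) (hl : lineOf x y = {z | cross f (z - q) = 0}) :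
    segment ℝ x y ⊆ C ∩ {z | cross f (z - q) = 0} := by
  intro w hw
  have hwl : cross f (w - q) = 0 := by
    have := segment_subset_lineOf _ _ hw
    rw [hl] at this
    exact this
  have hpar : cross (y - x) f = 0 := by
    have h1 : cross f (x - q) = 0 := by
      have := left_mem_lineOf x y
      rw [hl] at this; exact this
    have h2 : cross f (y - q) = 0 := by
      have := right_mem_lineOf x y
      rw [hl] at this; exact this
    rw [cross_swap, show y - x = (y - q) - (x - q) by abel, cross_sub_right, h1, h2]; simp
  obtain ⟨k, hk⟩ := exists_smul_of_cross_eq_zero (sub_ne_zero.2 hxy.symm) hpar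
  have hk0 : k ≠ 0 := by rintro rfl; rw [zero_smul] at hk; exact S.f_ne hk
  have hwc := mem_core_of_segment hK hw
  rw [← core_smul hk0, ← hk, S.skel] at hwc
  by_contra hn
  exact notMem_core_of_line S.f_ne S.avoid hwl (mem_core_of_notMem S.isClosed_chord hwc hn)

/-- The dividing line contains no vertex of `T`, hence no segment of its skeleton, and the chord is
maximal; inside the cell it is flat, so it contains no vertex between its ends. -/
theorem chord_isMerge (S : SplitData T T' C q f) (hD : IsConvexPolygon D) : IsMerge T' T := by
  obtain ⟨x, y, hxy, hC, hx, hy, ho, hqo⟩ := S.exists_chord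
  have hK : segment ℝ x y ⊆ T'.skeleton := by rw [← hC, S.skel]; exact subset_union_right
  have hl : lineOf x y = {z | cross f (z - q) = 0} :=
    IsLine.eq_of_mem ⟨x, y, hxy, rfl⟩ S.isLine hxy (left_mem_lineOf _ _) (right_mem_lineOf _ _)
      (hC.ge (left_mem_segment ℝ _ _)).2 (hC.ge (right_mem_segment ℝ _ _)).2
  have hs : T'.IsInternalSegment (segment ℝ x y) := by
    refine ⟨Tessellation.isSegment_iff.2 ⟨⟨x, y, hxy, rfl⟩, hK, fun p r hsub hpr => ?_⟩,
      fun hf => ?_⟩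
    · have hxl := segment_subset_lineOf _ _ (hsub (left_mem_segment ℝ _ _))
      have hyl := segment_subset_lineOf _ _ (hsub (right_mem_segment ℝ _ _))
      have hne : p ≠ r := by
        rintro rfl
        rw [segment_same] at hsub
        exact hxy ((hsub (left_mem_segment ℝ _ _)).trans (hsub (right_mem_segment ℝ _ _)).symm)
      rw [← hC]
      exact S.segment_subset_chord hne hpr ((lineOf_eq hne hxl hyl hxy).symm.trans hl)
    · exact (hf (openSegment_subset_segment ℝ _ _ hqo)).2
        (interior_mono (T.cell_subset S.cell) S.q_mem)
  have he : T'.IsEdge (segment ℝ x y) := by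
    refine Tessellation.isEdge_of_disjoint hs.1.endpoints.2.1 hs.1.endpoints.2.2.1 hxy hK
      (disjoint_left.2 fun z hz => ?_)
    exact Tessellation.not_mem_vertices_of_isFlatAt hD
      (S.flat_inside (ho hz) (hC.ge (openSegment_subset_segment ℝ _ _ hz)).2)
  exact ⟨_, hs, he, (closure_skeleton_diff hD hs (S.skeleton_diff hC hx hy ho).symm).symm⟩

/-- If no merge is applicable to `T`, then the only merge of `T'` is the reverse of the split. -/
theorem eq_of_isMerge (S : SplitData T T' C q f) (hD : IsConvexPolygon D)
    (hno : ¬ Applicable .merge T) (h : IsMerge T' T'') : T'' = T := by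
  obtain ⟨a, b, hs, he, hsk⟩ := skeleton_of_isMerge hD h
  obtain ⟨hab, -, -, hK⟩ := hs.1.endpoints
  by_cases hl : lineOf a b = {z | cross f (z - q) = 0}
  · obtain ⟨x, y, hxy, hC, hx, hy, ho, hqo⟩ := S.exists_chord
    have h1 := S.segment_subset_chord hab hK hl
    rw [hC] at h1
    have h2 : segment ℝ x y ⊆ segment ℝ a b :=
      (Tessellation.isSegment_iff.1 hs.1).2.2 x y h1
        (by rw [← hC, S.skel]; exact subset_union_right)
    apply eq_of_skeleton_eq
    rw [hsk, ← S.skeleton_diff hC hx hy ho]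
    rcases segment_eq_segment (subset_antisymm h1 h2) with ⟨rfl, rfl⟩ | ⟨rfl, rfl⟩
    · rfl
    · rw [openSegment_symm]
  -- Any other non-blocking segment of `T'` would already be one of `T`, since a split removes no
  -- vertex.
  · exfalso
    have hK' := S.segment_subset hab hK hl
    have hs' : T.IsSegment (segment ℝ a b) := Tessellation.isSegment_iff.2
      ⟨⟨a, b, hab, rfl⟩, hK', fun x y hsub hxy =>
        (Tessellation.isSegment_iff.1 hs.1).2.2 x y hsub (hxy.trans S.subset)⟩
    refine hno (exists_isMerge hD ⟨hs', hs.2⟩ (Tessellation.isEdge_of_disjoint hs'.endpoints.2.1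
      hs'.endpoints.2.2.1 hab hK' ?_))
    exact he.disjoint.2.2.2.mono_right (S.vertices_subset hD)

/-- A candidate for a flip of `T` whose new edge is shortened by the split. -/
theorem exists_flipData (S : SplitData T T' C q f) (hD : IsConvexPolygon D)
    {a b v x d e : Plane} {κ ξ : ℝ} (F : FlipData T a b v x d e κ ξ)
    (hvx : openSegment ℝ v x ⊆ interior C) (hL : ∀ z ∈ C, z ∈ lineOf a b → cross f (z - q) ≠ 0)
    (hsep : cross f (v - q) * cross f (x - q) < 0) :
    ∃ x' ξ', FlipData T' a b v x' d e κ ξ' ∧ x' ∉ T'.vertices := by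
  have hv : cross f (v - q) ≠ 0 := fun h => by rw [h, zero_mul] at hsep; exact lt_irrefl _ hsep
  set A := cross f (v - q) with hA
  set B := cross f (x - q) with hB
  have hat : ∀ τ : ℝ, cross f (v - τ • e - q) = A - τ * cross f e := by
    intro τ
    rw [show v - τ • e - q = (v - q) - τ • e by abel, cross_sub_right, cross_smul_right]
  have hBA : B = A - ξ * cross f e := by rw [hB, F.hx]; exact hat ξ
  have hfe : cross f e ≠ 0 := by
    intro h
    rw [h, mul_zero, sub_zero] at hBA
    rw [hBA] at hsep
    nlinarith [mul_self_nonneg A]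
  -- The parameter at which the dividing line meets the prolonged stem; it is between `0` and `ξ`
  -- because the line separates `v` from `x`.
  set ξ' := A / cross f e with hξ'
  have hξA : ξ' * cross f e = A := div_mul_cancel₀ _ hfe
  have hc2 : 0 < cross f e * cross f e := mul_self_pos.2 hfe
  have hsep' : ξ' * (ξ' - ξ) < 0 := by
    have : A * B = ξ' * (ξ' - ξ) * (cross f e * cross f e) := by rw [hBA, ← hξA]; ring
    rw [this] at hsep
    by_contra! hn
    nlinarith [mul_nonneg hn hc2.le]
  have hξ := F.xi
  have h0 : 0 < ξ' := by
    by_contra! hn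
    nlinarith
  have h1 : ξ' < ξ := by
    by_contra! hn
    nlinarith
  have hx'o := F.mem_oseg_x h0 h1
  have hx'l : cross f (v - ξ' • e - q) = 0 := by rw [hat, hξA, sub_self]
  have hflat := S.flat_inside (hvx hx'o) hx'l
  have hvL : v ∈ lineOf a b :=
    segment_subset_lineOf _ _ (openSegment_subset_segment ℝ _ _ F.mem)
  have hlne : lineOf a b ≠ {z | cross f (z - q) = 0} := by
    intro h
    rw [h] at hvL
    exact hv hvL
  have hab := F.seg.1.endpoints.1
  refine ⟨v - ξ' • e, ξ', ⟨⟨Tessellation.isSegment_iff.2 ⟨⟨a, b, hab, rfl⟩,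
    F.seg.1.endpoints.2.2.2.trans S.subset, fun y z hsub hK => ?_⟩, F.seg.2⟩, F.mem, ?_, ?_,
    F.kappa, F.hb, h0, rfl, ?_, ?_⟩, Tessellation.not_mem_vertices_of_isFlatAt hD hflat⟩
  · have hyz : y ≠ z := by
      rintro rfl
      rw [segment_same] at hsub
      exact hab ((hsub (left_mem_segment ℝ _ _)).trans (hsub (right_mem_segment ℝ _ _)).symm)
    refine (Tessellation.isSegment_iff.1 F.seg.1).2.2 y z hsub (S.segment_subset hyz hK ?_)
    rwa [← lineOf_eq hyz (segment_subset_lineOf _ _ (hsub (left_mem_segment ℝ _ _)))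
      (segment_subset_lineOf _ _ (hsub (right_mem_segment ℝ _ _))) hab]
  · obtain ⟨hvb, hvV, hbV, hdis⟩ := F.edge.disjoint
    refine Tessellation.isEdge_of_disjoint (S.vertices_subset hD hvV) (S.vertices_subset hD hbV) hvb
      (F.edge.subset_skeleton.trans S.subset) (disjoint_left.2 fun z hz hzV => ?_)
    refine disjoint_left.1 hdis hz (S.mem_vertices hD hzV fun h => hL z h.1 ?_ h.2)
    exact segment_subset_lineOf _ _ (openSegment_subset_segment ℝ _ _ (F.oseg_subset hz))
  · exact F.tee.congr (S.eventually_iff fun h => hv h.2)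
  · rw [S.skel]
    exact Or.inr ⟨interior_subset (hvx hx'o), hx'l⟩
  · rw [disjoint_left, S.skel]
    intro z hz hzK
    obtain ⟨σ, k0, k1, rfl⟩ := mem_oseg.1 hz
    rw [show v + σ • (v - ξ' • e - v) = v - (σ * ξ') • e by module] at hzK
    rcases hzK with hzK | ⟨-, hzl⟩
    · exact disjoint_left.1 F.disj (F.mem_oseg_x (by positivity) (by nlinarith)) hzK
    · have hzl : cross f _ = 0 := hzl
      rw [hat, ← hξA] at hzl
      have : (1 - σ) * ξ' * cross f e = 0 := by linarith
      exact mul_ne_zero (mul_pos (by linarith) h0).ne' hfe this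

/-- The new line avoids the vertices, among them the corners of `D`, and all crossings of old
carriers; so no three carriers meet on it, and it creates no triple point on the old lines. -/
theorem generic (S : SplitData T T' C q f) {O : Set (Set Plane)} (hG : T.Generic O)
    (h : ∀ L ∈ T.carriers, ∀ M ∈ T.carriers, L ≠ M → ∀ z ∈ L, z ∈ M → cross f (z - q) ≠ 0) :
    T'.Generic O := by
  intro L hL hLO
  rcases S.innerCarriers_subset hL with rfl | hL'
  · refine ⟨fun z hz hzD => S.avoid z (T.extremePoints_subset_vertices hzD) hz, ?_⟩
    intro z hz M hM M' hM' hne hne' hMM hzM hzM'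
    exact h M ((S.carriers_subset hM).resolve_left hne) M' ((S.carriers_subset hM').resolve_left hne')
      hMM z hzM hzM' hz
  · refine ⟨(hG L hL' hLO).1, ?_⟩
    intro z hz M hM M' hM' hne hne' hMM hzM hzM'
    have hLc := TTessellation.innerCarriers_subset hL'
    rcases S.carriers_subset hM with rfl | hM
    · rcases S.carriers_subset hM' with rfl | hM'
      · exact hMM rfl
      · exact h L hLc M' hM' hne'.symm z hz hzM' hzM
    · rcases S.carriers_subset hM' with rfl | hM'
      · exact h L hLc M hM hne.symm z hz hzM hzM'
      · exact (hG L hL' hLO).2 z hz M hM M' hM' hne hne' hMM hzM hzM'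

end SplitData

end TTess.TTessellation

/-! ### The space of lines -/

namespace TTess

/-- The equation of a line. -/
noncomputable def lineEq (ℓ : ℝ × ℝ) (z : Plane) : ℝ := z 0 * Real.cos ℓ.1 + z 1 * Real.sin ℓ.1 - ℓ.2

/-- The direction of a line. -/
noncomputable def lineDir (ℓ : ℝ × ℝ) : Plane := !₂[Real.sin ℓ.1, -Real.cos ℓ.1]

theorem mem_line {ℓ : ℝ × ℝ} {z : Plane} : z ∈ line ℓ ↔ lineEq ℓ z = 0 := by
  rw [lineEq, sub_eq_zero]; rfl

theorem lineEq_sub (ℓ : ℝ × ℝ) (z w : Plane) :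
    lineEq ℓ z - lineEq ℓ w = cross (lineDir ℓ) (z - w) := by
  simp [lineEq, lineDir, cross]; ring

theorem lineEq_eq_cross {ℓ : ℝ × ℝ} {q : Plane} (hq : q ∈ line ℓ) (z : Plane) :
    lineEq ℓ z = cross (lineDir ℓ) (z - q) := by
  rw [← lineEq_sub, mem_line.1 hq, sub_zero]

theorem line_eq_setOf {ℓ : ℝ × ℝ} {q : Plane} (hq : q ∈ line ℓ) :
    line ℓ = {z | cross (lineDir ℓ) (z - q) = 0} := by
  ext z; rw [mem_line, lineEq_eq_cross hq]; rfl

theorem lineDir_ne_zero (ℓ : ℝ × ℝ) : lineDir ℓ ≠ 0 := by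
  intro h
  have h0 : Real.sin ℓ.1 = 0 := congrArg (fun u : Plane => u 0) h
  have h1 : -Real.cos ℓ.1 = 0 := congrArg (fun u : Plane => u 1) h
  have := Real.sin_sq_add_cos_sq ℓ.1
  rw [h0, neg_eq_zero.1 h1] at this
  norm_num at this

theorem continuous_lineEq : Continuous fun p : (ℝ × ℝ) × Plane => lineEq p.1 p.2 := by
  unfold lineEq
  fun_prop

/-- A form of the tube lemma: compactness makes the condition open in the line. -/
theorem isOpen_setOf_forall_mem {M : Set Plane} (hM : IsCompact M) {U : Set ((ℝ × ℝ) × Plane)}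
    (hU : IsOpen U) : IsOpen {ℓ | ∀ z ∈ M, (ℓ, z) ∈ U} := by
  rw [isOpen_iff_mem_nhds]
  intro ℓ hℓ
  exact hM.eventually_forall_of_forall_eventually fun z hz => hU.mem_nhds (hℓ z hz)

/-- Every direction is that of a line. -/
theorem exists_lineDir {d : Plane} (hd : d ≠ 0) :
    ∃ θ ∈ Icc 0 Real.pi, ∀ r, ∃ k : ℝ, k ≠ 0 ∧ lineDir (θ, r) = k • d := by
  have hc : ContinuousOn (fun θ : ℝ => Real.sin θ * d 1 + Real.cos θ * d 0) (uIcc 0 Real.pi) := by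
    fun_prop
  have h0 : (0 : ℝ) ∈ uIcc (Real.sin 0 * d 1 + Real.cos 0 * d 0)
      (Real.sin Real.pi * d 1 + Real.cos Real.pi * d 0) := by
    simp only [Real.sin_zero, Real.cos_zero, Real.sin_pi, Real.cos_pi, mem_uIcc]
    rcases le_total (d 0) 0 with h | h
    · left; constructor <;> linarith
    · right; constructor <;> linarith
  obtain ⟨θ, hθ, h⟩ := intermediate_value_uIcc hc h0
  rw [uIcc_of_le Real.pi_pos.le] at hθ
  refine ⟨θ, hθ, fun r => ?_⟩
  have h1 : cross d (lineDir (θ, r)) = 0 := by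
    have h : Real.sin θ * d 1 + Real.cos θ * d 0 = 0 := h
    simp [cross, lineDir]; linarith
  obtain ⟨k, hk⟩ := exists_smul_of_cross_eq_zero hd h1
  refine ⟨k, ?_, hk⟩
  rintro rfl
  rw [zero_smul] at hk
  exact lineDir_ne_zero _ hk

theorem lineMeasure_pos {W : Set (ℝ × ℝ)} (hW : IsOpen W) (hne : W.Nonempty)
    (hsub : W ⊆ Ioo 0 Real.pi ×ˢ univ) : 0 < lineMeasure W := by
  have h1 : 0 < volume W := hW.measure_pos volume hne
  have h2 : W ∩ Ico 0 Real.pi ×ˢ univ = W :=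
    inter_eq_left.2 (hsub.trans (prod_mono_left Ioo_subset_Ico_self))
  rw [lineMeasure, Measure.smul_apply, Measure.restrict_apply hW.measurableSet, h2, smul_eq_mul]
  refine ENNReal.mul_pos ?_ h1.ne'
  rw [Ne, ENNReal.ofReal_eq_zero, not_le]
  have := Real.pi_pos
  positivity

/-- Generic lines which separate a point from a compact part of a line. -/
theorem exists_separating_lines {M : Set Plane} (hM : IsCompact M) {S : Set Plane} (hS : S.Finite)
    {d v x : Plane} (hMd : ∀ z ∈ M, cross d (z - v) = 0)
    (hx : cross d (x - v) ≠ 0) :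
    ∃ W : Set (ℝ × ℝ), IsOpen W ∧ W.Nonempty ∧ W ⊆ Ioo 0 Real.pi ×ˢ univ ∧ ∀ ℓ ∈ W,
      lineEq ℓ v * lineEq ℓ x < 0 ∧ (∀ z ∈ M, lineEq ℓ z ≠ 0) ∧ ∀ z ∈ S, lineEq ℓ z ≠ 0 := by
  have hd : d ≠ 0 := ne_zero_left_of_cross hx
  obtain ⟨θ, hθ, hdir⟩ := exists_lineDir hd
  -- The line with direction `d` halfway between `v` and `x`. It separates them and misses `M`,
  -- which is on the parallel through `v`.
  set r := (lineEq (θ, 0) v + lineEq (θ, 0) x) / 2 with hr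
  obtain ⟨k, hk, hkd⟩ := hdir r
  have hshift : ∀ z, lineEq (θ, r) z = lineEq (θ, 0) z - r := fun z => by simp [lineEq]
  have hvx : lineEq (θ, r) x - lineEq (θ, r) v = k * cross d (x - v) := by
    rw [lineEq_sub, hkd, cross_smul_left]
  have hsum : lineEq (θ, r) x + lineEq (θ, r) v = 0 := by rw [hshift, hshift, hr]; ring
  have hkx : k * cross d (x - v) ≠ 0 := mul_ne_zero hk hx
  have hMv : ∀ z ∈ M, lineEq (θ, r) z = lineEq (θ, r) v := by
    intro z hz
    rw [← sub_eq_zero, lineEq_sub, hkd, cross_smul_left, hMd z hz, mul_zero]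
  have hv0 : lineEq (θ, r) v ≠ 0 := fun h => hkx (by rw [← hvx]; linarith)
  let W₁ : Set (ℝ × ℝ) := {ℓ | lineEq ℓ v * lineEq ℓ x < 0}
  let W₂ : Set (ℝ × ℝ) := {ℓ | ∀ z ∈ M, (ℓ, z) ∈ {p : (ℝ × ℝ) × Plane | lineEq p.1 p.2 ≠ 0}}
  have hcz : ∀ z, Continuous fun ℓ : ℝ × ℝ => lineEq ℓ z := fun z =>
    continuous_lineEq.comp (Continuous.prodMk_left z)
  have hW₁ : IsOpen W₁ := isOpen_lt ((hcz v).mul (hcz x)) continuous_const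
  have hW₂ : IsOpen W₂ := isOpen_setOf_forall_mem hM (isOpen_ne_fun continuous_lineEq
    continuous_const)
  have h1 : (θ, r) ∈ W₁ := by
    change lineEq (θ, r) v * lineEq (θ, r) x < 0
    rw [show lineEq (θ, r) x = -lineEq (θ, r) v by linarith]
    nlinarith [mul_self_pos.2 hv0]
  have h2 : (θ, r) ∈ W₂ := fun z hz => by
    change lineEq (θ, r) z ≠ 0
    rw [hMv z hz]; exact hv0
  have hopen : IsOpen ((W₁ ∩ W₂) ∩ Ioo 0 Real.pi ×ˢ univ) :=
    (hW₁.inter hW₂).inter (isOpen_Ioo.prod isOpen_univ)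
  -- The angle found so far may be `0` or `π`; as the conditions are open, it can be moved into the
  -- open interval.
  obtain ⟨⟨θ₁, r₁⟩, hW, hW'⟩ : ((W₁ ∩ W₂) ∩ Ioo 0 Real.pi ×ˢ univ).Nonempty := by
    have hcl : (θ, r) ∈ closure (Ioo 0 Real.pi ×ˢ (univ : Set ℝ)) := by
      rw [closure_prod_eq, closure_Ioo Real.pi_pos.ne, closure_univ]
      exact ⟨hθ, mem_univ _⟩
    exact mem_closure_iff.1 hcl _ (hW₁.inter hW₂) ⟨h1, h2⟩
  have hSopen : IsOpen {ℓ : ℝ × ℝ | ∀ z ∈ S, lineEq ℓ z ≠ 0} := by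
    have : {ℓ : ℝ × ℝ | ∀ z ∈ S, lineEq ℓ z ≠ 0} = ⋂ z ∈ S, {ℓ | lineEq ℓ z ≠ 0} := by
      ext ℓ; simp
    rw [this]
    exact hS.isOpen_biInter fun z _ => isOpen_ne_fun (hcz z) continuous_const
  refine ⟨_, hopen.inter hSopen, ?_, fun ℓ hℓ => hℓ.1.2, fun ℓ hℓ => ⟨hℓ.1.1.1, hℓ.1.1.2, hℓ.2⟩⟩
  have hsl : {r : ℝ | (θ₁, r) ∈ (W₁ ∩ W₂) ∩ Ioo 0 Real.pi ×ˢ univ} ∈ 𝓝 r₁ :=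
    (hopen.preimage (Continuous.prodMk_right θ₁)).mem_nhds ⟨hW, hW'⟩
  -- At the fixed angle `θ₁`, each point of `S` excludes a single offset.
  have hinf := infinite_of_mem_nhds r₁ hsl
  obtain ⟨r₂, hr₂, hn⟩ := (hinf.sdiff (hS.image fun z => lineEq (θ₁, 0) z)).nonempty
  refine ⟨(θ₁, r₂), hr₂, fun z hz h => hn ⟨z, hz, ?_⟩⟩
  have : lineEq (θ₁, r₂) z = lineEq (θ₁, 0) z - r₂ := by simp [lineEq]
  change lineEq (θ₁, 0) z = r₂
  linarith

end TTess

namespace TTess.TTessellation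

/-! ### Leading every T-tessellation to the empty one -/

variable {D : Set Plane} {T : TTessellation D}

/-- A finite set which meets all the lines of a finite set, and contains all the points where
lines carrying segments cross. -/
theorem exists_finite_avoid (T : TTessellation D) {O : Set (Set Plane)} (hO : O.Finite)
    (hOl : ∀ L ∈ O, IsLine L) : ∃ S : Set Plane, S.Finite ∧ T.vertices ⊆ S ∧
      (∀ L ∈ T.carriers, ∀ M ∈ T.carriers, L ≠ M → ∀ z ∈ L, z ∈ M → z ∈ S) ∧
      ∀ L ∈ O, ∃ z ∈ S, z ∈ L := by
  have hcross : (⋃ L ∈ T.carriers, ⋃ M ∈ T.carriers \ {L}, L ∩ M).Finite :=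
    T.finite_carriers.biUnion fun L hL => (T.finite_carriers.subset sdiff_subset).biUnion
      fun M hM => (IsLine.inter_subsingleton (isLine_of_mem_carriers hL)
        (isLine_of_mem_carriers hM.1) fun h => hM.2 h.symm).finite
  have hpt : ∀ L ∈ O, ∃ z, z ∈ L := by
    intro L hL
    obtain ⟨x, y, -, rfl⟩ := hOl L hL
    exact ⟨x, left_mem_lineOf x y⟩
  choose! pt hpt using hpt
  refine ⟨T.vertices ∪ (⋃ L ∈ T.carriers, ⋃ M ∈ T.carriers \ {L}, L ∩ M) ∪ pt '' O,
    (T.finite_vertices.union hcross).union (hO.image pt),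
    subset_union_left.trans subset_union_left, ?_,
    fun L hL => ⟨pt L, Or.inr ⟨L, hL, rfl⟩, hpt L hL⟩⟩
  intro L hL M hM hne z hzL hzM
  refine Or.inl (Or.inr (mem_biUnion hL (mem_biUnion (x := M) ⟨hM, fun h => hne ?_⟩ ⟨hzL, hzM⟩)))
  exact (mem_singleton_iff.1 h).symm

/-- If no merge is applicable, then a candidate for a flip, even a blocked one, becomes a flip
after a suitable split. -/
theorem FlipData.exists_split_flip {a b v x d e : Plane} {κ ξ : ℝ}
    (F : FlipData T a b v x d e κ ξ) (hD : IsConvexPolygon D) (hno : ¬ Applicable .merge T)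
    {O : Set (Set Plane)} (hO : O.Finite) (hOl : ∀ L ∈ O, IsLine L) (hG : T.Generic O) :
    ∃ C, ∃ W : Set (ℝ × ℝ), IsOpen W ∧ W.Nonempty ∧ W ⊆ Ioo 0 Real.pi ×ˢ univ ∧
      ∀ ℓ ∈ W, ∃ T' : TTessellation D, IsSplitBy T C (line ℓ) T' ∧ IsMerge T' T ∧
        (∀ T'', IsMerge T' T'' → T'' = T) ∧ ∃ T₂, IsFlip T' T₂ ∧ IsFlip T₂ T' ∧ T₂.Generic O ∧
          T₂.innerCarriers ∩ O ⊆ T.innerCarriers ∩ O ∧ lineOf a b ∈ T₂.innerCarriers ∧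
          T₂.nodes (lineOf a b) ⊂ T.nodes (lineOf a b) := by
  obtain ⟨C, hC, -, -, -, hvx, hseg⟩ := F.exists_far_cell hD
  obtain ⟨S, hS, hVS, hcross, hOS⟩ := T.exists_finite_avoid hO hOl
  have hab := F.seg.1.endpoints.1
  have hLcl : IsClosed (lineOf a b) :=
    isClosed_eq ((continuous_cross _).comp (continuous_id.sub continuous_const)) continuous_const
  obtain ⟨W, hWo, hWn, hWs, hW⟩ := exists_separating_lines
    ((T.isConvexPolygon C hC).isCompact.inter_right hLcl) hS (d := d) (v := v) (x := x)
    (fun z hz => (F.cross_ab_iff z).1 hz.2)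
    (by rw [F.cross_x]; exact neg_ne_zero.2 (mul_pos F.xi F.tee.1).ne')
  refine ⟨C, W, hWo, hWn, hWs, fun ℓ hℓ => ?_⟩
  obtain ⟨hsep, hM, hSℓ⟩ := hW ℓ hℓ
  -- The point where the separating line crosses `[v, x]`, inside the cell `C`.
  obtain ⟨q, hqo, hq⟩ : ∃ q ∈ openSegment ℝ v x, q ∈ line ℓ := by
    set A := lineEq ℓ v
    set B := lineEq ℓ x
    have hAB : A - B ≠ 0 := by
      intro h
      rw [sub_eq_zero.1 h] at hsep
      nlinarith [mul_self_nonneg B]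
    have hc2 : 0 < (A - B) * (A - B) := mul_self_pos.2 hAB
    refine ⟨v + (A / (A - B)) • (x - v), mem_oseg.2 ⟨_, ?_, ?_, rfl⟩, ?_⟩
    · rw [← mul_div_mul_right _ _ hAB]
      exact div_pos (by nlinarith [mul_self_nonneg A]) hc2
    · rw [← mul_div_mul_right _ _ hAB, div_lt_one hc2]
      nlinarith [mul_self_nonneg B]
    · have h1 := lineEq_sub ℓ (v + (A / (A - B)) • (x - v)) v
      rw [add_sub_cancel_left, cross_smul_right, ← lineEq_sub] at h1
      rw [mem_line]
      have h2 : A / (A - B) * (A - B) = A := div_mul_cancel₀ _ hAB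
      change _ - A = A / (A - B) * (B - A) at h1
      linarith
  have hline := line_eq_setOf hq
  have heq := lineEq_eq_cross hq
  obtain ⟨T', hT'⟩ := exists_split hD hC (hvx hqo) (lineDir_ne_zero ℓ)
    (fun z hz => by rw [← heq]; exact hSℓ z (hVS hz))
  have Sd : SplitData T T' C q (lineDir ℓ) := ⟨hC, hvx hqo, lineDir_ne_zero ℓ,
    fun z hz => by rw [← heq]; exact hSℓ z (hVS hz), hT'⟩
  have hL : ∀ z ∈ C, z ∈ lineOf a b → cross (lineDir ℓ) (z - q) ≠ 0 := fun z hz hz' => by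
    rw [← heq]; exact hM z ⟨hz, hz'⟩
  obtain ⟨x', ξ', F', hx'⟩ := Sd.exists_flipData hD F hvx hL (by rwa [← heq, ← heq])
  obtain ⟨T₂, hT₂⟩ := F'.exists_flip hD hx'
  have hG' : T'.Generic O := Sd.generic hG fun L hL M hM hne z hzL hzM => by
    rw [← heq]; exact hSℓ z (hcross L hL M hM hne z hzL hzM)
  obtain ⟨hc1, hc2⟩ := F'.flip_carriers hD hT₂
  have hvC : v ∈ C := (hseg.ge (left_mem_segment ℝ _ _)).1
  have hvL := segment_subset_lineOf _ _ (openSegment_subset_segment ℝ _ _ F.mem)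
  refine ⟨T', ⟨hC, ⟨q, hq, hvx hqo⟩, by rw [hT', hline, inter_comm C]⟩, Sd.chord_isMerge hD,
    fun T'' => Sd.eq_of_isMerge hD hno, T₂, F'.isFlip hD hT₂, F'.isFlip_symm hD hT₂,
    hG'.mono hc1 hc2, ?_, F'.flip_lineOf_mem hD hT₂, (F'.flip_nodes hD hT₂).trans_subset
      (Sd.nodes_subset hD ⟨a, b, hab, rfl⟩ ?_ hL)⟩
  -- The new line is not in `O`: each line of `O` has a point in `S`, and the new line avoids `S`.
  · rintro L ⟨hL, hLO⟩
    refine ⟨(Sd.innerCarriers_subset (hc2 hL)).resolve_left ?_, hLO⟩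
    rintro rfl
    obtain ⟨z, hz, hzl⟩ := hOS _ hLO
    exact hSℓ z hz (by rw [heq]; exact hzl)
  · intro h
    rw [h] at hvL
    exact hL v hvC (h ▸ hvL) hvL

/-- A set of T-tessellations which is closed under going back along merges, flips and generic
splits, in the sense below, and contains the empty tessellation, contains all T-tessellations. -/
theorem mem_of_closed (hD : IsConvexPolygon D) {A : Set (TTessellation D)}
    (h0 : emptyTessellation hD ∈ A)
    (hM : ∀ T, Applicable .merge T → ∃ T', IsMerge T T' ∧ (T' ∈ A → T ∈ A))
    (hF : ∀ T T', IsFlip T T' → IsFlip T' T → T' ∈ A → T ∈ A)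
    (hS : ∀ (T : TTessellation D) (C : Set Plane) (W : Set (ℝ × ℝ)), IsOpen W → W.Nonempty →
      W ⊆ Ioo 0 Real.pi ×ˢ univ → ∀ Tf : ℝ × ℝ → TTessellation D,
      (∀ ℓ ∈ W, IsSplitBy T C (line ℓ) (Tf ℓ) ∧ IsMerge (Tf ℓ) T ∧
        (∀ T'', IsMerge (Tf ℓ) T'' → T'' = T) ∧ (∃ T₂, IsFlip (Tf ℓ) T₂) ∧ Tf ℓ ∈ A) → T ∈ A)
    (T : TTessellation D) : T ∈ A := by
  -- Once no line of `O` carries an internal segment, all inner carriers are generic and no split is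
  -- needed. The induction is lexicographic: merges decrease the number of inner carriers, and flips
  -- do not increase it but decrease the nodes of a chosen carrier.
  have disj : ∀ (O : Set (Set Plane)) (n : ℕ) (T : TTessellation D), T.Generic O →
      T.innerCarriers ∩ O = ∅ → T.innerCarriers.ncard ≤ n → T ∈ A := by
    intro O n
    induction n with
    | zero =>
      intro T _ _ hn
      rw [Nat.le_zero, ncard_eq_zero T.finite_innerCarriers] at hn
      rwa [eq_emptyTessellation hD hn]
    | succ n ih =>
      intro T hG hTO hn
      rcases T.innerCarriers.eq_empty_or_nonempty with h | ⟨L, hL⟩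
      · rwa [eq_emptyTessellation hD h]
      obtain ⟨k, hk⟩ : ∃ k, (T.nodes L).ncard < k := ⟨_, Nat.lt_succ_self _⟩
      induction k generalizing T with
      | zero => exact absurd hk (Nat.not_lt_zero _)
      | succ k ihk =>
        by_cases hm : Applicable .merge T
        · obtain ⟨T', hTT', hA⟩ := hM T hm
          obtain ⟨hsub, hss, -⟩ := merge_facts hD hTT'
          refine hA (ih T' (hG.mono (carriers_mono hsub) hss.1) ?_ ?_)
          · exact subset_empty_iff.1 (hTO ▸ inter_subset_inter_left O hss.1)
          · have := ncard_lt_ncard hss T.finite_innerCarriers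
            omega
        · obtain ⟨a, b, v, x, d, e, κ, ξ, F, rfl⟩ := exists_flipData hD hm hL
          have hxV := F.x_notMem_vertices hD hG hTO
          obtain ⟨T₂, hT₂⟩ := F.exists_flip hD hxV
          obtain ⟨hc1, hc2⟩ := F.flip_carriers hD hT₂
          refine hF T T₂ (F.isFlip hD hT₂) (F.isFlip_symm hD hT₂) (ihk T₂ (hG.mono hc1 hc2) ?_ ?_
            (F.flip_lineOf_mem hD hT₂) ?_)
          · exact subset_empty_iff.1 (hTO ▸ inter_subset_inter_left O hc2)
          · exact (ncard_le_ncard hc2 T.finite_innerCarriers).trans hn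
          · have := ncard_lt_ncard (F.flip_nodes hD hT₂) (T.finite_nodes _)
            omega
  -- Lexicographic induction on the number of lines of `O` which still carry an internal segment,
  -- the number of nodes of one of them, `L`, and the number of inner carriers. The latter comes
  -- last because a split may increase it.
  have main : ∀ (O : Set (Set Plane)), O.Finite → (∀ L ∈ O, IsLine L) → ∀ (o : ℕ)
      (T : TTessellation D), T.Generic O → (T.innerCarriers ∩ O).ncard ≤ o → T ∈ A := by
    intro O hO hOl o
    induction o with
    | zero =>
      intro T hG ho
      rw [Nat.le_zero, ncard_eq_zero (hO.subset inter_subset_right)] at ho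
      exact disj O _ T hG ho le_rfl
    | succ o ih =>
      intro T hG ho
      rcases (T.innerCarriers ∩ O).eq_empty_or_nonempty with h | ⟨L, hL, hLO⟩
      · exact disj O _ T hG h le_rfl
      obtain ⟨k, hk⟩ : ∃ k, (T.nodes L).ncard < k := ⟨_, Nat.lt_succ_self _⟩
      induction k generalizing T with
      | zero => exact absurd hk (Nat.not_lt_zero _)
      | succ k ihk =>
        obtain ⟨n, hn⟩ : ∃ n, T.innerCarriers.ncard < n := ⟨_, Nat.lt_succ_self _⟩
        induction n generalizing T with
        | zero => exact absurd hn (Nat.not_lt_zero _)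
        | succ n ihn =>
          by_cases hm : Applicable .merge T
          · obtain ⟨T', hTT', hA⟩ := hM T hm
            obtain ⟨hsub, hss, hnodes⟩ := merge_facts hD hTT'
            have hG' := hG.mono (carriers_mono hsub) hss.1
            have hle : T'.innerCarriers ∩ O ⊆ T.innerCarriers ∩ O := inter_subset_inter_left O hss.1
            by_cases hL' : L ∈ T'.innerCarriers
            · refine hA (ihn T' hG' ((ncard_le_ncard hle (hO.subset inter_subset_right)).trans ho)
                hL' ((ncard_le_ncard (hnodes L) (T.finite_nodes L)).trans_lt hk) ?_)
              have := ncard_lt_ncard hss T.finite_innerCarriers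
              omega
            · refine hA (ih T' hG' ?_)
              have hlt : T'.innerCarriers ∩ O ⊂ T.innerCarriers ∩ O :=
                ⟨hle, fun h => hL' (h ⟨hL, hLO⟩).1⟩
              have := ncard_lt_ncard hlt (hO.subset inter_subset_right)
              omega
          · obtain ⟨a, b, v, x, d, e, κ, ξ, F, rfl⟩ := exists_flipData hD hm hL
            obtain ⟨C, W, hWo, hWn, hWs, hW⟩ := F.exists_split_flip hD hm hO hOl hG
            have : Nonempty (TTessellation D) := ⟨T⟩
            choose! Tf hTf using hW
            refine hS T C W hWo hWn hWs Tf fun ℓ hℓ => ?_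
            obtain ⟨h1, h2, h3, T₂, h4, h5, h6, h7, h8, h9⟩ := hTf ℓ hℓ
            refine ⟨h1, h2, h3, ⟨T₂, h4⟩, hF _ _ h4 h5 (ihk T₂ h6
              ((ncard_le_ncard h7 (hO.subset inter_subset_right)).trans ho) h8 ?_)⟩
            have := ncard_lt_ncard h9 (T.finite_nodes _)
            omega
  -- With the inner carriers of `T` itself as `O`, the genericity condition is void.
  exact main T.innerCarriers T.finite_innerCarriers
    (fun L hL => isLine_of_mem_carriers (innerCarriers_subset hL)) _ T
    (fun L hL hLO => absurd hL hLO) le_rfl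

end TTess.TTessellation

/-! ### The Markov chain -/

namespace TTess

variable {D : Set Plane} {T T' : TTessellation D}

/-- A line misses a compact part of the cell on an open set of lines. The preimage of a hitting
event is therefore everything or a difference of two open sets. -/
theorem measurable_of_isSplitBy {C : Set Plane} (hC : IsClosed C) {W : Set (ℝ × ℝ)} (hW : IsOpen W)
    {Tf : ℝ × ℝ → TTessellation D}
    (hin : ∀ ℓ ∈ W, (Tf ℓ).skeleton = T.skeleton ∪ line ℓ ∩ C) (hout : ∀ ℓ ∉ W, Tf ℓ = T) :
    Measurable Tf := by
  refine measurable_generateFrom ?_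
  rintro _ ⟨K, hK, -, rfl⟩
  by_cases hT : (T.skeleton ∩ K).Nonempty
  · have : Tf ⁻¹' {T : TTessellation D | (T.skeleton ∩ K).Nonempty} = univ := by
      refine eq_univ_of_forall fun ℓ => ?_
      change ((Tf ℓ).skeleton ∩ K).Nonempty
      by_cases hℓ : ℓ ∈ W
      · rw [hin ℓ hℓ]
        exact hT.mono (inter_subset_inter_left _ subset_union_left)
      · rwa [hout ℓ hℓ]
    rw [this]
    exact MeasurableSet.univ
  · have hM : IsOpen {ℓ | ∀ z ∈ K ∩ C, (ℓ, z) ∈ {p : (ℝ × ℝ) × Plane | lineEq p.1 p.2 ≠ 0}} :=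
      isOpen_setOf_forall_mem (hK.inter_right hC) (isOpen_ne_fun continuous_lineEq continuous_const)
    have : Tf ⁻¹' {T : TTessellation D | (T.skeleton ∩ K).Nonempty} =
        W \ {ℓ | ∀ z ∈ K ∩ C, (ℓ, z) ∈ {p : (ℝ × ℝ) × Plane | lineEq p.1 p.2 ≠ 0}} := by
      ext ℓ
      change ((Tf ℓ).skeleton ∩ K).Nonempty ↔ ℓ ∈ W ∧ ¬ ∀ z ∈ K ∩ C, lineEq ℓ z ≠ 0
      by_cases hℓ : ℓ ∈ W
      · rw [hin ℓ hℓ]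
        push Not
        constructor
        · rintro ⟨z, hz | hz, hzK⟩
          · exact absurd ⟨z, hz, hzK⟩ hT
          · exact ⟨hℓ, z, ⟨hzK, hz.2⟩, mem_line.1 hz.1⟩
        · rintro ⟨-, z, hz, hz'⟩
          exact ⟨z, Or.inr ⟨mem_line.2 hz', hz.2⟩, hz.1⟩
      · rw [hout ℓ hℓ]
        exact ⟨fun h => absurd h hT, fun h => absurd h.1 hℓ⟩
    rw [this]
    exact hW.measurableSet.diff hM.measurableSet

namespace MHGInput

variable (I : MHGInput D)

/-- Only the numerators matter, since a positive number divided by zero is `∞`. -/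
theorem acceptance_pos {t : UpdateType} (h1 : 0 < I.h T') (h2 : 0 < I.p t.inv T')
    (h3 : 0 < I.q t.inv T' T) : 0 < I.acceptance t T T' := by
  have key : ∀ {a b : ℝ≥0}, 0 < a → (a : ℝ≥0∞) / b ≠ 0 := fun ha =>
    (ENNReal.div_pos (ENNReal.coe_ne_zero.2 ha.ne') ENNReal.coe_ne_top).ne'
  refine lt_min one_pos (pos_iff_ne_zero.2 ?_)
  exact mul_ne_zero (mul_ne_zero (key h1) (key h2)) (key h3)

theorem measurable_acceptance (t : UpdateType) (T : TTessellation D) :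
    Measurable (I.acceptance t T) := by
  have hq : ∀ t, Measurable fun T' => I.q t T T' := fun t =>
    (I.measurable_q t).comp measurable_prodMk_left
  have hq' : ∀ t, Measurable fun T' => I.q t T' T := fun t =>
    (I.measurable_q t).comp measurable_prodMk_right
  have h1 : Measurable fun T' => ((I.h T' : ℝ≥0∞) / I.h T) :=
    I.measurable_h.coe_nnreal_ennreal.div_const _
  have h2 : Measurable fun T' => ((I.p t.inv T' : ℝ≥0∞) / I.p t T) :=
    (I.measurable_p t.inv).coe_nnreal_ennreal.div_const _
  have h3 : Measurable fun T' => ((I.q t.inv T' T : ℝ≥0∞) / I.q t T T') :=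
    (hq' t.inv).coe_nnreal_ennreal.div (hq t).coe_nnreal_ennreal
  exact measurable_const.min ((h1.mul h2).mul h3)

/-- Keeps only the mass of the accepted proposal. -/
theorem le_proposal {t : UpdateType} {A : Set (TTessellation D)} (hT' : T' ∈ A) :
    I.q t T T' * I.acceptance t T T' ≤ I.q t T T' * (I.acceptance t T T' * A.indicator 1 T' +
      (1 - I.acceptance t T T') * A.indicator 1 T) := by
  gcongr
  rw [indicator_of_mem hT', Pi.one_apply, mul_one]
  exact le_self_add

theorem proposal_pos {t : UpdateType} (h0 : 0 < I.q t T T') (h1 : 0 < I.h T')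
    (h2 : 0 < I.p t.inv T') (h3 : 0 < I.q t.inv T' T) :
    0 < (I.q t T T' : ℝ≥0∞) * I.acceptance t T T' :=
  ENNReal.mul_pos (ENNReal.coe_ne_zero.2 h0.ne') (I.acceptance_pos h1 h2 h3).ne'

theorem transition_pos {t : UpdateType} {A : Set (TTessellation D)} (hp : 0 < I.p t T)
    (h : 0 < I.typeTransition t T A) : 0 < I.transition T A := by
  have h1 := ENNReal.mul_pos (ENNReal.coe_ne_zero.2 hp.ne') h.ne'
  cases t
  · exact h1.trans_le (le_self_add.trans le_self_add)
  · exact h1.trans_le (le_add_self.trans le_self_add)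
  · exact h1.trans_le le_add_self

theorem transition_pos_of_isMerge {A : Set (TTessellation D)} (hT' : T' ∈ A) (h : IsMerge T T')
    (hp : 0 < I.p .merge T) (hq : 0 < I.q .merge T T') (h1 : 0 < I.h T') (h2 : 0 < I.p .split T')
    (h3 : 0 < I.q .split T' T) : 0 < I.transition T A := by
  refine I.transition_pos hp ?_
  rw [typeTransition, if_pos ⟨T', h⟩]
  exact ((I.proposal_pos (t := .merge) hq h1 h2 h3).trans_le (I.le_proposal hT')).trans_le
    (ENNReal.le_tsum (f := fun T' : {T' // IsMerge T T'} => (I.q .merge T T' : ℝ≥0∞) *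
      (I.acceptance .merge T T' * A.indicator 1 T'.1 +
        (1 - I.acceptance .merge T T') * A.indicator 1 T)) ⟨T', h⟩)

theorem transition_pos_of_isFlip {A : Set (TTessellation D)} (hT' : T' ∈ A) (h : IsFlip T T')
    (hp : 0 < I.p .flip T) (hq : 0 < I.q .flip T T') (h1 : 0 < I.h T') (h2 : 0 < I.p .flip T')
    (h3 : 0 < I.q .flip T' T) : 0 < I.transition T A := by
  refine I.transition_pos hp ?_
  rw [typeTransition, if_pos ⟨T', h⟩]
  exact ((I.proposal_pos (t := .flip) hq h1 h2 h3).trans_le (I.le_proposal hT')).trans_le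
    (ENNReal.le_tsum (f := fun T' : {T' // IsFlip T T'} => (I.q .flip T T' : ℝ≥0∞) *
      (I.acceptance .flip T T' * A.indicator 1 T'.1 +
        (1 - I.acceptance .flip T T') * A.indicator 1 T)) ⟨T', h⟩)

/-- Splits are proposed with a density, so a single line contributes nothing, but a non-empty open
set of lines has positive measure. -/
theorem transition_pos_of_isSplitBy {A : Set (TTessellation D)} {C : Set Plane} {W : Set (ℝ × ℝ)}
    (hW : IsOpen W) (hne : W.Nonempty) (hsub : W ⊆ Ioo 0 Real.pi ×ˢ univ)
    {Tf : ℝ × ℝ → TTessellation D} (hp : 0 < I.p .split T)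
    (h : ∀ ℓ ∈ W, IsSplitBy T C (line ℓ) (Tf ℓ) ∧ Tf ℓ ∈ A ∧ 0 < I.q .split T (Tf ℓ) ∧
      0 < I.h (Tf ℓ) ∧ 0 < I.p .merge (Tf ℓ) ∧ 0 < I.q .merge (Tf ℓ) T) :
    0 < I.transition T A := by
  classical
  refine I.transition_pos hp ?_
  obtain ⟨ℓ₀, hℓ₀⟩ := hne
  have hC := (h ℓ₀ hℓ₀).1.1
  rw [typeTransition, if_pos ⟨Tf ℓ₀, ℓ₀, Ioo_subset_Ico_self (hsub hℓ₀).1, C, (h ℓ₀ hℓ₀).1⟩]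
  -- `Tf` is arbitrary outside `W`; replacing it there by `T` gives a measurable map.
  let Tg : ℝ × ℝ → TTessellation D := fun ℓ => if ℓ ∈ W then Tf ℓ else T
  have hin : ∀ ℓ ∈ W, Tg ℓ = Tf ℓ := fun ℓ hℓ => if_pos hℓ
  have hTg : Measurable Tg := measurable_of_isSplitBy (T.isConvexPolygon C hC).isClosed hW
    (fun ℓ hℓ => by rw [hin ℓ hℓ, (h ℓ hℓ).1.2.2]) (fun ℓ hℓ => if_neg hℓ)
  -- A measurable lower bound of the integrand, with the support needed for a positive integral;
  -- measurability of the whole integrand is then not required.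
  let g : ℝ × ℝ → ℝ≥0∞ :=
    W.indicator fun ℓ => (I.q .split T (Tg ℓ) : ℝ≥0∞) * I.acceptance .split T (Tg ℓ)
  have hg : Measurable g := by
    refine Measurable.indicator (Measurable.mul ?_ ?_) hW.measurableSet
    · exact (((I.measurable_q .split).comp measurable_prodMk_left).comp hTg).coe_nnreal_ennreal
    · exact (I.measurable_acceptance .split T).comp hTg
  have hpos : 0 < ∫⁻ ℓ, g ℓ ∂lineMeasure := by
    rw [lintegral_pos_iff_support hg]
    refine (lineMeasure_pos hW ⟨ℓ₀, hℓ₀⟩ hsub).trans_le (measure_mono fun ℓ hℓ => ?_)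
    obtain ⟨-, -, h1, h2, h3, h4⟩ := h ℓ hℓ
    simp only [Function.mem_support, g]
    rw [indicator_of_mem hℓ, hin ℓ hℓ]
    exact (I.proposal_pos (t := .split) h1 h2 h3 h4).ne'
  refine hpos.trans_le (lintegral_mono fun ℓ => ?_)
  by_cases hℓ : ℓ ∈ W
  · obtain ⟨h0, h1, -⟩ := h ℓ hℓ
    simp only [g]
    rw [indicator_of_mem hℓ, hin ℓ hℓ]
    refine (I.le_proposal h1).trans (le_trans ?_ (ENNReal.le_tsum ⟨C, hC⟩))
    exact ENNReal.le_tsum (f := fun T' : {T' // IsSplitBy T C (line ℓ) T'} =>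
      (I.q .split T T' : ℝ≥0∞) * (I.acceptance .split T T' * A.indicator 1 T'.1 +
        (1 - I.acceptance .split T T') * A.indicator 1 T)) ⟨Tf ℓ, h0⟩
  · simp only [g]
    rw [indicator_of_notMem hℓ]
    exact zero_le

/-- Acceptance and rejection add up to one, and the proposal is normalised. -/
theorem typeTransition_univ (t : UpdateType) (T : TTessellation D) :
    I.typeTransition t T univ = 1 := by
  rw [typeTransition]
  split_ifs with h
  · refine Eq.trans ?_ (I.integral_q t T h)
    congr 1
    funext T'
    have : I.acceptance t T T' ≤ 1 := min_le_left _ _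
    simp only [indicator_univ, Pi.one_apply, mul_one]
    rw [add_tsub_cancel_of_le this, mul_one]
  · simp

theorem transition_univ (T : TTessellation D) : I.transition T univ = 1 := by
  simp only [transition, typeTransition_univ, mul_one]
  exact_mod_cast I.sum_p T

end MHGInput

/-- Otherwise, for every `n`, the states `y` with `0 < (κ ^ n) y B` form a null set for `κ x`, and
so does their countable union over `n`. -/
theorem exists_pow_pos {α : Type*} [MeasurableSpace α] {κ : Kernel α α} {B : Set α}
    (hB : MeasurableSet B) {x : α} (h : 0 < κ x {y | ∃ n : ℕ, 0 < (κ ^ n) y B}) :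
    ∃ n : ℕ, 0 < (κ ^ (n + 1)) x B := by
  by_contra! hn
  refine h.ne' ?_
  rw [show {y | ∃ n : ℕ, 0 < (κ ^ n) y B} = ⋃ n : ℕ, {y | 0 < (κ ^ n) y B} by ext; simp]
  refine measure_iUnion_null fun n => ?_
  have h1 := hn n
  rw [add_comm, Kernel.pow_add_apply_eq_lintegral _ _ _ _ hB, pow_one, nonpos_iff_eq_zero,
    lintegral_eq_zero_iff (Kernel.measurable_coe _ hB)] at h1
  have h2 : ∀ᵐ y ∂κ x, (κ ^ n) y B = 0 := h1
  rw [ae_iff] at h2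
  simpa only [pos_iff_ne_zero] using h2

end TTess

/-! ### Irreducibility -/

theorem mainTheorem6 (D : Set TTess.Plane) (hD : TTess.IsConvexPolygon D)
    (I : TTess.MHGInput D)
    (κ : Kernel (TTess.TTessellation D) (TTess.TTessellation D))
    (hκ : I.IsTransitionKernel κ)
    (hmerge : ∀ T : TTess.TTessellation D, TTess.Applicable .merge T →
      ∃ T', TTess.IsMerge T T' ∧ 0 < I.p .merge T * I.q .merge T T' ∧
        0 < I.h T' * I.p .split T' * I.q .split T' T)
    (hflip : ∀ T T' : TTess.TTessellation D, TTess.IsFlip T T' →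
      0 < I.h T * I.p .flip T * I.q .flip T T') :
    TTess.IsPsiIrreducible (Measure.dirac (TTess.emptyTessellation hD)) κ := by
  intro B hB hpos
  rw [Measure.dirac_apply' _ hB] at hpos
  have hDB : TTess.emptyTessellation hD ∈ B := by
    by_contra hn
    rw [indicator_of_notMem hn] at hpos
    exact lt_irrefl _ hpos
  have hpos2 : ∀ {a b : ℝ≥0}, 0 < a * b → 0 < a ∧ 0 < b := fun h =>
    ⟨pos_of_mul_pos_left h zero_le, pos_of_mul_pos_right h zero_le⟩
  -- The states from which `B` can be reached, zero steps being allowed.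
  set A : Set (TTess.TTessellation D) := {T | ∃ n : ℕ, 0 < (κ ^ n) T B} with hAdef
  have hA : MeasurableSet A := by
    rw [hAdef, show {T | ∃ n : ℕ, 0 < (κ ^ n) T B} = ⋃ n : ℕ, {T | 0 < (κ ^ n) T B} by ext; simp]
    exact MeasurableSet.iUnion fun n =>
      measurableSet_lt measurable_const (Kernel.measurable_coe _ hB)
  have hstep : ∀ T, 0 < I.transition T A → T ∈ A := by
    intro T h
    rw [← hκ T A hA] at h
    obtain ⟨n, hn⟩ := TTess.exists_pow_pos hB h
    exact ⟨n + 1, hn⟩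
  have hall : ∀ T, T ∈ A := by
    refine TTess.TTessellation.mem_of_closed hD ⟨0, ?_⟩ ?_ ?_ ?_
    · rw [pow_zero, show (1 : Kernel (TTess.TTessellation D) (TTess.TTessellation D)) = Kernel.id from rfl,
        Kernel.id_apply, Measure.dirac_apply' _ hB, indicator_of_mem hDB]
      exact one_pos
    · intro T hT
      obtain ⟨T', h, h1, h2⟩ := hmerge T hT
      obtain ⟨hp, hq⟩ := hpos2 h1
      obtain ⟨h3, h5⟩ := hpos2 h2
      obtain ⟨h3, h4⟩ := hpos2 h3
      exact ⟨T', h, fun hT' => hstep T (I.transition_pos_of_isMerge hT' h hp hq h3 h4 h5)⟩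
    · intro T T' h h' hT'
      obtain ⟨h1, hq⟩ := hpos2 (hflip T T' h)
      obtain ⟨-, hp⟩ := hpos2 h1
      obtain ⟨h2, hq'⟩ := hpos2 (hflip T' T h')
      obtain ⟨hh, hp'⟩ := hpos2 h2
      exact hstep T (I.transition_pos_of_isFlip hT' h hp hq hh hp' hq')
    · intro T C W hW hne hsub Tf h
      -- The merge which `hmerge` provides at `Tf ℓ` can only be the reverse of the split, whence
      -- the positivity of both proposals. The factor `I.h (Tf ℓ)` is positive by `hflip`, because a
      -- flip applies to `Tf ℓ`.
      have key : ∀ ℓ ∈ W, 0 < I.p .split T ∧ 0 < I.q .split T (Tf ℓ) ∧ 0 < I.h (Tf ℓ) ∧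
          0 < I.p .merge (Tf ℓ) ∧ 0 < I.q .merge (Tf ℓ) T := by
        intro ℓ hℓ
        obtain ⟨-, h1, h2, ⟨T₂, h3⟩, -⟩ := h ℓ hℓ
        obtain ⟨T', h4, h5, h6⟩ := hmerge (Tf ℓ) ⟨T, h1⟩
        obtain rfl := h2 T' h4
        obtain ⟨h7, h8⟩ := hpos2 h6
        exact ⟨(hpos2 h7).2, h8, (hpos2 (hpos2 (hflip _ _ h3)).1).1, hpos2 h5⟩
      obtain ⟨ℓ₀, hℓ₀⟩ := hne
      exact hstep T (I.transition_pos_of_isSplitBy (C := C) (Tf := Tf) hW ⟨ℓ₀, hℓ₀⟩ hsub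
        (key ℓ₀ hℓ₀).1 fun ℓ hℓ => ⟨(h ℓ hℓ).1, (h ℓ hℓ).2.2.2.2, (key ℓ hℓ).2⟩)
  intro T
  -- One arbitrary first step, which stays in `A`, makes the number of steps positive, even when the
  -- chain starts at the empty tessellation.
  have h1 : 0 < κ T A := by
    rw [eq_univ_of_forall hall, hκ T univ MeasurableSet.univ, I.transition_univ]
    exact one_pos
  obtain ⟨n, hn⟩ := TTess.exists_pow_pos hB h1
  exact ⟨n + 1, Nat.le_add_left 1 n, hn⟩
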